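/- **Setting.** Formulas are built from propositional variables $p_0,p_1,\dots$ and $\top$ by $\land,\lor,\to,\neg$. The weight is $w(p_i)=w(\top)=1$, $w(\alpha\circ\beta)=w(\alpha)+w(\beta)+1$ for $\circ\in\{\land,\lor,\to\}$, $w(\neg\alpha)=w(\alpha)+1$. A sequent with history $\mathcal H\mid\Gamma\Rightarrow\varphi$ consists of a finite set $\mathcal H$ of formulas, a finite multiset $\Gamma$ of formulas and a formula $\varphi$ (the goal). The calculi $\mathrm{G3}^{Hist}$ have the following rules, written "conclusion $\Leftarrow$ premises"; in $(\to l),(\land l_i),(\lor l)$ the goal $\varphi$ is a variable, a negation or a disjunction, and $\varphi,\mathcal H$ stands for $\mathcal H\cup\{\varphi\}$. * (ax) $\mathcal H\mid\Gamma,p\Rightarrow p$ and $(\top)$ $\mathcal H\mid\Gamma\Rightarrow\top$, without premises. * $(\to r_1)$, if $\alpha\notin\Gamma$: $\mathcal H\mid\Gamma\Rightarrow\alpha\to\beta\ \Leftarrow\ \emptyset\mid\Gamma,\alpha\Rightarrow\beta$. $(\to r_2)$, if $\alpha\in\Gamma$: $\mathcal H\mid\Gamma\Rightarrow\alpha\to\beta\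 \Leftarrow\ \mathcal H\mid\Gamma\Rightarrow\beta$. * $(\to l)$, if $\varphi\notin\mathcal H$ and $\beta\notin\Gamma$: $\mathcal H\mid\Gamma,\alpha\to\beta\Rightarrow\varphi\ \Leftarrow\ \varphi,\mathcal H\mid\Gamma,\alpha\to\beta\Rightarrow\alpha$ and $\emptyset\mid\Gamma,\alpha\to\beta,\beta\Rightarrow\varphi$. * $(\land r)$: $\mathcal H\mid\Gamma\Rightarrow\alpha\land\beta\ \Leftarrow\ \mathcal H\mid\Gamma\Rightarrow\alpha$ and $\mathcal H\mid\Gamma\Rightarrow\beta$. * $(\land l_1)$, if $\alpha\notin\Gamma$: $\mathcal H\mid\Gamma,\alpha\land\beta\Rightarrow\varphi\ \Leftarrow\ \emptyset\mid\Gamma,\alpha\land\beta,\alpha\Rightarrow\varphi$; $(\land l_2)$ likewise with $\beta$ in place of the added $\alpha$, if $\beta\notin\Gamma$. * $(\lor r_i)$: $\mathcal H\mid\Gamma\Rightarrow\alpha_1\lor\alpha_2\ \Leftarrow\ \mathcal H\mid\Gamma\Rightarrow\alpha_i$, for $i=1,2$. * $(\lor l)$, if $\alpha,\beta\notin\Gamma$: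 $\mathcal H\mid\Gamma,\alpha\lor\beta\Rightarrow\varphi\ \Leftarrow\ \emptyset\mid\Gamma,\alpha\lor\beta,\alpha\Rightarrow\varphi$ and $\emptyset\mid\Gamma,\alpha\lor\beta,\beta\Rightarrow\varphi$. * $(n_1)$–$(n_4)$: $\mathcal H\mid\Gamma,\neg\alpha\Rightarrow\neg\beta\ \Leftarrow\ A$ and $B$. Here $A$ is $\emptyset\mid\Gamma,\neg\alpha,\beta\Rightarrow\alpha$ if $\beta\notin\Gamma\cup\{\neg\alpha\}$; if $\beta\in\Gamma\cup\{\neg\alpha\}$, then $\neg\beta\notin\mathcal H$ is required and $A$ is $\neg\beta,\mathcal H\mid\Gamma,\neg\alpha\Rightarrow\alpha$. Further, $B$ is $\emptyset\mid\Gamma,\neg\alpha,\alpha\Rightarrow\beta$ if $\alpha\notin\Gamma$, and $\mathcal H\mid\Gamma,\neg\alpha\Rightarrow\beta$ if $\alpha\in\Gamma$. * (nef), if $\neg\beta\notin\mathcal H$: $\mathcal H\mid\Gamma,\neg\alpha\Rightarrow\neg\beta\ \Leftarrow\ \neg\beta,\mathcal H\mid\Gamma,\neg\alpha\Rightarrow\alpha$.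 * $(copc_1)$, if $\beta\notin\Gamma\cup\{\neg\alpha\}$: $\mathcal H\mid\Gamma,\neg\alpha\Rightarrow\neg\beta\ \Leftarrow\ \emptyset\mid\Gamma,\neg\alpha,\beta\Rightarrow\alpha$. $(copc_2)$, if $\neg\beta\notin\mathcal H$ and $\beta\in\Gamma\cup\{\neg\alpha\}$: $\mathcal H\mid\Gamma,\neg\alpha\Rightarrow\neg\beta\ \Leftarrow\ \neg\beta,\mathcal H\mid\Gamma,\neg\alpha\Rightarrow\alpha$. * (an), if $\alpha\notin\Gamma$: $\mathcal H\mid\Gamma\Rightarrow\neg\alpha\ \Leftarrow\ \emptyset\mid\Gamma,\alpha\Rightarrow\neg\alpha$. All four systems have the rules for $\top,\land,\lor,\to$ and (ax). In addition $\mathsf N$ has $(n_1)$–$(n_4)$; $\mathsf{NeF}$ has $(n_1)$–$(n_4)$ and (nef); $\mathsf{CoPC}$ has $(copc_1),(copc_2)$; $\mathsf{MPC}$ has $(copc_1),(copc_2)$ and (an). The proof-search tree for $\varphi$ has root $\emptyset\mid\emptyset\Rightarrow\varphi$, and the children of a node $s$ are the sequents that are a premise of some rule instance with conclusion $s$. The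 size of a sequent is the sum of the weights of the formulas in its history, context and goal. Exhaustive depth-first backwards proof search treats the children of a node one after the other, keeping the sequents on the current branch, and gives a sequent the verdict "derivable" exactly when some rule instance with this conclusion has only premises with verdict "derivable". The code of a formula is its prefix notation over a finite alphabet, with the indices of variables in binary. **Theorem 5.6.** Let $\mathsf L$ be one of $\mathsf N,\mathsf{NeF},\mathsf{CoPC},\mathsf{MPC}$. There is a constant $C$ such that for every formula $\varphi$ of weight $w$: 1. every branch of the proof-search tree for $\varphi$ in $\mathrm{G3}^{Hist}$ for $\mathsf L$ has at most $w^3$ nodes; 2. every node of this tree has at most $2w$ distinct children; 3. every sequent in this tree has size at most $Cw^2$; 4. exhaustive depth-first backwards proof search from $\emptyset\mid\emptyset\Rightarrow\varphi$ terminates, its verdict is "derivable" if and only if this sequent is derivable, and the total size of the sequents on the current branch never exceeds $Cw^5$. Moreover, there are a (deterministic, multi-stack) Turing machine, depending only on $\mathsf L$, and a constant $C$, such that for every formula $\varphi$ of weight $w$ whose code has length $n$ the machine, started on the code of $\varphi$, halts, outputs whether $\emptyset\mid\emptyset\Rightarrow\varphi$ is derivable in $\mathrm{G3}^{Hist}$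 for $\mathsf L$, and never uses more than $C(w^5+n)$ cells, those holding the input included. Since $w\le n$, this is polynomial space. -/

import Mathlib

namespace WeakNegation

/-- Propositional formulas over the variables `p₀, p₁, …`, with `⊤`, `∧`, `∨`, `→`, `¬` and
without `⊥`. -/
inductive Formula : Type
  | var (i : ℕ)
  | top
  | and (α β : Formula)
  | or (α β : Formula)
  | imp (α β : Formula)
  | neg (α : Formula)
  deriving DecidableEq

/-- The weight of a formula. -/
def Formula.weight : Formula → ℕ
  | .var _ => 1
  | .top => 1
  | .and α β => α.weight + β.weight + 1
  | .or α β => α.weight + β.weight + 1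
  | .imp α β => α.weight + β.weight + 1
  | .neg α => α.weight + 1

/-- The goals for which the left rules for `→`, `∧`, `∨` may be used: atoms, negations and
disjunctions. -/
inductive Formula.IsLeftGoal : Formula → Prop
  | var (i : ℕ) : IsLeftGoal (.var i)
  | or (α β : Formula) : IsLeftGoal (.or α β)
  | neg (α : Formula) : IsLeftGoal (.neg α)

/-- A sequent with history `H | Γ ⇒ φ`: the history is a finite set of formulas, the context a
finite multiset of formulas. -/
structure HSequent : Type where
  hist : Finset Formula
  ctx : Multiset Formula
  goal : Formula

/-- The four systems. -/
inductive Calculus : Type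
  | N
  | NeF
  | CoPC
  | MPC

/-- The systems with the rules (n₁)-(n₄). -/
def Calculus.HasN (L : Calculus) : Prop := L = .N ∨ L = .NeF

/-- The systems with the rule (nef). -/
def Calculus.HasNef (L : Calculus) : Prop := L = .NeF

/-- The systems with the rules (copc₁), (copc₂). -/
def Calculus.HasCopc (L : Calculus) : Prop := L = .CoPC ∨ L = .MPC

/-- The systems with the rule (an). -/
def Calculus.HasAn (L : Calculus) : Prop := L = .MPC

open Formula in
/-- `Rule L s ps`: there is an instance of a rule of the history calculus for `L` with
conclusion `s` and list of premises `ps`. -/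
inductive Rule (L : Calculus) : HSequent → List HSequent → Prop
  | ax (H : Finset Formula) (Γ : Multiset Formula) (i : ℕ) :
      Rule L ⟨H, var i ::ₘ Γ, var i⟩ []
  | topR (H : Finset Formula) (Γ : Multiset Formula) :
      Rule L ⟨H, Γ, top⟩ []
  | impR₁ (H : Finset Formula) (Γ : Multiset Formula) (α β : Formula) (hα : α ∉ Γ) :
      Rule L ⟨H, Γ, imp α β⟩ [⟨∅, α ::ₘ Γ, β⟩]
  | impR₂ (H : Finset Formula) (Γ : Multiset Formula) (α β : Formula) (hα : α ∈ Γ) :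
      Rule L ⟨H, Γ, imp α β⟩ [⟨H, Γ, β⟩]
  | impL (H : Finset Formula) (Γ : Multiset Formula) (α β φ : Formula)
      (hφ : φ.IsLeftGoal) (hH : φ ∉ H) (hβ : β ∉ Γ) :
      Rule L ⟨H, imp α β ::ₘ Γ, φ⟩
        [⟨insert φ H, imp α β ::ₘ Γ, α⟩, ⟨∅, β ::ₘ imp α β ::ₘ Γ, φ⟩]
  | andR (H : Finset Formula) (Γ : Multiset Formula) (α β : Formula) :
      Rule L ⟨H, Γ, and α β⟩ [⟨H, Γ, α⟩, ⟨H, Γ, β⟩]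
  | andL₁ (H : Finset Formula) (Γ : Multiset Formula) (α β φ : Formula)
      (hφ : φ.IsLeftGoal) (hα : α ∉ Γ) :
      Rule L ⟨H, and α β ::ₘ Γ, φ⟩ [⟨∅, α ::ₘ and α β ::ₘ Γ, φ⟩]
  | andL₂ (H : Finset Formula) (Γ : Multiset Formula) (α β φ : Formula)
      (hφ : φ.IsLeftGoal) (hβ : β ∉ Γ) :
      Rule L ⟨H, and α β ::ₘ Γ, φ⟩ [⟨∅, β ::ₘ and α β ::ₘ Γ, φ⟩]
  | orR₁ (H : Finset Formula) (Γ : Multiset Formula) (α β : Formula) :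
      Rule L ⟨H, Γ, or α β⟩ [⟨H, Γ, α⟩]
  | orR₂ (H : Finset Formula) (Γ : Multiset Formula) (α β : Formula) :
      Rule L ⟨H, Γ, or α β⟩ [⟨H, Γ, β⟩]
  | orL (H : Finset Formula) (Γ : Multiset Formula) (α β φ : Formula)
      (hφ : φ.IsLeftGoal) (hα : α ∉ Γ) (hβ : β ∉ Γ) :
      Rule L ⟨H, or α β ::ₘ Γ, φ⟩
        [⟨∅, α ::ₘ or α β ::ₘ Γ, φ⟩, ⟨∅, β ::ₘ or α β ::ₘ Γ, φ⟩]
  | n₁ (hL : L.HasN) (H : Finset Formula) (Γ : Multiset Formula) (α β : Formula)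
      (hβ : β ∉ neg α ::ₘ Γ) (hα : α ∉ Γ) :
      Rule L ⟨H, neg α ::ₘ Γ, neg β⟩
        [⟨∅, β ::ₘ neg α ::ₘ Γ, α⟩, ⟨∅, α ::ₘ neg α ::ₘ Γ, β⟩]
  | n₂ (hL : L.HasN) (H : Finset Formula) (Γ : Multiset Formula) (α β : Formula)
      (hβ : β ∉ neg α ::ₘ Γ) (hα : α ∈ Γ) :
      Rule L ⟨H, neg α ::ₘ Γ, neg β⟩
        [⟨∅, β ::ₘ neg α ::ₘ Γ, α⟩, ⟨H, neg α ::ₘ Γ, β⟩]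
  | n₃ (hL : L.HasN) (H : Finset Formula) (Γ : Multiset Formula) (α β : Formula)
      (hH : neg β ∉ H) (hβ : β ∈ neg α ::ₘ Γ) (hα : α ∉ Γ) :
      Rule L ⟨H, neg α ::ₘ Γ, neg β⟩
        [⟨insert (neg β) H, neg α ::ₘ Γ, α⟩, ⟨∅, α ::ₘ neg α ::ₘ Γ, β⟩]
  | n₄ (hL : L.HasN) (H : Finset Formula) (Γ : Multiset Formula) (α β : Formula)
      (hH : neg β ∉ H) (hβ : β ∈ neg α ::ₘ Γ) (hα : α ∈ Γ) :
      Rule L ⟨H, neg α ::ₘ Γ, neg β⟩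
        [⟨insert (neg β) H, neg α ::ₘ Γ, α⟩, ⟨H, neg α ::ₘ Γ, β⟩]
  | nef (hL : L.HasNef) (H : Finset Formula) (Γ : Multiset Formula) (α β : Formula)
      (hH : neg β ∉ H) :
      Rule L ⟨H, neg α ::ₘ Γ, neg β⟩ [⟨insert (neg β) H, neg α ::ₘ Γ, α⟩]
  | copc₁ (hL : L.HasCopc) (H : Finset Formula) (Γ : Multiset Formula) (α β : Formula)
      (hβ : β ∉ neg α ::ₘ Γ) :
      Rule L ⟨H, neg α ::ₘ Γ, neg β⟩ [⟨∅, β ::ₘ neg α ::ₘ Γ, α⟩]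
  | copc₂ (hL : L.HasCopc) (H : Finset Formula) (Γ : Multiset Formula) (α β : Formula)
      (hH : neg β ∉ H) (hβ : β ∈ neg α ::ₘ Γ) :
      Rule L ⟨H, neg α ::ₘ Γ, neg β⟩ [⟨insert (neg β) H, neg α ::ₘ Γ, α⟩]
  | an (hL : L.HasAn) (H : Finset Formula) (Γ : Multiset Formula) (α : Formula) (hα : α ∉ Γ) :
      Rule L ⟨H, Γ, neg α⟩ [⟨∅, α ::ₘ Γ, neg α⟩]

/-- Derivability in the history calculus for `L`. -/
inductive Derivable (L : Calculus) : HSequent → Prop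
  | intro (s : HSequent) (ps : List HSequent) (h : Rule L s ps)
      (hps : ∀ t ∈ ps, Derivable L t) : Derivable L s

/-- The sequent `∅ | ∅ ⇒ φ`, at which the proof search for `φ` starts. -/
def root (φ : Formula) : HSequent := ⟨∅, 0, φ⟩

/-- The children of `s` in a proof-search tree: `t` is a premise of some rule instance with
conclusion `s`. -/
def Child (L : Calculus) (s t : HSequent) : Prop := ∃ ps, Rule L s ps ∧ t ∈ ps

/-- `s` occurs in the proof-search tree for `φ`. -/
def Occurs (L : Calculus) (φ : Formula) (s : HSequent) : Prop :=
  Relation.ReflTransGen (Child L) (root φ) s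

/-- `b` is an initial segment of a branch of the proof-search tree for `φ`, listed from the
root upwards. -/
def IsBranch (L : Calculus) (φ : Formula) (b : List HSequent) : Prop :=
  b.head? = some (root φ) ∧ b.IsChain (Child L)

/-- The size of a sequent: the total weight of the formulas in its history, context and goal
(this is at least the number of these formulas). -/
def HSequent.size (s : HSequent) : ℕ :=
  ∑ α ∈ s.hist, α.weight + (s.ctx.map Formula.weight).sum + s.goal.weight

/-- `Search L s v m`: exhaustive backwards proof search from `s`, carried out depth first,
terminates with verdict `v` (`true`: a derivation has been found; `false`: there is none), and
the sequents on the branch under inspection, from `s` on, have total size at most `m` at every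
moment. The search at `s` runs the search at each child `t` of `s`, one after the other, while
keeping `s`; then `s` is given the verdict `true` exactly if some rule instance with conclusion
`s` has only premises with verdict `true`. -/
inductive Search (L : Calculus) : HSequent → Bool → ℕ → Prop
  | node (s : HSequent) (r : HSequent → Bool) (m : ℕ)
      (hr : ∀ t, Child L s t → Search L t (r t) m) (v : Bool)
      (hv : v = true ↔ ∃ ps, Rule L s ps ∧ ∀ t ∈ ps, r t = true) :
      Search L s v (s.size + m)

/-- A finite alphabet for writing formulas. -/
inductive Letter : Type
  | var
  | bit (b : Bool)
  | top
  | and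
  | or
  | imp
  | neg

/-- Formulas as words in prefix notation; the index of a variable is written in binary, least
significant bit first, after the letter `var`. -/
def Formula.code : Formula → List Letter
  | .var i => Letter.var :: i.bits.map Letter.bit
  | .top => [Letter.top]
  | .and α β => Letter.and :: (α.code ++ β.code)
  | .or α β => Letter.or :: (α.code ++ β.code)
  | .imp α β => Letter.imp :: (α.code ++ β.code)
  | .neg α => Letter.neg :: α.code

/-- The number of cells in use in a configuration of a Turing machine (in the form of a machine
with finitely many stacks): the total length of all its stacks, those for input and output
included. -/
def cellsUsed (M : Turing.FinTM2) (c : M.Cfg) : ℕ :=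
  letI := M.kFin
  ∑ k : M.K, (Turing.TM2.Cfg.stk c k).length

open Classical in
/-- Some Turing machine, with finite alphabets, halts on the code of every `a : A`, with the
correct answer to the question whether `P a` as its output, and never uses more than `space a`
cells on the way. -/
def DecidableInSpace {A Λ : Type} (code : A → List Λ) (P : A → Prop) (space : A → ℕ) : Prop :=
  ∃ T : Turing.TM2Computable code Computability.encodeBool (fun a => decide (P a)),
    (∀ k, Finite (T.tm.Γ k)) ∧
    ∀ (a : A) (c : T.tm.Cfg),
      StateTransition.Reaches T.tm.step
        (Turing.initList T.tm ((code a).map T.inputAlphabet.invFun)) c →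
      cellsUsed T.tm c ≤ space a

end WeakNegation

/-!
# Polynomial space for the calculi with history

*The tree.* All formulas in the proof-search tree for `φ` are subformulas of `φ`, and those in a
context are proper subformulas and pairwise distinct (`Subformulas`). Hence a context has fewer than
`w` formulas, a history has at most `w`, and a sequent has size at most `3 w ^ 2`. In passing to a
premise, either the context grows and the history becomes empty, or the context stays and the history
grows, or both stay and the goal is replaced by an immediate subformula (`Child.move`). So the
lexicographic order of these three quantities, put into a single number `rank φ s`, decreases along
branches, and `rank φ (root φ) ≤ w ^ 3`. This bounds the branches (`length_branch_le`), and with it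
the search (`exists_search`). Children are counted by the formulas that contribute them: a formula of
the context contributes at most two; a negation `¬α` in the context can contribute a third one, but
only if `α` is not in the context, and then `α` counts among the `w - 1` proper subformulas
as well (`encard_children_le`).

*The machine.* Turing machines are given by structured programs on five stacks (`Prog`), with a
big-step semantics that bounds the stacks (`Run`). They operate on binary trees in prefix notation,
and `LinSpace` is the class of functions on trees that they compute in linear space. It is closed
under composition, pairing, case distinction and suitable folds, so that membership proofs follow the
definitions of the functions. A while loop needs space linear in the size of the trees that occur in
it (`exists_replaces_of_iterates`).

The depth-first search is a while loop whose body `searchStep` is in `LinSpace`. Its state contains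
the list of all subformulas of `φ` and a stack of calls. The sets in a sequent are lists of truth
values, one for each subformula, so that a call has size `O(w ^ 2)`, which is the size of its goal.
The stack never has more than `rank φ (root φ)` calls (`iterates_call`), so the loop runs in space
`O(w ^ 5)`.

The index of a variable can be arbitrarily long in comparison with `w`. The parser (`parseStep`)
therefore numbers the variables in the order of their occurrence, counted from the end of the code,
and the search uses these numbers, which are at most `w`. The parser needs space `O(w ^ 3 + n)`
(`folds_parseStep`).
-/

/-! ### Structured programs and Turing machines -/

namespace WeakNegation

open Turing Function

variable {K : Type} {Γ : K → Type}

/-- Structured programs on finitely many stacks. `pop k P` removes the top symbol of stack `k` (if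
there is one) and continues with the branch of `P` for this symbol; `loop k quit P` repeats this as
long as the symbol does not satisfy `quit`. -/
inductive Prog (Γ : K → Type) : Type
  | skip
  | push (k : K) (a : Γ k)
  | seq (P Q : Prog Γ)
  | pop (k : K) (P : Option (Γ k) → Prog Γ)
  | loop (k : K) (quit : Option (Γ k) → Bool) (P : Option (Γ k) → Prog Γ)

/-- The program points of a program, which become labels of a Turing machine. -/
def Prog.Lab : Prog Γ → Type
  | .skip => Unit
  | .push _ _ => Unit
  | .seq P Q => P.Lab ⊕ Q.Lab
  | .pop _ P => Option (Σ o, (P o).Lab)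
  | .loop _ _ P => Option (Σ o, (P o).Lab)

/-- The program point at which a program starts. -/
def Prog.start : (P : Prog Γ) → P.Lab
  | .skip => ()
  | .push _ _ => ()
  | .seq P _ => .inl P.start
  | .pop _ _ => none
  | .loop _ _ _ => none

theorem Prog.finite_lab [∀ k, Finite (Γ k)] (P : Prog Γ) : Finite P.Lab := by
  induction P with
  | skip => exact inferInstanceAs (Finite Unit)
  | push => exact inferInstanceAs (Finite Unit)
  | seq P Q hP hQ => exact inferInstanceAs (Finite (P.Lab ⊕ Q.Lab))
  | pop k P hP => exact inferInstanceAs (Finite (Option (Σ o, (P o).Lab)))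
  | loop k s P hP => exact inferInstanceAs (Finite (Option (Σ o, (P o).Lab)))

variable [DecidableEq K]

/-- `Run cap P S S'`: the program `P`, started on the stacks `S`, terminates with the stacks `S'`,
and pushes onto a stack only while this stack has fewer than `cap` cells. -/
inductive Run (cap : ℕ) : Prog Γ → (∀ k, List (Γ k)) → (∀ k, List (Γ k)) → Prop
  | skip (S) : Run cap .skip S S
  | push (k a) (S : ∀ k, List (Γ k)) (h : (S k).length < cap) :
      Run cap (.push k a) S (update S k (a :: S k))
  | seq {P Q S S₁ S₂} (hP : Run cap P S S₁) (hQ : Run cap Q S₁ S₂) : Run cap (.seq P Q) S S₂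
  | pop {k P S S'} (h : Run cap (P (S k).head?) (update S k (S k).tail) S') :
      Run cap (.pop k P) S S'
  | finish {k quit P S} (h : quit (S k).head? = true) :
      Run cap (.loop k quit P) S (update S k (S k).tail)
  | iter {k quit P S S₁ S₂} (h : quit (S k).head? = false)
      (hP : Run cap (P (S k).head?) (update S k (S k).tail) S₁)
      (hL : Run cap (.loop k quit P) S₁ S₂) : Run cap (.loop k quit P) S S₂

/-- The Turing machine statements that carry out a program. The labels of the program are embedded
into those of the machine by `emb`, and the program ends by going to the label `exit`. The internal
state of the machine records the symbol that was last popped from each stack. -/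
def Prog.stmt {Λ : Type} : (P : Prog Γ) → (P.Lab → Λ) → Λ → P.Lab →
    TM2.Stmt Γ Λ (∀ k, Option (Γ k))
  | .skip, _, exit, _ => .goto fun _ => exit
  | .push k a, _, exit, _ => .push k (fun _ => a) (.goto fun _ => exit)
  | .seq P Q, emb, exit, l =>
      match l with
      | .inl l => P.stmt (fun l => emb (.inl l)) (emb (.inr Q.start)) l
      | .inr l => Q.stmt (fun l => emb (.inr l)) exit l
  | .pop k P, emb, exit, l =>
      match l with
      | none => .pop k (fun v o => update v k o)
          (.goto fun v => emb (some ⟨v k, (P (v k)).start⟩))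
      | some ⟨o, l⟩ => (P o).stmt (fun l => emb (some ⟨o, l⟩)) exit l
  | .loop k quit P, emb, exit, l =>
      match l with
      | none => .pop k (fun v o => update v k o)
          (.goto fun v => bif quit (v k) then exit else emb (some ⟨v k, (P (v k)).start⟩))
      | some ⟨o, l⟩ => (P o).stmt (fun l => emb (some ⟨o, l⟩)) (emb none) l

/-- `c` steps to `c'`, and no stack of `c'` has more than `cap` cells. -/
def CapStep {Λ σ : Type} (M : Λ → TM2.Stmt Γ Λ σ) (cap : ℕ) (c c' : TM2.Cfg Γ Λ σ) : Prop :=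
  c' ∈ TM2.step M c ∧ ∀ k, (c'.stk k).length ≤ cap

theorem length_update_tail_le {S : ∀ k, List (Γ k)} {cap : ℕ} (hS : ∀ k, (S k).length ≤ cap)
    (k j : K) : (update S k (S k).tail j).length ≤ cap := by
  rcases eq_or_ne j k with rfl | h
  · rw [update_self, List.length_tail]; exact (Nat.sub_le _ _).trans (hS j)
  · rw [update_of_ne h]; exact hS j

theorem length_update_cons_le {S : ∀ k, List (Γ k)} {cap : ℕ} (hS : ∀ k, (S k).length ≤ cap)
    (k : K) (a : Γ k) (h : (S k).length < cap) (j : K) :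
    (update S k (a :: S k) j).length ≤ cap := by
  rcases eq_or_ne j k with rfl | h'
  · rw [update_self]; exact h
  · rw [update_of_ne h']; exact hS j

theorem Run.length_le {cap : ℕ} {P : Prog Γ} {S S' : ∀ k, List (Γ k)} (h : Run cap P S S')
    (hS : ∀ k, (S k).length ≤ cap) (k : K) : (S' k).length ≤ cap := by
  induction h generalizing k with
  | skip S => exact hS k
  | push j a S h => exact length_update_cons_le hS j a h k
  | seq _ _ ih₁ ih₂ => exact ih₂ (ih₁ hS) k
  | pop _ ih => exact ih (length_update_tail_le hS _) k
  | finish _ => exact length_update_tail_le hS _ k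
  | iter _ _ _ ih₁ ih₂ => exact ih₂ (ih₁ (length_update_tail_le hS _)) k

/-- A machine that contains the statements of a program carries it out, in the same space. -/
theorem Run.capStep {Λ : Type} {M : Λ → TM2.Stmt Γ Λ (∀ k, Option (Γ k))} {cap : ℕ}
    {P : Prog Γ} {S S' : ∀ k, List (Γ k)} (h : Run cap P S S')
    (hS : ∀ k, (S k).length ≤ cap) (emb : P.Lab → Λ) (exit : Λ)
    (hM : ∀ l, M (emb l) = P.stmt emb exit l) (v : ∀ k, Option (Γ k)) :
    ∃ v', Relation.ReflTransGen (CapStep M cap) ⟨some (emb P.start), v, S⟩ ⟨some exit, v', S'⟩ := by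
  induction h generalizing exit v with
  | skip S =>
    refine ⟨v, .single ⟨?_, hS⟩⟩
    simp [hM, Prog.stmt]
  | push k a S h =>
    refine ⟨v, .single ⟨?_, length_update_cons_le hS k a h⟩⟩
    simp [hM, Prog.stmt]
  | @seq P Q S S₁ S₂ hP hQ ihP ihQ =>
    obtain ⟨v₁, h₁⟩ := ihP hS (fun l => emb (.inl l)) (emb (.inr Q.start)) (fun l => hM (.inl l)) v
    obtain ⟨v₂, h₂⟩ := ihQ (hP.length_le hS) (fun l => emb (.inr l)) exit (fun l => hM (.inr l)) v₁
    exact ⟨v₂, h₁.trans h₂⟩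
  | @pop k P S S' h ih =>
    obtain ⟨v', h'⟩ := ih (length_update_tail_le hS k) (fun l => emb (some ⟨_, l⟩)) exit
      (fun l => hM (some ⟨_, l⟩)) (update v k (S k).head?)
    refine ⟨v', .head ⟨?_, length_update_tail_le hS k⟩ h'⟩
    refine congrArg some ((congrArg (fun q => TM2.stepAux q v S) (hM none)).trans ?_)
    change TM2.Cfg.mk (some (emb (some ⟨update v k _ k, (P (update v k _ k)).start⟩))) _ _ = _
    rw [update_self]
  | @finish k quit P S h =>
    refine ⟨update v k (S k).head?, .single ⟨?_, length_update_tail_le hS k⟩⟩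
    refine congrArg some ((congrArg (fun q => TM2.stepAux q v S) (hM none)).trans ?_)
    change TM2.Cfg.mk (some (bif quit (update v k _ k) then exit else
      emb (some ⟨update v k _ k, (P (update v k _ k)).start⟩))) _ _ = _
    rw [update_self, h, cond_true]
  | @iter k quit P S S₁ S₂ h hP hL ihP ihL =>
    obtain ⟨v₁, h₁⟩ := ihP (length_update_tail_le hS k) (fun l => emb (some ⟨_, l⟩)) (emb none)
      (fun l => hM (some ⟨_, l⟩)) (update v k (S k).head?)
    obtain ⟨v₂, h₂⟩ := ihL (hP.length_le (length_update_tail_le hS k)) emb exit hM v₁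
    refine ⟨v₂, .head ⟨?_, length_update_tail_le hS k⟩ (h₁.trans h₂)⟩
    refine congrArg some ((congrArg (fun q => TM2.stepAux q v S) (hM none)).trans ?_)
    change TM2.Cfg.mk (some (bif quit (update v k _ k) then exit else
      emb (some ⟨update v k _ k, (P (update v k _ k)).start⟩))) _ _ = _
    rw [update_self, h, cond_false]

theorem CapStep.length_le_of_reaches {Λ σ : Type} {M : Λ → TM2.Stmt Γ Λ σ} {cap : ℕ}
    {c d e : TM2.Cfg Γ Λ σ} (hd : Relation.ReflTransGen (CapStep M cap) c d)
    (hn : TM2.step M d = none) (hc : ∀ k, (c.stk k).length ≤ cap)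
    (he : StateTransition.Reaches (TM2.step M) c e) (k : K) : (e.stk k).length ≤ cap := by
  induction hd using Relation.ReflTransGen.head_induction_on with
  | refl =>
    rcases he.cases_head with rfl | ⟨x, hx, -⟩
    · exact hc k
    · rw [hn] at hx; cases hx
  | head h _ ih =>
    rcases he.cases_head with rfl | ⟨x, hx, hx'⟩
    · exact hc k
    · cases Option.mem_unique hx h.1
      exact ih h.2 hx'

theorem exists_evalsTo_of_reaches {σ : Type} {f : σ → Option σ} {a b : σ}
    (h : StateTransition.Reaches f a b) : Nonempty (StateTransition.EvalsTo f a (some b)) := by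
  induction h using Relation.ReflTransGen.head_induction_on with
  | refl => exact ⟨.refl _ _⟩
  | head h _ ih =>
    obtain ⟨n, hn⟩ := ih
    refine ⟨n + 1, ?_⟩
    rw [iterate_succ_apply, ← hn]
    exact congrArg _ h

end WeakNegation

/-! ### Binary trees on stacks -/

namespace WeakNegation

open Function

/-- The data on which the programs below operate: binary trees. The list of `a₁, …, aₙ` is
`cons a₁ (… (cons aₙ nil))`, and `nil` also serves as the truth value `false`. -/
inductive Data : Type
  | nil
  | cons (a b : Data)
  deriving DecidableEq

namespace Data

/-- Prefix notation for trees. -/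
def word : Data → List Bool
  | nil => [false]
  | cons a b => true :: (a.word ++ b.word)

/-- The number of cells needed to store a tree. -/
def size (x : Data) : ℕ := x.word.length

@[simp] theorem size_nil : nil.size = 1 := rfl

@[simp] theorem size_cons (a b : Data) : (cons a b).size = a.size + b.size + 1 := by
  simp [size, word]

theorem size_pos (x : Data) : 0 < x.size := by
  cases x <;> simp

/-- The left subtree. -/
def fst : Data → Data
  | nil => nil
  | cons a _ => a

/-- The right subtree. -/
def snd : Data → Data
  | nil => nil
  | cons _ b => b

@[simp] theorem fst_nil : nil.fst = nil := rfl
@[simp] theorem snd_nil : nil.snd = nil := rfl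
@[simp] theorem fst_cons (a b : Data) : (cons a b).fst = a := rfl
@[simp] theorem snd_cons (a b : Data) : (cons a b).snd = b := rfl

/-- Truth values as trees. -/
def bool : Bool → Data
  | false => nil
  | true => cons nil nil

@[simp] theorem bool_false : bool false = nil := rfl
@[simp] theorem bool_true : bool true = cons nil nil := rfl

theorem word_injective : Function.Injective word := by
  have key : ∀ (x y : Data) (r s : List Bool), x.word ++ r = y.word ++ s → x = y ∧ r = s := by
    intro x
    induction x with
    | nil =>
      intro y r s h
      cases y with
      | nil => exact ⟨rfl, by simpa [word] using h⟩
      | cons c d => simp [word] at h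
    | cons a b iha ihb =>
      intro y r s h
      cases y with
      | nil => simp [word] at h
      | cons c d =>
        simp only [word, List.cons_append, List.append_assoc, List.cons.injEq, true_and] at h
        obtain ⟨h₁, h⟩ := iha _ _ _ h
        obtain ⟨h₂, h⟩ := ihb _ _ _ h
        exact ⟨by rw [h₁, h₂], h⟩
  intro x y h
  exact (key x y [] [] (by simp [h])).1

end Data

/-- The stacks of the machine: the input, a main stack that holds data in prefix notation, two
auxiliary stacks, and a counter. -/
inductive Stk : Type
  | input
  | main
  | aux₁
  | aux₂
  | count
  deriving DecidableEq

instance : Fintype Stk :=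
  ⟨{.input, .main, .aux₁, .aux₂, .count}, fun k => by cases k <;> simp⟩

/-- The alphabets of the stacks. -/
def Sym : Stk → Type
  | .input => Letter
  | .main => Bool
  | .aux₁ => Bool
  | .aux₂ => Bool
  | .count => Bool

/-- Stacks with the given contents. -/
def stk (i : List Letter) (m a b c : List Bool) : ∀ k, List (Sym k)
  | .input => i
  | .main => m
  | .aux₁ => a
  | .aux₂ => b
  | .count => c

section Stacks

variable {cap : ℕ} {i : List Letter} {m a b c : List Bool} {S : ∀ k, List (Sym k)}

theorem update_input (x : List Letter) :
    update (stk i m a b c) .input x = stk x m a b c := by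
  funext k; cases k <;> rfl

theorem update_main (x : List Bool) :
    update (stk i m a b c) .main x = stk i x a b c := by
  funext k; cases k <;> rfl

theorem update_aux₁ (x : List Bool) :
    update (stk i m a b c) .aux₁ x = stk i m x b c := by
  funext k; cases k <;> rfl

theorem update_aux₂ (x : List Bool) :
    update (stk i m a b c) .aux₂ x = stk i m a x c := by
  funext k; cases k <;> rfl

theorem update_count (x : List Bool) :
    update (stk i m a b c) .count x = stk i m a b x := by
  funext k; cases k <;> rfl

/-- Push a bit onto the main stack. -/
def pushMain (x : Bool) : Prog Sym := .push .main x
/-- Push a bit onto the first auxiliary stack. -/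
def pushAux₁ (x : Bool) : Prog Sym := .push .aux₁ x
/-- Push a bit onto the second auxiliary stack. -/
def pushAux₂ (x : Bool) : Prog Sym := .push .aux₂ x
/-- Push a bit onto the counter. -/
def pushCount (x : Bool) : Prog Sym := .push .count x

theorem run_pushMain (x : Bool) (h : m.length < cap) :
    Run cap (pushMain x) (stk i m a b c) (stk i (x :: m) a b c)  := by
  rw [← update_main (i := i) (m := m) (a := a) (b := b) (c := c) (x :: m)]
  exact Run.push (Γ := Sym) Stk.main x _ h

theorem run_pushAux₁ (x : Bool) (h : a.length < cap) :
    Run cap (pushAux₁ x) (stk i m a b c) (stk i m (x :: a) b c)  := by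
  rw [← update_aux₁ (i := i) (m := m) (a := a) (b := b) (c := c) (x :: a)]
  exact Run.push (Γ := Sym) Stk.aux₁ x _ h

theorem run_pushAux₂ (x : Bool) (h : b.length < cap) :
    Run cap (pushAux₂ x) (stk i m a b c) (stk i m a (x :: b) c)  := by
  rw [← update_aux₂ (i := i) (m := m) (a := a) (b := b) (c := c) (x :: b)]
  exact Run.push (Γ := Sym) Stk.aux₂ x _ h

theorem run_pushCount (x : Bool) (h : c.length < cap) :
    Run cap (pushCount x) (stk i m a b c) (stk i m a b (x :: c))  := by
  rw [← update_count (i := i) (m := m) (a := a) (b := b) (c := c) (x :: c)]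
  exact Run.push (Γ := Sym) Stk.count x _ h

/-- Pop a bit from the main stack and continue according to this bit (or according to the stack
being empty). -/
def popMain (P : Option Bool → Prog Sym) : Prog Sym := .pop .main P
/-- Pop a bit from the second auxiliary stack and continue according to this bit. -/
def popAux₂ (P : Option Bool → Prog Sym) : Prog Sym := .pop .aux₂ P
/-- Pop a bit from the counter and continue according to this bit. -/
def popCount (P : Option Bool → Prog Sym) : Prog Sym := .pop .count P

theorem run_popMain {P : Option Bool → Prog Sym}
    (h : Run cap (P m.head?) (stk i m.tail a b c) S) :
    Run cap (popMain P) (stk i m a b c) S :=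
  Run.pop (k := Stk.main) (by rw [← update_main (m := m)] at h; exact h)

theorem run_popAux₂ {P : Option Bool → Prog Sym}
    (h : Run cap (P b.head?) (stk i m a b.tail c) S) :
    Run cap (popAux₂ P) (stk i m a b c) S :=
  Run.pop (k := Stk.aux₂) (by rw [← update_aux₂ (b := b)] at h; exact h)

theorem run_popCount {P : Option Bool → Prog Sym}
    (h : Run cap (P c.head?) (stk i m a b c.tail) S) :
    Run cap (popCount P) (stk i m a b c) S :=
  Run.pop (k := Stk.count) (by rw [← update_count (c := c)] at h; exact h)

/-- Empty the first auxiliary stack, running a program for each of its bits. -/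
def forAux₁ (P : Bool → Prog Sym) : Prog Sym := .loop .aux₁ Option.isNone fun o => o.elim .skip P
/-- Empty the second auxiliary stack, running a program for each of its bits. -/
def forAux₂ (P : Bool → Prog Sym) : Prog Sym :=
  .loop .aux₂ Option.isNone fun o => o.elim .skip P
/-- Empty the counter, running a program for each of its bits. -/
def forCount (P : Bool → Prog Sym) : Prog Sym :=
  .loop .count Option.isNone fun o => o.elim .skip P
/-- Empty the input stack, running a program for each of its letters. -/
def forInput (P : Letter → Prog Sym) : Prog Sym :=
  .loop .input Option.isNone fun o => o.elim .skip P

/-- Pop bits from the main stack, running a program after each bit `true`, up to the first other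
bit. -/
def whileMain (P : Prog Sym) : Prog Sym := .loop .main (fun o => !(o.getD false)) fun _ => P

theorem run_forAux₁_nil {P : Bool → Prog Sym} :
    Run cap (forAux₁ P) (stk i m [] b c) (stk i m [] b c) := by
  have := Run.finish (cap := cap) (k := Stk.aux₁) (quit := Option.isNone)
    (P := fun o => o.elim .skip P) (S := stk i m [] b c) rfl
  rw [show (stk i m [] b c .aux₁).tail = ([] : List Bool) from rfl, update_aux₁] at this
  exact this

theorem run_forAux₁_cons {P : Bool → Prog Sym} {x : Bool} {S₁ : ∀ k, List (Sym k)}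
    (h : Run cap (P x) (stk i m a b c) S₁) (h' : Run cap (forAux₁ P) S₁ S) :
    Run cap (forAux₁ P) (stk i m (x :: a) b c) S :=
  Run.iter (k := Stk.aux₁) rfl (by rw [← update_aux₁ (a := x :: a)] at h; exact h) h'

theorem run_forAux₂_nil {P : Bool → Prog Sym} :
    Run cap (forAux₂ P) (stk i m a [] c) (stk i m a [] c) := by
  have := Run.finish (cap := cap) (k := Stk.aux₂) (quit := Option.isNone)
    (P := fun o => o.elim .skip P) (S := stk i m a [] c) rfl
  rw [show (stk i m a [] c .aux₂).tail = ([] : List Bool) from rfl, update_aux₂] at this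
  exact this

theorem run_forAux₂_cons {P : Bool → Prog Sym} {x : Bool} {S₁ : ∀ k, List (Sym k)}
    (h : Run cap (P x) (stk i m a b c) S₁) (h' : Run cap (forAux₂ P) S₁ S) :
    Run cap (forAux₂ P) (stk i m a (x :: b) c) S :=
  Run.iter (k := Stk.aux₂) rfl (by rw [← update_aux₂ (b := x :: b)] at h; exact h) h'

theorem run_forCount_nil {P : Bool → Prog Sym} :
    Run cap (forCount P) (stk i m a b []) (stk i m a b []) := by
  have := Run.finish (cap := cap) (k := Stk.count) (quit := Option.isNone)
    (P := fun o => o.elim .skip P) (S := stk i m a b []) rfl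
  rw [show (stk i m a b [] .count).tail = ([] : List Bool) from rfl, update_count] at this
  exact this

theorem run_forCount_cons {P : Bool → Prog Sym} {x : Bool} {S₁ : ∀ k, List (Sym k)}
    (h : Run cap (P x) (stk i m a b c) S₁) (h' : Run cap (forCount P) S₁ S) :
    Run cap (forCount P) (stk i m a b (x :: c)) S :=
  Run.iter (k := Stk.count) rfl (by rw [← update_count (c := x :: c)] at h; exact h) h'

theorem run_forInput_nil {P : Letter → Prog Sym} :
    Run cap (forInput P) (stk [] m a b c) (stk [] m a b c) := by
  have := Run.finish (cap := cap) (k := Stk.input) (quit := Option.isNone)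
    (P := fun o => o.elim .skip P) (S := stk [] m a b c) rfl
  rw [show (stk [] m a b c .input).tail = ([] : List Letter) from rfl, update_input] at this
  exact this

theorem run_forInput_cons {P : Letter → Prog Sym} {x : Letter} {S₁ : ∀ k, List (Sym k)}
    (h : Run cap (P x) (stk i m a b c) S₁) (h' : Run cap (forInput P) S₁ S) :
    Run cap (forInput P) (stk (x :: i) m a b c) S :=
  Run.iter (k := Stk.input) rfl (by rw [← update_input (i := x :: i)] at h; exact h) h'

theorem run_whileMain_false {P : Prog Sym} :
    Run cap (whileMain P) (stk i (false :: m) a b c) (stk i m a b c) := by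
  have := Run.finish (cap := cap) (k := Stk.main) (quit := fun o : Option Bool => !(o.getD false))
    (P := fun _ => P) (S := stk i (false :: m) a b c) rfl
  rw [show (stk i (false :: m) a b c .main).tail = m from rfl, update_main] at this
  exact this

theorem run_whileMain_true {P : Prog Sym} {S₁ : ∀ k, List (Sym k)}
    (h : Run cap P (stk i m a b c) S₁) (h' : Run cap (whileMain P) S₁ S) :
    Run cap (whileMain P) (stk i (true :: m) a b c) S :=
  Run.iter (k := Stk.main) rfl (by rw [← update_main (m := true :: m)] at h; exact h) h'

end Stacks

end WeakNegation

/-! ### Elementary programs for trees -/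

namespace WeakNegation

open Function

section Programs

variable {cap : ℕ} {i : List Letter} {m a b c l : List Bool} {S : ∀ k, List (Sym k)}

/-- Move one tree from the main stack to an auxiliary stack, whose bits are pushed with `put`. The
counter holds one bit for each tree still to be moved. -/
def moveLoop (put : Bool → Prog Sym) : Prog Sym :=
  forCount fun _ => popMain fun o => o.elim .skip fun x =>
    .seq (put x) (bif x then .seq (pushCount true) (pushCount true) else .skip)

theorem run_moveLoop_aux₁ (x : Data) (hc : c.length + x.size ≤ cap) (ha : a.length + x.size ≤ cap)
    (h : Run cap (moveLoop pushAux₁) (stk i m (x.word.reverse ++ a) b c) S) :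
    Run cap (moveLoop pushAux₁) (stk i (x.word ++ m) a b (true :: c)) S := by
  induction x generalizing m a c with
  | nil =>
    simp only [Data.size_nil] at ha
    exact run_forCount_cons (run_popMain (.seq (run_pushAux₁ false (by omega)) (.skip _))) h
  | cons x y ihx ihy =>
    have hx := x.size_pos
    have hy := y.size_pos
    simp only [Data.size_cons] at ha hc
    refine run_forCount_cons (run_popMain (.seq (run_pushAux₁ true (by omega))
      (.seq (run_pushCount true (by omega)) (run_pushCount true (by simp; omega))))) ?_
    simp only [Data.word, List.cons_append, List.append_assoc, List.tail_cons]
    refine ihx (by simp; omega) (by simp; omega) (ihy (by omega) ?_ ?_)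
    · simp only [List.length_append, List.length_reverse, List.length_cons]
      change x.size + (a.length + 1) + y.size ≤ cap
      omega
    · simpa [Data.word] using h

theorem run_moveLoop_aux₂ (x : Data) (hc : c.length + x.size ≤ cap) (hb : b.length + x.size ≤ cap)
    (h : Run cap (moveLoop pushAux₂) (stk i m a (x.word.reverse ++ b) c) S) :
    Run cap (moveLoop pushAux₂) (stk i (x.word ++ m) a b (true :: c)) S := by
  induction x generalizing m b c with
  | nil =>
    simp only [Data.size_nil] at hb
    exact run_forCount_cons (run_popMain (.seq (run_pushAux₂ false (by omega)) (.skip _))) h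
  | cons x y ihx ihy =>
    have hx := x.size_pos
    have hy := y.size_pos
    simp only [Data.size_cons] at hb hc
    refine run_forCount_cons (run_popMain (.seq (run_pushAux₂ true (by omega))
      (.seq (run_pushCount true (by omega)) (run_pushCount true (by simp; omega))))) ?_
    simp only [Data.word, List.cons_append, List.append_assoc, List.tail_cons]
    refine ihx (by simp; omega) (by simp; omega) (ihy (by omega) ?_ ?_)
    · simp only [List.length_append, List.length_reverse, List.length_cons]
      change x.size + (b.length + 1) + y.size ≤ cap
      omega
    · simpa [Data.word] using h

/-- Move one tree to the first auxiliary stack, reversing its word. -/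
def move₁ : Prog Sym := .seq (pushCount true) (moveLoop pushAux₁)
/-- Move one tree to the second auxiliary stack, reversing its word. -/
def move₂ : Prog Sym := .seq (pushCount true) (moveLoop pushAux₂)

theorem run_move₁ (x : Data) (h : x.size ≤ cap) :
    Run cap move₁ (stk i (x.word ++ m) [] b []) (stk i m x.word.reverse b []) := by
  have hx := x.size_pos
  refine .seq (run_pushCount true (by simp; omega)) (run_moveLoop_aux₁ x (by simpa) (by simpa) ?_)
  rw [List.append_nil]
  exact run_forCount_nil

theorem run_move₂ (x : Data) (h : x.size ≤ cap) :
    Run cap move₂ (stk i (x.word ++ m) a [] []) (stk i m a x.word.reverse []) := by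
  have hx := x.size_pos
  refine .seq (run_pushCount true (by simp; omega)) (run_moveLoop_aux₂ x (by simpa) (by simpa) ?_)
  rw [List.append_nil]
  exact run_forCount_nil

/-- Pour the first auxiliary stack onto the main stack. -/
def back₁ : Prog Sym := forAux₁ pushMain
/-- Pour the second auxiliary stack onto the main stack. -/
def back₂ : Prog Sym := forAux₂ pushMain

theorem run_back₁ (h : l.length + m.length ≤ cap) :
    Run cap back₁ (stk i m l b c) (stk i (l.reverse ++ m) [] b c) := by
  induction l generalizing m with
  | nil => exact run_forAux₁_nil
  | cons x l ih =>
    simp only [List.length_cons] at h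
    refine run_forAux₁_cons (run_pushMain x (by omega)) ?_
    have := ih (m := x :: m) (by simp; omega)
    simp only [List.reverse_cons, List.append_assoc]
    exact this

theorem run_back₂ (h : l.length + m.length ≤ cap) :
    Run cap back₂ (stk i m a l c) (stk i (l.reverse ++ m) a [] c) := by
  induction l generalizing m with
  | nil => exact run_forAux₂_nil
  | cons x l ih =>
    simp only [List.length_cons] at h
    refine run_forAux₂_cons (run_pushMain x (by omega)) ?_
    have := ih (m := x :: m) (by simp; omega)
    simp only [List.reverse_cons, List.append_assoc]
    exact this

/-- Empty the second auxiliary stack. -/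
def clear₂ : Prog Sym := forAux₂ fun _ => .skip

theorem run_clear₂ : Run cap clear₂ (stk i m a l c) (stk i m a [] c) := by
  induction l with
  | nil => exact run_forAux₂_nil
  | cons x l ih => exact run_forAux₂_cons (.skip _) ih

/-- Remove the top tree of the main stack. -/
def drop : Prog Sym := .seq move₂ clear₂

theorem run_drop (x : Data) (h : x.size ≤ cap) :
    Run cap drop (stk i (x.word ++ m) a [] []) (stk i m a [] []) :=
  .seq (run_move₂ x h) run_clear₂

/-- Exchange the two top trees of the main stack. -/
def swap : Prog Sym := .seq move₁ (.seq move₂ (.seq back₁ back₂))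

theorem run_swap (x y : Data) (h : x.size + y.size + m.length ≤ cap) :
    Run cap swap (stk i (x.word ++ (y.word ++ m)) [] [] [])
      (stk i (y.word ++ (x.word ++ m)) [] [] []) := by
  refine .seq (run_move₁ x (by omega)) (.seq (run_move₂ y (by omega))
    (.seq (run_back₁ (by rw [List.length_reverse]; change x.size + _ ≤ _; omega)) ?_))
  have := run_back₂ (cap := cap) (i := i) (m := x.word ++ m) (a := []) (c := [])
    (l := y.word.reverse) (by
      rw [List.length_reverse, List.length_append]; change y.size + (x.size + _) ≤ _; omega)
  simpa using this

/-- Pour the first auxiliary stack onto the main stack and onto the second auxiliary stack. -/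
def pour₁₂ : Prog Sym := forAux₁ fun x => .seq (pushMain x) (pushAux₂ x)

theorem run_pour₁₂ (h : l.length + m.length ≤ cap) (hb : l.length + b.length ≤ cap) :
    Run cap pour₁₂ (stk i m l b c) (stk i (l.reverse ++ m) [] (l.reverse ++ b) c) := by
  induction l generalizing m b with
  | nil => exact run_forAux₁_nil
  | cons x l ih =>
    simp only [List.length_cons] at h hb
    refine run_forAux₁_cons (.seq (run_pushMain x (by omega)) (run_pushAux₂ x (by omega))) ?_
    have := ih (m := x :: m) (b := x :: b) (by simp; omega) (by simp; omega)
    simp only [List.reverse_cons, List.append_assoc]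
    exact this

/-- Pour the second auxiliary stack onto the first one. -/
def pour₂₁ : Prog Sym := forAux₂ pushAux₁

theorem run_pour₂₁ (h : l.length + a.length ≤ cap) :
    Run cap pour₂₁ (stk i m a l c) (stk i m (l.reverse ++ a) [] c) := by
  induction l generalizing a with
  | nil => exact run_forAux₂_nil
  | cons x l ih =>
    simp only [List.length_cons] at h
    refine run_forAux₂_cons (run_pushAux₁ x (by omega)) ?_
    have := ih (a := x :: a) (by simp; omega)
    simp only [List.reverse_cons, List.append_assoc]
    exact this

/-- Duplicate the top tree of the main stack. -/
def dup : Prog Sym := .seq move₁ (.seq pour₁₂ (.seq pour₂₁ back₁))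

theorem run_dup (x : Data) (h : x.size + x.size + m.length ≤ cap) :
    Run cap dup (stk i (x.word ++ m) [] [] []) (stk i (x.word ++ (x.word ++ m)) [] [] []) := by
  have e : x.word.length = x.size := rfl
  have h₁ := run_pour₁₂ (cap := cap) (i := i) (m := m) (b := []) (c := [])
    (l := x.word.reverse) (by simp; omega) (by simp; omega)
  have h₂ := run_pour₂₁ (cap := cap) (i := i) (m := x.word ++ m) (a := []) (c := [])
    (l := x.word) (by simp; omega)
  have h₃ := run_back₁ (cap := cap) (i := i) (m := x.word ++ m) (b := []) (c := [])
    (l := x.word.reverse) (by simp; omega)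
  simp only [List.reverse_reverse, List.append_nil] at h₁ h₂ h₃
  exact .seq (run_move₁ x (by omega)) (.seq h₁ (.seq h₂ h₃))

/-- Replace the top tree of the main stack by its left subtree. -/
def left : Prog Sym :=
  popMain fun o => bif o.getD false then .seq move₁ (.seq drop back₁) else pushMain false

theorem run_left (x : Data) (h : x.size + m.length ≤ cap) :
    Run cap left (stk i (x.word ++ m) [] [] []) (stk i (x.fst.word ++ m) [] [] []) := by
  cases x with
  | nil =>
    simp only [Data.size_nil] at h
    exact run_popMain (run_pushMain false (by simp [Data.word]; omega))
  | cons x y =>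
    simp only [Data.size_cons] at h
    have e : x.word.length = x.size := rfl
    have h₃ := run_back₁ (cap := cap) (i := i) (m := m) (b := []) (c := [])
      (l := x.word.reverse) (by simp; omega)
    simp only [List.reverse_reverse] at h₃
    refine run_popMain ?_
    simp only [Data.word, List.cons_append, List.append_assoc, List.tail_cons]
    exact .seq (run_move₁ x (by omega)) (.seq (run_drop y (by omega)) h₃)

/-- Replace the top tree of the main stack by its right subtree. -/
def right : Prog Sym :=
  popMain fun o => bif o.getD false then drop else pushMain false

theorem run_right (x : Data) (h : x.size + m.length ≤ cap) :
    Run cap right (stk i (x.word ++ m) [] [] []) (stk i (x.snd.word ++ m) [] [] []) := by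
  cases x with
  | nil =>
    simp only [Data.size_nil] at h
    exact run_popMain (run_pushMain false (by simp [Data.word]; omega))
  | cons x y =>
    simp only [Data.size_cons] at h
    refine run_popMain ?_
    simp only [Data.word, List.cons_append, List.append_assoc, List.tail_cons]
    exact run_drop x (by omega)

/-- Compare the auxiliary stacks from top to bottom, emptying the first one, and push a bit onto the
counter for each position at which the first stack differs from the second one. -/
def compareLoop : Prog Sym :=
  forAux₁ fun x => popAux₂ fun o => bif o == some x then .skip else pushCount true

theorem run_compareLoop (h : a.length + c.length ≤ cap) : ∃ b' c',
    Run cap compareLoop (stk i m a b c) (stk i m [] b' c') ∧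
      (b' = [] ∧ c' = [] ↔ a = b ∧ c = []) ∧ b'.length ≤ b.length ∧
      c'.length ≤ a.length + c.length := by
  induction a generalizing b c with
  | nil => exact ⟨b, c, run_forAux₁_nil, by rw [eq_comm (b := b)], le_rfl, by simp⟩
  | cons x a ih =>
    simp only [List.length_cons] at h
    by_cases hx : b.head? = some x
    · obtain ⟨b', c', h₁, h₂, h₃, h₄⟩ := ih (b := b.tail) (c := c) (by omega)
      refine ⟨b', c', run_forAux₁_cons (run_popAux₂ ?_) h₁, ?_, ?_, ?_⟩
      · rw [hx, beq_self_eq_true]; exact .skip _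
      · rw [h₂]
        cases b with
        | nil => simp at hx
        | cons y b => simp only [List.head?_cons, Option.some.injEq] at hx; simp [hx]
      · exact h₃.trans (by simp)
      · simp only [List.length_cons]; omega
    · obtain ⟨b', c', h₁, h₂, h₃, h₄⟩ := ih (b := b.tail) (c := true :: c) (by simp; omega)
      refine ⟨b', c', run_forAux₁_cons (run_popAux₂ ?_) h₁, ?_, ?_, ?_⟩
      · rw [beq_eq_false_iff_ne.2 hx]; exact run_pushCount _ (by omega)
      · rw [h₂]
        cases b with
        | nil => simp
        | cons y b =>
          simp only [List.head?_cons, Option.some.injEq] at hx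
          simp [Ne.symm hx]
      · exact h₃.trans (by simp)
      · simp only [List.length_cons] at h₄ ⊢; omega

/-- Empty the counter. -/
def clearCount : Prog Sym := forCount fun _ => .skip

theorem run_clearCount : Run cap clearCount (stk i m a b l) (stk i m a b []) := by
  induction l with
  | nil => exact run_forCount_nil
  | cons x l ih => exact run_forCount_cons (.skip _) ih

/-- Count the bits of the second auxiliary stack, emptying it. -/
def countAux₂ : Prog Sym := forAux₂ fun _ => pushCount true

theorem run_countAux₂ (h : b.length + c.length ≤ cap) : ∃ c',
    Run cap countAux₂ (stk i m a b c) (stk i m a [] c') ∧ (c' = [] ↔ b = [] ∧ c = []) := by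
  induction b generalizing c with
  | nil => exact ⟨c, run_forAux₂_nil, by simp⟩
  | cons x l ih =>
    simp only [List.length_cons] at h
    obtain ⟨c', h₁, h₂⟩ := ih (c := true :: c) (by simp; omega)
    exact ⟨c', run_forAux₂_cons (run_pushCount true (by omega)) h₁, by simp [h₂]⟩

/-- Replace the two top trees of the main stack by the truth value of their equality. -/
def compare : Prog Sym :=
  .seq move₁ (.seq move₂ (.seq compareLoop (.seq countAux₂ (popCount fun o =>
    bif o.isNone then .seq (pushMain false) (.seq (pushMain false) (pushMain true))
    else .seq clearCount (pushMain false)))))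

theorem run_compare (x y : Data) (h : x.size + y.size + m.length + 1 ≤ cap) :
    Run cap compare (stk i (x.word ++ (y.word ++ m)) [] [] [])
      (stk i ((Data.bool (decide (x = y))).word ++ m) [] [] []) := by
  have ex : x.word.length = x.size := rfl
  have ey : y.word.length = y.size := rfl
  have hx := x.size_pos
  have hy := y.size_pos
  obtain ⟨b', c', h₁, h₂, h₃, h₄⟩ := run_compareLoop (cap := cap) (i := i) (m := m)
    (a := x.word.reverse) (b := y.word.reverse) (c := []) (by simp; omega)
  simp only [List.length_reverse, List.length_nil, and_true, List.reverse_inj,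
    Data.word_injective.eq_iff] at h₂ h₃ h₄
  obtain ⟨d, h₅, h₆⟩ := run_countAux₂ (cap := cap) (i := i) (m := m) (a := []) (b := b') (c := c')
    (by omega)
  rw [h₂] at h₆
  refine .seq (run_move₁ x (by omega)) (.seq (run_move₂ y (by omega)) (.seq h₁
    (.seq h₅ (run_popCount ?_))))
  by_cases hxy : x = y
  · obtain rfl := h₆.2 hxy
    rw [decide_eq_true hxy]
    exact .seq (run_pushMain _ (by omega)) (.seq (run_pushMain _ (by simp; omega))
      (run_pushMain _ (by simp; omega)))
  · rw [decide_eq_false hxy]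
    have : d.head?.isNone = false := by
      cases d <;> simp_all
    rw [this]
    exact .seq run_clearCount (run_pushMain _ (by omega))

end Programs

end WeakNegation

/-! ### Functions computable in linear space -/

namespace WeakNegation

open Function

/-- The program `P` replaces the tree `x` on top of the main stack by `y`, and needs `s` cells of the
main stack (and of any other stack) for this. -/
def Replaces (P : Prog Sym) (x y : Data) (s : ℕ) : Prop :=
  ∀ (cap : ℕ) (r : List Bool), s + r.length ≤ cap →
    Run cap P (stk [] (x.word ++ r) [] [] []) (stk [] (y.word ++ r) [] [] [])

theorem Replaces.mono {P : Prog Sym} {x y : Data} {s t : ℕ} (h : Replaces P x y s) (hst : s ≤ t) :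
    Replaces P x y t :=
  fun cap r hc => h cap r (by omega)

theorem Replaces.seq {P Q : Prog Sym} {x y z : Data} {s : ℕ} (hP : Replaces P x y s)
    (hQ : Replaces Q y z s) : Replaces (.seq P Q) x z s :=
  fun cap r hc => .seq (hP cap r hc) (hQ cap r hc)

/-- `f` is computed by a program in linear space. -/
def LinSpace (f : Data → Data) : Prop :=
  ∃ (P : Prog Sym) (k : ℕ), ∀ x, (f x).size ≤ k * x.size ∧ Replaces P x (f x) (k * x.size)

namespace LinSpace

variable {f g h e : Data → Data}

theorem id : LinSpace fun x => x :=
  ⟨.skip, 1, fun x => ⟨by dsimp only; omega, fun _ _ _ => .skip _⟩⟩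

theorem comp (hg : LinSpace g) (hf : LinSpace f) : LinSpace fun x => g (f x) := by
  obtain ⟨P, k, hP⟩ := hf
  obtain ⟨Q, l, hQ⟩ := hg
  refine ⟨.seq P Q, k + l * k, fun x => ?_⟩
  have h₁ := (hP x).1
  have h₂ := (hQ (f x)).1
  have h₃ : l * (f x).size ≤ l * k * x.size := by
    rw [mul_assoc]; exact Nat.mul_le_mul_left _ h₁
  rw [add_mul]
  exact ⟨by dsimp only; omega, ((hP x).2.mono (by omega)).seq ((hQ (f x)).2.mono (by omega))⟩

theorem nil : LinSpace fun _ => .nil := by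
  refine ⟨.seq drop (pushMain false), 1, fun x => ⟨by simpa using Nat.succ_le_of_lt x.size_pos, ?_⟩⟩
  intro cap r hc
  have := x.size_pos
  exact .seq (run_drop x (by omega)) (run_pushMain _ (by omega))

theorem fst (hf : LinSpace f) : LinSpace fun x => (f x).fst := by
  refine comp (g := Data.fst) ⟨left, 1, fun x => ⟨?_, fun cap r hc => run_left x (by omega)⟩⟩ hf
  cases x <;> simp; omega

theorem snd (hf : LinSpace f) : LinSpace fun x => (f x).snd := by
  refine comp (g := Data.snd) ⟨right, 1, fun x => ⟨?_, fun cap r hc => run_right x (by omega)⟩⟩ hf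
  cases x <;> simp; omega

theorem cons (hf : LinSpace f) (hg : LinSpace g) : LinSpace fun x => .cons (f x) (g x) := by
  obtain ⟨P, k, hP⟩ := hf
  obtain ⟨Q, l, hQ⟩ := hg
  refine ⟨.seq dup (.seq P (.seq swap (.seq Q (.seq swap (pushMain true))))), k + l + 2,
    fun x => ?_⟩
  have h₁ := (hP x).1
  have h₂ := (hQ x).1
  have h₀ := x.size_pos
  have h₃ := (f x).size_pos
  have ex : ∀ x : Data, x.word.length = x.size := fun _ => rfl
  rw [add_mul, add_mul]
  refine ⟨by simp; omega, fun cap r hc => .seq (run_dup x (by omega)) (.seq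
    ((hP x).2 _ _ (by simp [ex]; omega)) (.seq (run_swap _ _ (by omega)) (.seq
    ((hQ x).2 _ _ (by simp [ex]; omega)) (.seq (run_swap _ _ (by omega)) ?_))))⟩
  have := run_pushMain (cap := cap) (i := []) (a := []) (b := []) (c := [])
    (m := (f x).word ++ ((g x).word ++ r)) true (by simp [ex]; omega)
  simpa [Data.word] using this

theorem const (d : Data) : LinSpace fun _ => d := by
  induction d with
  | nil => exact nil
  | cons a b iha ihb => exact cons iha ihb

theorem eq (hf : LinSpace f) (hg : LinSpace g) :
    LinSpace fun x => .bool (decide (f x = g x)) := by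
  obtain ⟨P, k, hP⟩ := hf
  obtain ⟨Q, l, hQ⟩ := hg
  refine ⟨.seq dup (.seq P (.seq swap (.seq Q (.seq swap compare)))), k + l + 3,
    fun x => ?_⟩
  have h₁ := (hP x).1
  have h₂ := (hQ x).1
  have h₀ := x.size_pos
  have ex : ∀ x : Data, x.word.length = x.size := fun _ => rfl
  rw [add_mul, add_mul]
  refine ⟨?_, fun cap r hc => .seq (run_dup x (by omega)) (.seq
    ((hP x).2 _ _ (by simp [ex]; omega)) (.seq (run_swap _ _ (by omega)) (.seq
    ((hQ x).2 _ _ (by simp [ex]; omega)) (.seq (run_swap _ _ (by omega))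
    (run_compare _ _ (by omega))))))⟩
  dsimp only
  cases decide (f x = g x) <;> simp only [Data.bool_false, Data.bool_true, Data.size_cons,
    Data.size_nil] <;> omega

theorem ite_nil (he : LinSpace e) (hf : LinSpace f) (hg : LinSpace g) :
    LinSpace fun x => if e x = .nil then f x else g x := by
  obtain ⟨O, j, hO⟩ := he
  obtain ⟨P, k, hP⟩ := hf
  obtain ⟨Q, l, hQ⟩ := hg
  refine ⟨.seq dup (.seq O (popMain fun o => bif o.getD false then .seq drop (.seq drop Q) else P)),
    j + k + l + 2, fun x => ?_⟩
  have h₁ := (hO x).1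
  have h₂ := (hP x).1
  have h₃ := (hQ x).1
  have h₀ := x.size_pos
  have ex : ∀ x : Data, x.word.length = x.size := fun _ => rfl
  rw [add_mul, add_mul, add_mul]
  refine ⟨by dsimp only; split_ifs <;> omega, fun cap r hc => .seq (run_dup x (by omega)) (.seq
    ((hO x).2 _ _ (by simp [ex]; omega)) (run_popMain ?_))⟩
  dsimp only
  cases hx : e x with
  | nil =>
    rw [if_pos rfl]
    exact (hP x).2 _ _ (by omega)
  | cons a b =>
    rw [if_neg (by simp)]
    simp only [hx, Data.size_cons] at h₁
    simp only [Data.word, List.cons_append, List.append_assoc, List.tail_cons]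
    exact .seq (run_drop a (by omega)) (.seq (run_drop b (by omega)) ((hQ x).2 _ _ (by omega)))

end LinSpace

/-- `Iterates test step B x y`: iterating `step` on `x` as long as `test` is not `nil` leads to `y`,
and all the trees on the way have at most size `B`. -/
inductive Iterates (test step : Data → Data) (B : ℕ) : Data → Data → Prop
  | done {x} (h : test x = .nil) (hB : x.size ≤ B) : Iterates test step B x x
  | next {x y} (h : test x ≠ .nil) (hB : x.size ≤ B) (hxy : Iterates test step B (step x) y) :
      Iterates test step B x y

/-- While loops need linear space in terms of the size of the trees that occur in them. -/
theorem exists_replaces_of_iterates {test step : Data → Data} (ht : LinSpace test)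
    (hs : LinSpace step) : ∃ (P : Prog Sym) (k : ℕ), ∀ B x y, Iterates test step B x y →
      Replaces P x y (k * B) := by
  obtain ⟨P, k, hP⟩ := ht
  obtain ⟨Q, l, hQ⟩ := hs
  refine ⟨.seq (.seq dup P) (whileMain (.seq (.seq drop (.seq drop Q)) (.seq dup P))), k + l + 2,
    fun B x y hxy cap r hc => ?_⟩
  have ex : ∀ x : Data, x.word.length = x.size := fun _ => rfl
  rw [add_mul, add_mul] at hc
  have hd : ∀ x : Data, x.size ≤ B → Run cap (.seq dup P) (stk [] (x.word ++ r) [] [] [])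
      (stk [] ((test x).word ++ (x.word ++ r)) [] [] []) := fun x hx =>
    have := Nat.mul_le_mul_left k hx
    .seq (run_dup x (by omega)) ((hP x).2 _ _ (by simp [ex]; omega))
  have hx : x.size ≤ B := by cases hxy <;> assumption
  refine .seq (hd x hx) ?_
  clear hx
  induction hxy with
  | done h hB => rw [h]; exact run_whileMain_false
  | @next x y h hB hxy ih =>
    have hB' : (step x).size ≤ B := by cases hxy <;> assumption
    cases hx : test x with
    | nil => exact absurd hx h
    | cons a b =>
      have h₁ := (hP x).1
      have h₂ := Nat.mul_le_mul_left k hB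
      have h₃ := Nat.mul_le_mul_left l hB
      simp only [hx, Data.size_cons] at h₁
      simp only [Data.word, List.cons_append, List.append_assoc]
      exact run_whileMain_true (.seq (.seq (run_drop a (by omega)) (.seq (run_drop b (by omega))
        ((hQ x).2 _ _ (by omega)))) (hd _ hB')) ih

/-- The left fold of `f` over a list, with an additional parameter `e` for `f`. -/
def foldData (f : Data → Data) (e : Data) : Data → Data → Data
  | acc, .nil => acc
  | acc, .cons y l => foldData f e (f (.cons e (.cons acc y))) l

/-- All values of the accumulator in the fold of `f` have at most size `B`. -/
def FoldLe (f : Data → Data) (e : Data) (B : ℕ) : Data → Data → Prop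
  | acc, .nil => acc.size ≤ B
  | acc, .cons y l => acc.size ≤ B ∧ FoldLe f e B (f (.cons e (.cons acc y))) l

theorem FoldLe.size_le {f : Data → Data} {e : Data} {B : ℕ} {acc l : Data}
    (h : FoldLe f e B acc l) : acc.size ≤ B := by
  cases l with
  | nil => exact h
  | cons y l => exact h.1

theorem FoldLe.foldData_le {f : Data → Data} {e : Data} {B : ℕ} {acc l : Data}
    (h : FoldLe f e B acc l) : (foldData f e acc l).size ≤ B := by
  induction l generalizing acc with
  | nil => exact h
  | cons y l _ ih => exact ih h.2

/-- Folds need linear space in terms of the size of the accumulator. -/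
theorem exists_replaces_foldData {f : Data → Data} (hf : LinSpace f) :
    ∃ (P : Prog Sym) (k : ℕ), ∀ e acc l B, e.size ≤ B → l.size ≤ B → FoldLe f e B acc l →
      Replaces P (.cons e (.cons acc l)) (foldData f e acc l) (k * B) := by
  obtain ⟨P, k, hP⟩ := exists_replaces_of_iterates (test := fun z => z.snd.snd)
    (step := fun z => .cons z.fst (.cons (f (.cons z.fst (.cons z.snd.fst z.snd.snd.fst)))
      z.snd.snd.snd)) LinSpace.id.snd.snd
    (.cons LinSpace.id.fst (.cons (hf.comp (.cons LinSpace.id.fst (.cons LinSpace.id.snd.fst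
      LinSpace.id.snd.snd.fst))) LinSpace.id.snd.snd.snd))
  obtain ⟨Q, j, hQ⟩ := LinSpace.id.snd.fst
  refine ⟨.seq P Q, k * 5 + j * 5, fun e acc l B he hl h => ?_⟩
  have hB : 0 < B := e.size_pos.trans_le he
  rw [add_mul, mul_assoc, mul_assoc]
  have hz := h.foldData_le
  have key : Iterates (fun z => z.snd.snd)
      (fun z => .cons z.fst (.cons (f (.cons z.fst (.cons z.snd.fst z.snd.snd.fst)))
      z.snd.snd.snd)) (5 * B) (.cons e (.cons acc l))
      (.cons e (.cons (foldData f e acc l) .nil)) := by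
    clear hz
    induction l generalizing acc with
    | nil =>
      refine .done rfl ?_
      have := h.size_le
      simp only [Data.size_cons, Data.size_nil]; omega
    | cons y l _ ih =>
      refine .next (by simp) ?_ ?_
      · have := h.1
        simp only [Data.size_cons] at hl ⊢; omega
      · refine ih _ ?_ h.2
        simp only [Data.size_cons] at hl; omega
  refine ((hP _ _ _ key).mono (by omega)).seq ((hQ _).2.mono ?_)
  have : (Data.cons e (.cons (foldData f e acc l) .nil)).size ≤ 5 * B := by
    simp only [Data.size_cons, Data.size_nil]; omega
  exact (Nat.mul_le_mul_left j this).trans (by omega)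

theorem foldLe_of_size_le {f : Data → Data} {M : ℕ}
    (h : ∀ e acc y, (f (.cons e (.cons acc y))).size ≤ max acc.size (M * e.size) + M * y.size)
    {e acc l : Data} {B : ℕ} (hB : max acc.size (M * e.size) + M * l.size ≤ B) :
    FoldLe f e B acc l := by
  induction l generalizing acc with
  | nil => exact ((le_max_left _ _).trans (Nat.le_add_right _ _)).trans hB
  | cons y l _ ih =>
    refine ⟨((le_max_left _ _).trans (Nat.le_add_right _ _)).trans hB, ih ?_⟩
    have := h e acc y
    simp only [Data.size_cons, mul_add] at hB
    omega

/-- Folds need linear space if each step enlarges the accumulator (or replaces an accumulator of size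
linear in the parameter) only by the size of the list entry, up to a constant factor. -/
theorem LinSpace.foldData {f e a l : Data → Data} (hf : LinSpace f) (he : LinSpace e)
    (ha : LinSpace a) (hl : LinSpace l) (M : ℕ)
    (h : ∀ e acc y, (f (.cons e (.cons acc y))).size ≤ max acc.size (M * e.size) + M * y.size) :
    LinSpace fun x => foldData f (e x) (a x) (l x) := by
  obtain ⟨P, k, hP⟩ := exists_replaces_foldData hf
  obtain ⟨Q, j, hQ⟩ := he.cons (ha.cons hl)
  refine ⟨.seq Q P, j + k * ((2 * M + 1) * j) + (2 * M + 1) * j, fun x => ?_⟩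
  have hz : (Data.cons (e x) (.cons (a x) (l x))).size ≤ j * x.size := (hQ x).1
  have h₁ : FoldLe f (e x) ((2 * M + 1) * (Data.cons (e x) (.cons (a x) (l x))).size)
      (a x) (l x) := by
    refine foldLe_of_size_le h ?_
    have : (2 * M + 1) * (Data.cons (e x) (.cons (a x) (l x))).size =
        2 * (M * (e x).size) + 2 * (M * (a x).size) + 2 * (M * (l x).size) + 4 * M +
          (e x).size + (a x).size + (l x).size + 2 := by
      simp only [Data.size_cons]; ring
    omega
  have h₂ := hP (e x) (a x) (l x) _ (by rw [add_mul, one_mul, Data.size_cons]; omega)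
    (by rw [add_mul, one_mul, Data.size_cons, Data.size_cons]; omega) h₁
  have h₃ := h₁.foldData_le
  have h₄ := Nat.mul_le_mul_left (2 * M + 1) hz
  have h₅ := Nat.mul_le_mul_left k h₄
  rw [add_mul, add_mul, mul_assoc k, mul_assoc (2 * M + 1)]
  exact ⟨by dsimp only; omega, ((hQ x).2.mono (by omega)).seq (h₂.mono (by omega))⟩

end WeakNegation

/-! ### Input, output and the machine -/

namespace WeakNegation

open Function Turing

/-- The letters as trees. -/
def Letter.data : Letter → Data
  | .var => .nil
  | .top => .cons .nil .nil
  | .neg => .cons .nil (.cons .nil .nil)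
  | .and => .cons .nil (.cons .nil (.cons .nil .nil))
  | .or => .cons .nil (.cons .nil (.cons .nil (.cons .nil .nil)))
  | .imp => .cons .nil (.cons .nil (.cons .nil (.cons .nil (.cons .nil .nil))))
  | .bit false => .cons (.cons .nil .nil) .nil
  | .bit true => .cons (.cons .nil .nil) (.cons .nil .nil)

/-- The list of the letters of a word, as a tree. -/
def lettersData : List Letter → Data
  | [] => .nil
  | x :: l => .cons x.data (lettersData l)

theorem Letter.size_data_le (x : Letter) : x.data.size ≤ 11 := by
  cases x with
  | bit b => cases b <;> simp [Letter.data]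
  | _ => simp [Letter.data]

theorem size_lettersData_le (l : List Letter) : (lettersData l).size ≤ 12 * l.length + 1 := by
  induction l with
  | nil => simp [lettersData]
  | cons x l ih =>
    have := x.size_data_le
    simp only [lettersData, Data.size_cons, List.length_cons]
    omega

/-- Push a word onto the main stack. -/
def pushWord : List Bool → Prog Sym
  | [] => .skip
  | x :: l => .seq (pushWord l) (pushMain x)

theorem run_pushWord {cap : ℕ} {i : List Letter} {m a b c : List Bool} (l : List Bool)
    (h : l.length + m.length ≤ cap) :
    Run cap (pushWord l) (stk i m a b c) (stk i (l ++ m) a b c) := by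
  induction l with
  | nil => exact .skip _
  | cons x l ih =>
    simp only [List.length_cons] at h
    exact .seq (ih (by omega)) (run_pushMain x (by simp; omega))

/-- Read the input and write the list of its letters, in reverse order, to the main stack. -/
def readInput : Prog Sym :=
  .seq (pushMain false) (forInput fun x => .seq (pushWord x.data.word) (pushMain true))

theorem run_readInput {cap : ℕ} (i : List Letter) (h : 12 * i.length + 1 ≤ cap) :
    Run cap readInput (stk i [] [] [] []) (stk [] (lettersData i.reverse).word [] [] []) := by
  have key : ∀ (i j : List Letter), 12 * (i.length + j.length) + 1 ≤ cap →
      Run cap (forInput fun x => .seq (pushWord x.data.word) (pushMain true))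
        (stk i (lettersData j).word [] [] [])
        (stk [] (lettersData (i.reverse ++ j)).word [] [] []) := by
    intro i
    induction i with
    | nil => intro j _; exact run_forInput_nil
    | cons x i ih =>
      intro j hj
      simp only [List.length_cons] at hj
      have h₁ := x.size_data_le
      have h₂ := size_lettersData_le j
      have e : ∀ x : Data, x.word.length = x.size := fun _ => rfl
      refine run_forInput_cons (.seq (run_pushWord _ (by simp only [e]; omega))
        (run_pushMain true (by simp only [e, List.length_append]; omega))) ?_
      rw [List.reverse_cons, List.append_assoc]
      exact ih (x :: j) (by simp; omega)
  refine .seq (run_pushMain false (by simp; omega)) ?_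
  have := key i [] (by simpa using h)
  rwa [List.append_nil] at this

/-- Turn the prefix notation of a truth value into a single bit. -/
def writeOutput : Prog Sym :=
  popMain fun o => bif o.getD false then popMain fun _ => popMain fun _ => pushMain true
    else pushMain false

theorem run_writeOutput {cap : ℕ} (b : Bool) (h : 0 < cap) :
    Run cap writeOutput (stk [] (Data.bool b).word [] [] []) (stk [] [b] [] [] []) := by
  cases b with
  | false => exact run_popMain (run_pushMain _ h)
  | true => exact run_popMain (run_popMain (run_popMain (run_pushMain _ h)))

instance (k : Stk) : Finite (Sym k) := by
  cases k
  · let f : Letter → Fin 8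
      | .var => 0
      | .bit false => 1
      | .bit true => 2
      | .top => 3
      | .and => 4
      | .or => 5
      | .imp => 6
      | .neg => 7
    refine Finite.of_injective (α := Letter) f fun x y h => ?_
    rcases x with _ | ⟨_ | _⟩ | _ | _ | _ | _ | _ <;>
      rcases y with _ | ⟨_ | _⟩ | _ | _ | _ | _ | _ <;> first | rfl | exact absurd h (by decide)
  all_goals exact inferInstanceAs (Finite Bool)

/-- The Turing machine that carries out a program, cleans up its internal state and halts. -/
noncomputable def machine (P : Prog Sym) : FinTM2 where
  K := Stk
  k₀ := .input
  k₁ := .main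
  Γ := Sym
  Λ := Option P.Lab
  main := some P.start
  ΛFin := haveI := P.finite_lab; Fintype.ofFinite _
  σ := ∀ k, Option (Sym k)
  initialState := fun _ => none
  σFin := Fintype.ofFinite _
  Γk₀Fin := Fintype.ofFinite _
  m
    | none => .load (fun _ _ => none) .halt
    | some l => P.stmt some none l

/-- A program whose stacks never have more than `cap a` cells decides `p` in space `5 * cap a`, as it
has five stacks. -/
theorem decidableInSpace_of_run {A : Type} {code : A → List Letter} {p : A → Prop}
    {P : Prog Sym} (cap : A → ℕ) (hcap : ∀ a, (code a).length ≤ cap a)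
    (h : ∀ a, ∃ b : Bool, (b = true ↔ p a) ∧
      Run (cap a) P (stk (code a) [] [] [] []) (stk [] [b] [] [] [])) :
    DecidableInSpace code p (fun a => 5 * cap a) := by
  classical
  have hinit : ∀ a, initList (machine P) (code a) =
      (⟨some (some P.start), fun _ => none, stk (code a) [] [] [] []⟩ : TM2.Cfg _ _ _) := by
    intro a
    refine congrArg (TM2.Cfg.mk _ _) ?_
    funext k
    cases k <;> rfl
  have hhalt : ∀ b : Bool, haltList (machine P) [b] =
      (⟨none, fun _ => none, stk [] [b] [] [] []⟩ : TM2.Cfg _ _ _) := by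
    intro b
    refine congrArg (TM2.Cfg.mk _ _) ?_
    funext k
    cases k <;> rfl
  have hsmall : ∀ a k, (stk (code a) [] [] [] [] k).length ≤ cap a := by
    intro a k
    cases k
    · exact hcap a
    all_goals exact Nat.zero_le _
  have key : ∀ a, Relation.ReflTransGen (CapStep (machine P).m (cap a))
      (initList (machine P) (code a)) (haltList (machine P) [decide (p a)]) := by
    intro a
    obtain ⟨b, hb, hrun⟩ := h a
    have hb' : decide (p a) = b := by
      cases b
      · exact decide_eq_false fun hp => by simpa using hb.2 hp
      · exact decide_eq_true (hb.1 rfl)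
    obtain ⟨v, hv⟩ := hrun.capStep (M := (machine P).m) (hsmall a) some none (fun _ => rfl)
      (fun _ => none)
    rw [hinit, hb', hhalt]
    exact hv.tail ⟨rfl, hrun.length_le (hsmall a)⟩
  have hreach : ∀ a, StateTransition.Reaches (machine P).step
      (initList (machine P) (code a)) (haltList (machine P) [decide (p a)]) :=
    fun a => Relation.ReflTransGen.mono (r := CapStep (machine P).m (cap a))
      (p := fun c d => d ∈ (machine P).step c) (fun _ _ h => h.1) _ _ (key a)
  have hout : ∀ (a : A) (l : List Letter), l = code a →
      Nonempty (StateTransition.EvalsTo (machine P).step (initList (machine P) l)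
        (some (haltList (machine P) [decide (p a)]))) := by
    rintro a _ rfl
    exact exists_evalsTo_of_reaches (hreach a)
  refine ⟨{ tm := machine P
            inputAlphabet := Equiv.refl Letter
            outputAlphabet := Equiv.refl Bool
            outputsFun := fun a => (hout a _ (List.map_id _)).some }, ?_, ?_⟩
  · intro k
    exact (inferInstance : ∀ k : Stk, Finite (Sym k)) k
  · intro a c hc
    have hinit' : ∀ l : List Letter, l = code a →
        StateTransition.Reaches (machine P).step (initList (machine P) l) c →
        StateTransition.Reaches (machine P).step (initList (machine P) (code a)) c := by
      rintro _ rfl h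
      exact h
    have hle := CapStep.length_le_of_reaches (key a) rfl
      (fun k => by rw [hinit]; exact hsmall a k) (hinit' _ (List.map_id _) hc)
    exact Finset.sum_le_card_nsmul (Finset.univ : Finset Stk) _ (cap a) fun k _ => hle k

end WeakNegation

/-! ### The proof-search tree -/

namespace WeakNegation

/-- The immediate subformulas of a formula. -/
def Formula.args : Formula → List Formula
  | .var _ => []
  | .top => []
  | .and α β => [α, β]
  | .or α β => [α, β]
  | .imp α β => [α, β]
  | .neg α => [α]

/-- The occurrences of subformulas of a formula, in the order of prefix notation. -/
def Formula.subs : Formula → List Formula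
  | .var i => [.var i]
  | .top => [.top]
  | .and α β => .and α β :: (α.subs ++ β.subs)
  | .or α β => .or α β :: (α.subs ++ β.subs)
  | .imp α β => .imp α β :: (α.subs ++ β.subs)
  | .neg α => .neg α :: α.subs

namespace Formula

theorem weight_pos (φ : Formula) : 0 < φ.weight := by
  cases φ <;> simp [weight]

theorem length_subs (φ : Formula) : φ.subs.length = φ.weight := by
  induction φ <;> simp_all [subs, weight]

theorem self_mem_subs (φ : Formula) : φ ∈ φ.subs := by
  cases φ <;> simp [subs]

theorem weight_lt_of_mem_args {φ ψ : Formula} (h : ψ ∈ φ.args) : ψ.weight < φ.weight := by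
  cases φ <;> simp only [args, List.mem_cons, List.not_mem_nil, or_false] at h
  case neg => subst h; simp [weight]
  all_goals rcases h with rfl | rfl <;> simp only [weight] <;> omega

theorem mem_subs_of_mem_args {φ ψ χ : Formula} (hψ : ψ ∈ φ.subs) (hχ : χ ∈ ψ.args) :
    χ ∈ φ.subs := by
  induction φ with
  | var i => simp only [subs, List.mem_singleton] at hψ; subst hψ; simp [args] at hχ
  | top => simp only [subs, List.mem_singleton] at hψ; subst hψ; simp [args] at hχ
  | neg α ih =>
    simp only [subs, List.mem_cons] at hψ ⊢
    rcases hψ with rfl | h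
    · simp only [args, List.mem_singleton] at hχ; subst hχ; exact .inr (self_mem_subs _)
    · exact .inr (ih h)
  | and α β ihα ihβ | or α β ihα ihβ | imp α β ihα ihβ =>
    simp only [subs, List.mem_cons, List.mem_append] at hψ ⊢
    rcases hψ with rfl | h | h
    · simp only [args, List.mem_cons, List.not_mem_nil, or_false] at hχ
      rcases hχ with rfl | rfl
      · exact .inr (.inl (self_mem_subs _))
      · exact .inr (.inr (self_mem_subs _))
    · exact .inr (.inl (ihα h))
    · exact .inr (.inr (ihβ h))

theorem weight_le_of_mem_subs {φ ψ : Formula} (h : ψ ∈ φ.subs) : ψ.weight ≤ φ.weight := by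
  induction φ with
  | var i => simp only [subs, List.mem_singleton] at h; rw [h]
  | top => simp only [subs, List.mem_singleton] at h; rw [h]
  | neg α ih =>
    simp only [subs, List.mem_cons] at h
    rcases h with rfl | h
    · exact le_rfl
    · have := ih h; simp only [weight]; omega
  | and α β ihα ihβ | or α β ihα ihβ | imp α β ihα ihβ =>
    simp only [subs, List.mem_cons, List.mem_append] at h
    rcases h with rfl | h | h
    · exact le_rfl
    · have := ihα h; simp only [weight]; omega
    · have := ihβ h; simp only [weight]; omega

instance : DecidablePred IsLeftGoal
  | .var i => .isTrue (.var i)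
  | .or α β => .isTrue (.or α β)
  | .neg α => .isTrue (.neg α)
  | .top => .isFalse nofun
  | .and _ _ => .isFalse nofun
  | .imp _ _ => .isFalse nofun

end Formula

theorem notMem_cons_of_mem_args {φ ψ : Formula} {Γ : Multiset Formula} (h : ψ ∈ φ.args)
    (hψ : ψ ∉ Γ) : ψ ∉ φ ::ₘ Γ := by
  rw [Multiset.mem_cons, not_or]
  refine ⟨?_, hψ⟩
  rintro rfl
  exact lt_irrefl _ (Formula.weight_lt_of_mem_args h)

theorem mem_cons_iff_of_mem_args {φ ψ : Formula} {Γ : Multiset Formula} (h : ψ ∈ φ.args) :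
    ψ ∈ φ ::ₘ Γ ↔ ψ ∈ Γ :=
  ⟨fun h' => by_contra fun hψ => notMem_cons_of_mem_args h hψ h', Multiset.mem_cons_of_mem⟩

/-- `ψ` is an immediate subformula of the goal or of a formula in the context. -/
def HSequent.Arg (s : HSequent) (ψ : Formula) : Prop :=
  ∃ χ, (χ = s.goal ∨ χ ∈ s.ctx) ∧ ψ ∈ χ.args

/-- The ways in which a premise differs from the conclusion: either the context grows and the
history is emptied, or the history grows, or the goal shrinks. -/
inductive Move (s : HSequent) : HSequent → Prop
  | ctx {x g : Formula} (hx : x ∉ s.ctx) (hx' : s.Arg x) (hg : g = s.goal ∨ s.Arg g) :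
      Move s ⟨∅, x ::ₘ s.ctx, g⟩
  | hist {g χ : Formula} (hH : s.goal ∉ s.hist) (hχ : χ ∈ s.ctx) (hg : g ∈ χ.args) :
      Move s ⟨insert s.goal s.hist, s.ctx, g⟩
  | goal {g : Formula} (hg : g ∈ s.goal.args) : Move s ⟨s.hist, s.ctx, g⟩

theorem Child.move {L : Calculus} {s t : HSequent} (h : Child L s t) : Move s t := by
  obtain ⟨ps, h, ht⟩ := h
  have argGoal : ∀ {s : HSequent} {ψ : Formula}, ψ ∈ s.goal.args → s.Arg ψ :=
    fun h => ⟨_, .inl rfl, h⟩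
  have argHead : ∀ {χ ψ φ : Formula} {H Γ}, ψ ∈ χ.args → HSequent.Arg ⟨H, χ ::ₘ Γ, φ⟩ ψ :=
    fun h => ⟨_, .inr (Multiset.mem_cons_self _ _), h⟩
  cases h with
  | ax => simp at ht
  | topR => simp at ht
  | impR₁ H Γ α β hα =>
    obtain rfl := List.mem_singleton.1 ht
    exact .ctx (s := ⟨H, Γ, _⟩) hα (argGoal (by simp [Formula.args]))
      (.inr (argGoal (by simp [Formula.args])))
  | impR₂ H Γ α β hα =>
    obtain rfl := List.mem_singleton.1 ht
    exact .goal (s := ⟨H, Γ, _⟩) (by simp [Formula.args])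
  | impL H Γ α β φ hφ hH hβ =>
    simp only [List.mem_cons, List.not_mem_nil, or_false] at ht
    rcases ht with rfl | rfl
    · exact .hist (s := ⟨H, _, φ⟩) hH (Multiset.mem_cons_self _ _) (by simp [Formula.args])
    · exact .ctx (s := ⟨H, _, φ⟩) (notMem_cons_of_mem_args (by simp [Formula.args]) hβ)
        (argHead (by simp [Formula.args])) (.inl rfl)
  | andR H Γ α β =>
    simp only [List.mem_cons, List.not_mem_nil, or_false] at ht
    rcases ht with rfl | rfl <;> exact .goal (s := ⟨H, Γ, _⟩) (by simp [Formula.args])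
  | andL₁ H Γ α β φ hφ hα =>
    obtain rfl := List.mem_singleton.1 ht
    exact .ctx (s := ⟨H, _, φ⟩) (notMem_cons_of_mem_args (by simp [Formula.args]) hα)
      (argHead (by simp [Formula.args])) (.inl rfl)
  | andL₂ H Γ α β φ hφ hβ =>
    obtain rfl := List.mem_singleton.1 ht
    exact .ctx (s := ⟨H, _, φ⟩) (notMem_cons_of_mem_args (by simp [Formula.args]) hβ)
      (argHead (by simp [Formula.args])) (.inl rfl)
  | orR₁ H Γ α β =>
    obtain rfl := List.mem_singleton.1 ht
    exact .goal (s := ⟨H, Γ, _⟩) (by simp [Formula.args])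
  | orR₂ H Γ α β =>
    obtain rfl := List.mem_singleton.1 ht
    exact .goal (s := ⟨H, Γ, _⟩) (by simp [Formula.args])
  | orL H Γ α β φ hφ hα hβ =>
    simp only [List.mem_cons, List.not_mem_nil, or_false] at ht
    rcases ht with rfl | rfl
    · exact .ctx (s := ⟨H, _, φ⟩) (notMem_cons_of_mem_args (by simp [Formula.args]) hα)
        (argHead (by simp [Formula.args])) (.inl rfl)
    · exact .ctx (s := ⟨H, _, φ⟩) (notMem_cons_of_mem_args (by simp [Formula.args]) hβ)
        (argHead (by simp [Formula.args])) (.inl rfl)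
  | n₁ hL H Γ α β hβ hα =>
    simp only [List.mem_cons, List.not_mem_nil, or_false] at ht
    rcases ht with rfl | rfl
    · exact .ctx (s := ⟨H, _, _⟩) hβ (argGoal (by simp [Formula.args]))
        (.inr (argHead (by simp [Formula.args])))
    · exact .ctx (s := ⟨H, _, .neg β⟩) (notMem_cons_of_mem_args (by simp [Formula.args]) hα)
        (argHead (by simp [Formula.args])) (.inr (argGoal (by simp [Formula.args])))
  | n₂ hL H Γ α β hβ hα =>
    simp only [List.mem_cons, List.not_mem_nil, or_false] at ht
    rcases ht with rfl | rfl
    · exact .ctx (s := ⟨H, _, _⟩) hβ (argGoal (by simp [Formula.args]))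
        (.inr (argHead (by simp [Formula.args])))
    · exact .goal (s := ⟨H, _, _⟩) (by simp [Formula.args])
  | n₃ hL H Γ α β hH hβ hα =>
    simp only [List.mem_cons, List.not_mem_nil, or_false] at ht
    rcases ht with rfl | rfl
    · exact .hist (s := ⟨H, _, _⟩) hH (Multiset.mem_cons_self _ _) (by simp [Formula.args])
    · exact .ctx (s := ⟨H, _, .neg β⟩) (notMem_cons_of_mem_args (by simp [Formula.args]) hα)
        (argHead (by simp [Formula.args])) (.inr (argGoal (by simp [Formula.args])))
  | n₄ hL H Γ α β hH hβ hα =>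
    simp only [List.mem_cons, List.not_mem_nil, or_false] at ht
    rcases ht with rfl | rfl
    · exact .hist (s := ⟨H, _, _⟩) hH (Multiset.mem_cons_self _ _) (by simp [Formula.args])
    · exact .goal (s := ⟨H, _, _⟩) (by simp [Formula.args])
  | nef hL H Γ α β hH =>
    obtain rfl := List.mem_singleton.1 ht
    exact .hist (s := ⟨H, _, _⟩) hH (Multiset.mem_cons_self _ _) (by simp [Formula.args])
  | copc₁ hL H Γ α β hβ =>
    obtain rfl := List.mem_singleton.1 ht
    exact .ctx (s := ⟨H, _, _⟩) hβ (argGoal (by simp [Formula.args]))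
      (.inr (argHead (by simp [Formula.args])))
  | copc₂ hL H Γ α β hH hβ =>
    obtain rfl := List.mem_singleton.1 ht
    exact .hist (s := ⟨H, _, _⟩) hH (Multiset.mem_cons_self _ _) (by simp [Formula.args])
  | an hL H Γ α hα =>
    obtain rfl := List.mem_singleton.1 ht
    exact .ctx (s := ⟨H, Γ, _⟩) hα (argGoal (by simp [Formula.args])) (.inl rfl)

/-- The subformula property of the proof-search tree for `φ`: all formulas are subformulas of `φ`,
those in the context are proper subformulas, and the context contains no formula twice. -/
structure Subformulas (φ : Formula) (s : HSequent) : Prop where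
  hist : ∀ ψ ∈ s.hist, ψ ∈ φ.subs
  nodup : s.ctx.Nodup
  ctx : ∀ ψ ∈ s.ctx, ψ ∈ φ.subs ∧ ψ.weight < φ.weight
  goal : s.goal ∈ φ.subs

namespace Subformulas

variable {L : Calculus} {φ : Formula} {s t : HSequent}

theorem root (φ : Formula) : Subformulas φ (root φ) :=
  ⟨by simp [WeakNegation.root], by simp [WeakNegation.root], by simp [WeakNegation.root],
    φ.self_mem_subs⟩

theorem arg (h : Subformulas φ s) {ψ : Formula} (hψ : s.Arg ψ) :
    ψ ∈ φ.subs ∧ ψ.weight < φ.weight := by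
  obtain ⟨χ, hχ, hψ⟩ := hψ
  have hχ' : χ ∈ φ.subs := by
    rcases hχ with rfl | hχ
    · exact h.goal
    · exact (h.ctx χ hχ).1
  exact ⟨Formula.mem_subs_of_mem_args hχ' hψ,
    (Formula.weight_lt_of_mem_args hψ).trans_le (Formula.weight_le_of_mem_subs hχ')⟩

theorem move (h : Subformulas φ s) (hst : Move s t) : Subformulas φ t := by
  cases hst with
  | ctx hx hx' hg =>
    refine ⟨by simp, Multiset.nodup_cons.2 ⟨hx, h.nodup⟩, ?_, ?_⟩
    · intro ψ hψ
      rcases Multiset.mem_cons.1 hψ with rfl | hψ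
      · exact h.arg hx'
      · exact h.ctx ψ hψ
    · rcases hg with rfl | hg
      · exact h.goal
      · exact (h.arg hg).1
  | hist hH hχ hg =>
    refine ⟨?_, h.nodup, h.ctx, (h.arg ⟨_, .inr hχ, hg⟩).1⟩
    intro ψ hψ
    rcases Finset.mem_insert.1 hψ with rfl | hψ
    · exact h.goal
    · exact h.hist ψ hψ
  | goal hg => exact ⟨h.hist, h.nodup, h.ctx, (h.arg ⟨_, .inl rfl, hg⟩).1⟩

theorem child (h : Subformulas φ s) (hst : Child L s t) : Subformulas φ t := h.move hst.move

theorem of_occurs (h : Occurs L φ s) : Subformulas φ s := by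
  induction h with
  | refl => exact root φ
  | tail _ h ih => exact ih.child h

theorem card_hist_le (h : Subformulas φ s) : s.hist.card ≤ φ.weight := by
  rw [← φ.length_subs]
  exact (Finset.card_le_card fun ψ hψ => List.mem_toFinset.2 (h.hist ψ hψ)).trans
    (List.toFinset_card_le _)

/-- A set of proper subformulas of `φ` does not contain `φ` itself, so it has fewer elements than `φ`
has subformulas. -/
theorem card_lt (S : Finset Formula) (h : ∀ ψ ∈ S, ψ ∈ φ.subs ∧ ψ.weight < φ.weight) :
    S.card < φ.weight := by
  have h₁ : insert φ S ⊆ φ.subs.toFinset := by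
    intro ψ hψ
    rw [List.mem_toFinset]
    rcases Finset.mem_insert.1 hψ with rfl | hψ
    · exact ψ.self_mem_subs
    · exact (h ψ hψ).1
  have h₂ : φ ∉ S := fun hφ => lt_irrefl _ (h φ hφ).2
  have h₃ := (Finset.card_le_card h₁).trans (List.toFinset_card_le _)
  rw [Finset.card_insert_of_notMem h₂, φ.length_subs] at h₃
  exact h₃

theorem card_ctx_lt (h : Subformulas φ s) : s.ctx.card < φ.weight := by
  rw [← Multiset.toFinset_card_of_nodup h.nodup]
  exact card_lt _ fun ψ hψ => h.ctx ψ (Multiset.mem_toFinset.1 hψ)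

theorem size_le (h : Subformulas φ s) : s.size ≤ 3 * φ.weight ^ 2 := by
  have h₁ : ∑ α ∈ s.hist, α.weight ≤ φ.weight * φ.weight :=
    (Finset.sum_le_card_nsmul _ _ _ fun ψ hψ => Formula.weight_le_of_mem_subs (h.hist ψ hψ)).trans
      (Nat.mul_le_mul_right _ h.card_hist_le)
  have h₂ : (s.ctx.map Formula.weight).sum ≤ φ.weight * φ.weight := by
    refine (Multiset.sum_le_card_nsmul _ φ.weight ?_).trans ?_
    · intro x hx
      obtain ⟨ψ, hψ, rfl⟩ := Multiset.mem_map.1 hx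
      exact (h.ctx ψ hψ).2.le
    · rw [Multiset.card_map]
      exact Nat.mul_le_mul_right _ h.card_ctx_lt.le
  have h₃ : s.goal.weight ≤ φ.weight * φ.weight :=
    (Formula.weight_le_of_mem_subs h.goal).trans (Nat.le_mul_of_pos_left _ φ.weight_pos)
  rw [HSequent.size, sq]
  omega

end Subformulas

/-- A measure that decreases along the branches of the proof-search tree for `φ`. A step at which
the context grows outweighs everything that happens to history and goal. While the context stays
fixed, a step at which the history grows outweighs the new goal, which is an immediate subformula of
a proper subformula of `φ`. -/
def rank (φ : Formula) (s : HSequent) : ℕ :=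
  (φ.weight - 1 - s.ctx.card) * φ.weight ^ 2 + (φ.weight - s.hist.card) * (φ.weight - 2) +
    s.goal.weight

theorem rank_pos (φ : Formula) (s : HSequent) : 0 < rank φ s := by
  have := s.goal.weight_pos
  rw [rank]
  omega

theorem rank_root_le (φ : Formula) : rank φ (root φ) ≤ φ.weight ^ 3 := by
  obtain ⟨n, hn⟩ : ∃ n, φ.weight = n + 1 := ⟨_, (Nat.succ_pred_eq_of_pos φ.weight_pos).symm⟩
  simp only [rank, root, hn, Multiset.card_zero, Finset.card_empty]
  rcases n with _ | n
  · norm_num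
  · simp only [Nat.add_sub_cancel, Nat.sub_zero, show n + 1 + 1 - 2 = n by omega]
    nlinarith

theorem rank_lt {φ : Formula} {s t : HSequent} (h : Subformulas φ s) (hst : Move s t) :
    rank φ t < rank φ s := by
  have ht := h.move hst
  have hs₁ := h.card_ctx_lt
  have hs₂ := s.goal.weight_pos
  have ht₁ := ht.card_ctx_lt
  have ht₂ := Formula.weight_le_of_mem_subs ht.goal
  have ht₃ := ht.card_hist_le
  cases hst with
  | @ctx x g hx hx' hg =>
    simp only [rank, Multiset.card_cons, Finset.card_empty, Nat.sub_zero] at *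
    obtain ⟨k, hk⟩ : ∃ k, φ.weight - 1 - s.ctx.card = k + 1 := ⟨φ.weight - 2 - s.ctx.card, by omega⟩
    rw [hk, show φ.weight - 1 - (s.ctx.card + 1) = k by omega]
    obtain ⟨n, hn⟩ : ∃ n, φ.weight = n + 2 := ⟨φ.weight - 2, by omega⟩
    rw [hn] at ht₂ ⊢
    rw [Nat.add_sub_cancel, add_mul k 1, one_mul]
    have : (n + 2) * n + (n + 2) ≤ (n + 2) ^ 2 := by nlinarith
    have := Nat.zero_le ((n + 2 - s.hist.card) * n)
    omega
  | @hist g χ hH hχ hg =>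
    simp only [rank] at *
    rw [Finset.card_insert_of_notMem hH] at *
    obtain ⟨k, hk⟩ : ∃ k, φ.weight - s.hist.card = k + 1 :=
      ⟨φ.weight - s.hist.card - 1, by omega⟩
    rw [hk, show φ.weight - (s.hist.card + 1) = k by omega, add_mul k]
    have h₁ := Formula.weight_lt_of_mem_args hg
    have h₂ := (h.ctx χ hχ).2
    omega
  | goal hg =>
    have := Formula.weight_lt_of_mem_args hg
    simp only [rank]
    omega

theorem rank_lt_of_child {L : Calculus} {φ : Formula} {s t : HSequent} (h : Subformulas φ s)
    (hst : Child L s t) : rank φ t < rank φ s := rank_lt h hst.move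

theorem length_le_rank {L : Calculus} {φ : Formula} {s : HSequent} {b : List HSequent}
    (h : Subformulas φ s) (hb : (s :: b).IsChain (Child L)) : (s :: b).length ≤ rank φ s := by
  induction b generalizing s with
  | nil => exact rank_pos φ s
  | cons t b ih =>
    rw [List.isChain_cons_cons] at hb
    have h₁ := ih (h.child hb.1) hb.2
    have h₂ := rank_lt_of_child h hb.1
    rw [List.length_cons]
    omega

theorem length_branch_le {L : Calculus} {φ : Formula} {b : List HSequent} (h : IsBranch L φ b) :
    b.length ≤ φ.weight ^ 3 := by
  obtain ⟨h₁, h₂⟩ := h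
  cases b with
  | nil => simp at h₁
  | cons s b =>
    simp only [List.head?_cons, Option.some.injEq] at h₁
    subst h₁
    exact (length_le_rank (.root φ) h₂).trans (rank_root_le φ)

section Search

variable {L : Calculus} {φ : Formula} {s t : HSequent}

theorem Search.mono {v : Bool} {m n : ℕ} (h : Search L s v m) (hmn : m ≤ n) : Search L s v n := by
  induction h generalizing n with
  | node s r m hr v hv ih =>
    obtain ⟨k, rfl⟩ := Nat.exists_eq_add_of_le hmn
    rw [add_assoc]
    exact .node s r (m + k) (fun t ht => ih t ht (Nat.le_add_right _ _)) v hv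

theorem derivable_iff : Derivable L s ↔ ∃ ps, Rule L s ps ∧ ∀ t ∈ ps, Derivable L t := by
  constructor
  · rintro ⟨_, ps, h, hps⟩
    exact ⟨ps, h, hps⟩
  · rintro ⟨ps, h, hps⟩
    exact .intro s ps h hps

open Classical in
/-- The branches from `s` on have at most `rank φ s` sequents, of size at most `3 * w ^ 2` each. -/
theorem exists_search (h : Subformulas φ s) :
    ∃ m, Search L s (decide (Derivable L s)) m ∧ m ≤ 3 * φ.weight ^ 2 * rank φ s := by
  induction hn : rank φ s using Nat.strong_induction_on generalizing s with
  | _ n ih =>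
    subst hn
    have hpos := rank_pos φ s
    refine ⟨s.size + 3 * φ.weight ^ 2 * (rank φ s - 1),
      .node s (fun t => decide (Derivable L t)) _ (fun t ht => ?_) _ ?_, ?_⟩
    · have hlt := rank_lt_of_child h ht
      obtain ⟨m, hm, hle⟩ := ih _ hlt (h.child ht) rfl
      exact hm.mono (hle.trans (Nat.mul_le_mul_left _ (by omega)))
    · simp only [decide_eq_true_eq]
      exact derivable_iff
    · obtain ⟨k, hk⟩ : ∃ k, rank φ s = k + 1 := ⟨_, (Nat.succ_pred_eq_of_pos hpos).symm⟩
      rw [hk, Nat.add_sub_cancel, mul_add, mul_one, add_comm]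
      exact Nat.add_le_add_left h.size_le _

end Search

end WeakNegation

namespace WeakNegation

/-! ### The number of children -/

/-- The first child that a formula of the context can contribute. -/
def firstChild (s : HSequent) : Formula → HSequent
  | .imp α _ => ⟨insert s.goal s.hist, s.ctx, α⟩
  | .and α _ => ⟨∅, α ::ₘ s.ctx, s.goal⟩
  | .or α _ => ⟨∅, α ::ₘ s.ctx, s.goal⟩
  | .neg α =>
      match s.goal with
      | .neg β => if β ∈ s.ctx then ⟨insert s.goal s.hist, s.ctx, α⟩ else ⟨∅, β ::ₘ s.ctx, α⟩
      | _ => s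
  | _ => s

/-- The second child that a formula of the context can contribute. -/
def secondChild (s : HSequent) : Formula → HSequent
  | .imp _ β => ⟨∅, β ::ₘ s.ctx, s.goal⟩
  | .and _ β => ⟨∅, β ::ₘ s.ctx, s.goal⟩
  | .or _ β => ⟨∅, β ::ₘ s.ctx, s.goal⟩
  | .neg α => ⟨insert s.goal s.hist, s.ctx, α⟩
  | _ => s

/-- The child that a formula `α` outside of the context contributes if its negation belongs to the
context and the goal is a negation as well. -/
def thirdChild (s : HSequent) (α : Formula) : HSequent :=
  match s.goal with
  | .neg β => ⟨∅, α ::ₘ s.ctx, β⟩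
  | _ => s

/-- The children that depend on the goal only. -/
def goalChildren (s : HSequent) : HSequent × HSequent :=
  match s.goal with
  | .imp α β => (⟨∅, α ::ₘ s.ctx, β⟩, ⟨s.hist, s.ctx, β⟩)
  | .and α β => (⟨s.hist, s.ctx, α⟩, ⟨s.hist, s.ctx, β⟩)
  | .or α β => (⟨s.hist, s.ctx, α⟩, ⟨s.hist, s.ctx, β⟩)
  | .neg α => (⟨s.hist, s.ctx, α⟩, ⟨∅, α ::ₘ s.ctx, s.goal⟩)
  | _ => (s, s)

theorem Child.cases {L : Calculus} {s t : HSequent} (h : Child L s t) :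
    (∃ ψ ∈ s.ctx, t = firstChild s ψ) ∨ (∃ ψ ∈ s.ctx, t = secondChild s ψ) ∨
      (∃ α, .neg α ∈ s.ctx ∧ α ∉ s.ctx ∧ t = thirdChild s α) ∨
      t = (goalChildren s).1 ∨ t = (goalChildren s).2 := by
  obtain ⟨ps, h, ht⟩ := h
  cases h with
  | ax => simp at ht
  | topR => simp at ht
  | impR₁ => simp_all [goalChildren]
  | impR₂ => simp_all [goalChildren]
  | andR => simp_all [goalChildren]
  | orR₁ => simp_all [goalChildren]
  | orR₂ => simp_all [goalChildren]
  | an => simp_all [goalChildren]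
  | impL H Γ α β =>
    simp only [List.mem_cons, List.not_mem_nil, or_false] at ht
    rcases ht with rfl | rfl
    · exact .inl ⟨.imp α β, by simp, rfl⟩
    · exact .inr (.inl ⟨.imp α β, by simp, rfl⟩)
  | andL₁ H Γ α β =>
    obtain rfl := List.mem_singleton.1 ht
    exact .inl ⟨.and α β, by simp, rfl⟩
  | andL₂ H Γ α β =>
    obtain rfl := List.mem_singleton.1 ht
    exact .inr (.inl ⟨.and α β, by simp, rfl⟩)
  | orL H Γ α β =>
    simp only [List.mem_cons, List.not_mem_nil, or_false] at ht
    rcases ht with rfl | rfl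
    · exact .inl ⟨.or α β, by simp, rfl⟩
    · exact .inr (.inl ⟨.or α β, by simp, rfl⟩)
  | n₁ hL H Γ α β hβ hα =>
    simp only [List.mem_cons, List.not_mem_nil, or_false] at ht
    rcases ht with rfl | rfl
    · exact .inl ⟨.neg α, by simp, by simp [firstChild, hβ]⟩
    · exact .inr (.inr (.inl ⟨α, by simp,
        notMem_cons_of_mem_args (by simp [Formula.args]) hα, by simp [thirdChild]⟩))
  | n₂ hL H Γ α β hβ hα =>
    simp only [List.mem_cons, List.not_mem_nil, or_false] at ht
    rcases ht with rfl | rfl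
    · exact .inl ⟨.neg α, by simp, by simp [firstChild, hβ]⟩
    · simp [goalChildren]
  | n₃ hL H Γ α β hH hβ hα =>
    simp only [List.mem_cons, List.not_mem_nil, or_false] at ht
    rcases ht with rfl | rfl
    · exact .inr (.inl ⟨.neg α, by simp, rfl⟩)
    · exact .inr (.inr (.inl ⟨α, by simp,
        notMem_cons_of_mem_args (by simp [Formula.args]) hα, by simp [thirdChild]⟩))
  | n₄ hL H Γ α β hH hβ hα =>
    simp only [List.mem_cons, List.not_mem_nil, or_false] at ht
    rcases ht with rfl | rfl
    · exact .inr (.inl ⟨.neg α, by simp, rfl⟩)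
    · simp [goalChildren]
  | nef hL H Γ α β hH =>
    obtain rfl := List.mem_singleton.1 ht
    exact .inr (.inl ⟨.neg α, by simp, rfl⟩)
  | copc₁ hL H Γ α β hβ =>
    obtain rfl := List.mem_singleton.1 ht
    exact .inl ⟨.neg α, by simp, by simp [firstChild, hβ]⟩
  | copc₂ hL H Γ α β hH hβ =>
    obtain rfl := List.mem_singleton.1 ht
    exact .inr (.inl ⟨.neg α, by simp, rfl⟩)

/-- The number of children is at most `2 |Γ| + |M| + 2`, where `M` consists of the formulas outside
of the context `Γ` whose negation is in `Γ`, and `|Γ| + |M|` is less than the weight of `φ`. -/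
theorem encard_children_le {L : Calculus} {φ : Formula} {s : HSequent} (h : Subformulas φ s) :
    {t | Child L s t}.encard ≤ ((2 * φ.weight : ℕ) : ℕ∞) := by
  classical
  let body : Formula → Formula := fun ψ => match ψ with
    | .neg α => α
    | ψ => ψ
  let G : Finset Formula := s.ctx.toFinset
  let M : Finset Formula := G.image body \ G
  let U : Finset HSequent := G.image (firstChild s) ∪ (G.image (secondChild s) ∪
    (M.image (thirdChild s) ∪ {(goalChildren s).1, (goalChildren s).2}))
  have hsub : {t | Child L s t} ⊆ (U : Set HSequent) := by
    intro t ht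
    simp only [U, Finset.mem_coe, Finset.mem_union, Finset.mem_image, Finset.mem_insert,
      Finset.mem_singleton]
    rcases Child.cases ht with ⟨ψ, hψ, rfl⟩ | ⟨ψ, hψ, rfl⟩ | ⟨α, h₁, h₂, rfl⟩ | h
    · exact .inl ⟨ψ, Multiset.mem_toFinset.2 hψ, rfl⟩
    · exact .inr (.inl ⟨ψ, Multiset.mem_toFinset.2 hψ, rfl⟩)
    · refine .inr (.inr (.inl ⟨α, Finset.mem_sdiff.2 ⟨Finset.mem_image.2 ⟨.neg α,
        Multiset.mem_toFinset.2 h₁, rfl⟩, fun h => h₂ (Multiset.mem_toFinset.1 h)⟩, rfl⟩))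
    · exact .inr (.inr (.inr h))
  have hcard : G.card + M.card < φ.weight := by
    rw [← Finset.card_union_of_disjoint Finset.disjoint_sdiff]
    refine Subformulas.card_lt _ fun ψ hψ => ?_
    rcases Finset.mem_union.1 hψ with hψ | hψ
    · exact h.ctx ψ (Multiset.mem_toFinset.1 hψ)
    · obtain ⟨χ, hχ, rfl⟩ := Finset.mem_image.1 (Finset.mem_sdiff.1 hψ).1
      have hχ' := Multiset.mem_toFinset.1 hχ
      cases χ with
      | neg α => exact h.arg ⟨.neg α, .inr hχ', by simp [Formula.args, body]⟩
      | _ => exact h.ctx _ hχ'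
  refine (Set.encard_le_encard hsub).trans ?_
  rw [Set.encard_coe_eq_coe_finsetCard, Nat.cast_le]
  have h₁ : (G.image (firstChild s)).card ≤ G.card := Finset.card_image_le
  have h₂ : (G.image (secondChild s)).card ≤ G.card := Finset.card_image_le
  have h₃ : (M.image (thirdChild s)).card ≤ M.card := Finset.card_image_le
  have h₄ : ({(goalChildren s).1, (goalChildren s).2} : Finset HSequent).card ≤ 2 :=
    Finset.card_le_two
  have h₅ := Finset.card_union_le (G.image (firstChild s)) (G.image (secondChild s) ∪
    (M.image (thirdChild s) ∪ {(goalChildren s).1, (goalChildren s).2}))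
  have h₆ := Finset.card_union_le (G.image (secondChild s))
    (M.image (thirdChild s) ∪ {(goalChildren s).1, (goalChildren s).2})
  have h₇ := Finset.card_union_le (M.image (thirdChild s))
    {(goalChildren s).1, (goalChildren s).2}
  change (G.image (firstChild s) ∪ (G.image (secondChild s) ∪
    (M.image (thirdChild s) ∪ {(goalChildren s).1, (goalChildren s).2}))).card ≤ _
  omega

/-! ### The rule instances with a given conclusion -/

/-- `x :: l` if `c` holds, and `l` otherwise. -/
def consIf {α : Type*} (c : Prop) [Decidable c] (x : α) (l : List α) : List α :=
  if c then x :: l else l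

theorem mem_consIf {α : Type*} {c : Prop} [Decidable c] {x y : α} {l : List α} :
    y ∈ consIf c x l ↔ (c ∧ y = x) ∨ y ∈ l := by
  unfold consIf
  split_ifs with h <;> simp [h]

/-- The first premise of the rules (n₁)-(n₄), (copc₁), (copc₂) with context `s.ctx`. -/
def negPremise₁ (s : HSequent) (α β : Formula) : HSequent :=
  if β ∈ s.ctx then ⟨insert s.goal s.hist, s.ctx, α⟩ else ⟨∅, β ::ₘ s.ctx, α⟩

/-- The second premise of the rules (n₁)-(n₄) with context `s.ctx`. -/
def negPremise₂ (s : HSequent) (α β : Formula) : HSequent :=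
  if α ∈ s.ctx then ⟨s.hist, s.ctx, β⟩ else ⟨∅, α ::ₘ s.ctx, β⟩

open Classical in
/-- The premises of the instances of left rules and of rules for negations that have conclusion `s`
and principal formula `ψ` in the context. The four rules (n₁)-(n₄) exclude each other, and together
they apply unless `β` is in the context and the goal `¬β` is in the history; so they count as one
alternative. The same holds for (copc₁) and (copc₂). -/
noncomputable def leftAlts (L : Calculus) (s : HSequent) : Formula → List (List HSequent)
  | .imp α β => consIf (s.goal.IsLeftGoal ∧ s.goal ∉ s.hist ∧ β ∉ s.ctx)
      [⟨insert s.goal s.hist, s.ctx, α⟩, ⟨∅, β ::ₘ s.ctx, s.goal⟩] []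
  | .and α β => consIf (s.goal.IsLeftGoal ∧ α ∉ s.ctx) [⟨∅, α ::ₘ s.ctx, s.goal⟩]
      (consIf (s.goal.IsLeftGoal ∧ β ∉ s.ctx) [⟨∅, β ::ₘ s.ctx, s.goal⟩] [])
  | .or α β => consIf (s.goal.IsLeftGoal ∧ α ∉ s.ctx ∧ β ∉ s.ctx)
      [⟨∅, α ::ₘ s.ctx, s.goal⟩, ⟨∅, β ::ₘ s.ctx, s.goal⟩] []
  | .neg α =>
      match s.goal with
      | .neg β =>
          consIf (L.HasN ∧ ¬(β ∈ s.ctx ∧ s.goal ∈ s.hist)) [negPremise₁ s α β, negPremise₂ s α β]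
          (consIf (L.HasNef ∧ s.goal ∉ s.hist) [⟨insert s.goal s.hist, s.ctx, α⟩]
          (consIf (L.HasCopc ∧ ¬(β ∈ s.ctx ∧ s.goal ∈ s.hist)) [negPremise₁ s α β] []))
      | _ => []
  | _ => []

open Classical in
/-- The premises of the other rule instances with conclusion `s`. -/
noncomputable def rightAlts (L : Calculus) (s : HSequent) : List (List HSequent) :=
  match s.goal with
  | .var i => consIf (.var i ∈ s.ctx) [] []
  | .top => [[]]
  | .imp α β => consIf (α ∈ s.ctx) [⟨s.hist, s.ctx, β⟩]
      (consIf (α ∉ s.ctx) [⟨∅, α ::ₘ s.ctx, β⟩] [])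
  | .and α β => [[⟨s.hist, s.ctx, α⟩, ⟨s.hist, s.ctx, β⟩]]
  | .or α β => [[⟨s.hist, s.ctx, α⟩], [⟨s.hist, s.ctx, β⟩]]
  | .neg α => consIf (L.HasAn ∧ α ∉ s.ctx) [⟨∅, α ::ₘ s.ctx, s.goal⟩] []

theorem mem_alts_of_rule {L : Calculus} {s : HSequent} {ps : List HSequent} (h : Rule L s ps) :
    ps ∈ rightAlts L s ∨ ∃ ψ ∈ s.ctx, ps ∈ leftAlts L s ψ := by
  have key : ∀ {φ ψ : Formula} {Γ : Multiset Formula}, ψ ∈ φ.args → (ψ ∈ φ ::ₘ Γ ↔ ψ ∈ Γ) :=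
    mem_cons_iff_of_mem_args
  cases h with
  | ax => exact .inl (by simp [rightAlts, mem_consIf])
  | topR => exact .inl (by simp [rightAlts])
  | impR₁ H Γ α β hα => exact .inl (by simp [rightAlts, mem_consIf, hα])
  | impR₂ H Γ α β hα => exact .inl (by simp [rightAlts, mem_consIf, hα])
  | andR => exact .inl (by simp [rightAlts])
  | orR₁ => exact .inl (by simp [rightAlts])
  | orR₂ => exact .inl (by simp [rightAlts])
  | an hL H Γ α hα => exact .inl (by simp [rightAlts, mem_consIf, hα, hL])
  | impL H Γ α β φ hφ hH hβ =>
    exact .inr ⟨_, Multiset.mem_cons_self _ _, by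
      simp only [leftAlts, mem_consIf, key (show β ∈ (Formula.imp α β).args by simp [Formula.args])]
      simp [hφ, hH, hβ]⟩
  | andL₁ H Γ α β φ hφ hα =>
    exact .inr ⟨_, Multiset.mem_cons_self _ _, by
      simp only [leftAlts, mem_consIf, key (show α ∈ (Formula.and α β).args by simp [Formula.args])]
      simp [hφ, hα]⟩
  | andL₂ H Γ α β φ hφ hβ =>
    exact .inr ⟨_, Multiset.mem_cons_self _ _, by
      simp only [leftAlts, mem_consIf, key (show β ∈ (Formula.and α β).args by simp [Formula.args])]
      simp [hφ, hβ]⟩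
  | orL H Γ α β φ hφ hα hβ =>
    exact .inr ⟨_, Multiset.mem_cons_self _ _, by
      simp only [leftAlts, mem_consIf, key (show α ∈ (Formula.or α β).args by simp [Formula.args]),
        key (show β ∈ (Formula.or α β).args by simp [Formula.args])]
      simp [hφ, hα, hβ]⟩
  | n₁ hL H Γ α β hβ hα =>
    refine .inr ⟨_, Multiset.mem_cons_self _ _, ?_⟩
    simp only [leftAlts, mem_consIf, negPremise₁, negPremise₂,
      key (show α ∈ (Formula.neg α).args by simp [Formula.args])]
    simp [hL, hβ, hα]
  | n₂ hL H Γ α β hβ hα =>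
    refine .inr ⟨_, Multiset.mem_cons_self _ _, ?_⟩
    simp only [leftAlts, mem_consIf, negPremise₁, negPremise₂,
      key (show α ∈ (Formula.neg α).args by simp [Formula.args])]
    simp [hL, hβ, hα]
  | n₃ hL H Γ α β hH hβ hα =>
    refine .inr ⟨_, Multiset.mem_cons_self _ _, ?_⟩
    simp only [leftAlts, mem_consIf, negPremise₁, negPremise₂,
      key (show α ∈ (Formula.neg α).args by simp [Formula.args])]
    simp [hL, hβ, hα, hH]
  | n₄ hL H Γ α β hH hβ hα =>
    refine .inr ⟨_, Multiset.mem_cons_self _ _, ?_⟩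
    simp only [leftAlts, mem_consIf, negPremise₁, negPremise₂,
      key (show α ∈ (Formula.neg α).args by simp [Formula.args])]
    simp [hL, hβ, hα, hH]
  | nef hL H Γ α β hH =>
    exact .inr ⟨_, Multiset.mem_cons_self _ _, by simp [leftAlts, mem_consIf, hL, hH]⟩
  | copc₁ hL H Γ α β hβ =>
    exact .inr ⟨_, Multiset.mem_cons_self _ _, by
      simp [leftAlts, mem_consIf, negPremise₁, hL, hβ]⟩
  | copc₂ hL H Γ α β hH hβ =>
    exact .inr ⟨_, Multiset.mem_cons_self _ _, by
      simp [leftAlts, mem_consIf, negPremise₁, hL, hβ, hH]⟩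

theorem rule_of_mem_rightAlts {L : Calculus} {s : HSequent} {ps : List HSequent}
    (h : ps ∈ rightAlts L s) : Rule L s ps := by
  obtain ⟨H, Γ, g⟩ := s
  cases g with
  | var i =>
    simp only [rightAlts, mem_consIf, List.not_mem_nil, or_false] at h
    obtain ⟨h, rfl⟩ := h
    obtain ⟨Δ, rfl⟩ := Multiset.exists_cons_of_mem h
    exact .ax H Δ i
  | top =>
    obtain rfl := List.mem_singleton.1 h
    exact .topR H Γ
  | imp α β =>
    simp only [rightAlts, mem_consIf, List.not_mem_nil, or_false] at h
    rcases h with ⟨h, rfl⟩ | ⟨h, rfl⟩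
    · exact .impR₂ H Γ α β h
    · exact .impR₁ H Γ α β h
  | and α β =>
    obtain rfl := List.mem_singleton.1 h
    exact .andR H Γ α β
  | or α β =>
    simp only [rightAlts, List.mem_cons, List.not_mem_nil, or_false] at h
    rcases h with rfl | rfl
    · exact .orR₁ H Γ α β
    · exact .orR₂ H Γ α β
  | neg α =>
    simp only [rightAlts, mem_consIf, List.not_mem_nil, or_false] at h
    obtain ⟨⟨hL, h⟩, rfl⟩ := h
    exact .an hL H Γ α h

theorem rule_of_mem_leftAlts {L : Calculus} {s : HSequent} {ψ : Formula} {ps : List HSequent}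
    (hψ : ψ ∈ s.ctx) (h : ps ∈ leftAlts L s ψ) : Rule L s ps := by
  obtain ⟨H, Γ', g⟩ := s
  obtain ⟨Γ, rfl⟩ := Multiset.exists_cons_of_mem hψ
  clear hψ
  have key : ∀ {φ ψ : Formula} {Γ : Multiset Formula}, ψ ∈ φ.args → (ψ ∈ φ ::ₘ Γ ↔ ψ ∈ Γ) :=
    mem_cons_iff_of_mem_args
  cases ψ with
  | var i => simp [leftAlts] at h
  | top => simp [leftAlts] at h
  | imp α β =>
    simp only [leftAlts, mem_consIf, List.not_mem_nil, or_false,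
      key (show β ∈ (Formula.imp α β).args by simp [Formula.args])] at h
    obtain ⟨⟨h₁, h₂, h₃⟩, rfl⟩ := h
    exact .impL H Γ α β g h₁ h₂ h₃
  | and α β =>
    simp only [leftAlts, mem_consIf, List.not_mem_nil, or_false,
      key (show α ∈ (Formula.and α β).args by simp [Formula.args]),
      key (show β ∈ (Formula.and α β).args by simp [Formula.args])] at h
    rcases h with ⟨⟨h₁, h₂⟩, rfl⟩ | ⟨⟨h₁, h₂⟩, rfl⟩
    · exact .andL₁ H Γ α β g h₁ h₂
    · exact .andL₂ H Γ α β g h₁ h₂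
  | or α β =>
    simp only [leftAlts, mem_consIf, List.not_mem_nil, or_false,
      key (show α ∈ (Formula.or α β).args by simp [Formula.args]),
      key (show β ∈ (Formula.or α β).args by simp [Formula.args])] at h
    obtain ⟨⟨h₁, h₂, h₃⟩, rfl⟩ := h
    exact .orL H Γ α β g h₁ h₂ h₃
  | neg α =>
    cases g with
    | neg β =>
      have hα := key (Γ := Γ) (show α ∈ (Formula.neg α).args by simp [Formula.args])
      simp only [leftAlts, mem_consIf, List.not_mem_nil, or_false, negPremise₁, negPremise₂,
        hα] at h
      rcases h with ⟨⟨hL, h₁⟩, rfl⟩ | ⟨⟨hL, h₁⟩, rfl⟩ | ⟨⟨hL, h₁⟩, rfl⟩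
      · by_cases hβ : β ∈ Formula.neg α ::ₘ Γ <;> by_cases hα' : α ∈ Γ
        · rw [if_pos hβ, if_pos hα']
          exact .n₄ hL H Γ α β (fun h => h₁ ⟨hβ, h⟩) hβ hα'
        · rw [if_pos hβ, if_neg hα']
          exact .n₃ hL H Γ α β (fun h => h₁ ⟨hβ, h⟩) hβ hα'
        · rw [if_neg hβ, if_pos hα']
          exact .n₂ hL H Γ α β hβ hα'
        · rw [if_neg hβ, if_neg hα']
          exact .n₁ hL H Γ α β hβ hα'
      · exact .nef hL H Γ α β h₁
      · by_cases hβ : β ∈ Formula.neg α ::ₘ Γ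
        · rw [if_pos hβ]
          exact .copc₂ hL H Γ α β (fun h => h₁ ⟨hβ, h⟩) hβ
        · rw [if_neg hβ]
          exact .copc₁ hL H Γ α β hβ
    | _ => simp [leftAlts] at h

open Classical in
/-- The premises of all rule instances with conclusion `s`, if the context of `s` is contained in the
list `T`. -/
noncomputable def alts (L : Calculus) (T : List Formula) (s : HSequent) : List (List HSequent) :=
  rightAlts L s ++ T.flatMap fun ψ => if ψ ∈ s.ctx then leftAlts L s ψ else []

theorem mem_alts_iff {L : Calculus} {T : List Formula} {s : HSequent} {ps : List HSequent}
    (hT : ∀ ψ ∈ s.ctx, ψ ∈ T) : ps ∈ alts L T s ↔ Rule L s ps := by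
  rw [alts, List.mem_append, List.mem_flatMap]
  constructor
  · rintro (h | ⟨ψ, -, h⟩)
    · exact rule_of_mem_rightAlts h
    · split_ifs at h with hψ
      · exact rule_of_mem_leftAlts hψ h
      · simp at h
  · intro h
    rcases mem_alts_of_rule h with h | ⟨ψ, hψ, h⟩
    · exact .inl h
    · exact .inr ⟨ψ, hT ψ hψ, by rwa [if_pos hψ]⟩

theorem length_consIf_le {α : Type*} {c : Prop} {_ : Decidable c} {x : α} {l : List α} :
    (consIf c x l).length ≤ l.length + 1 := by
  unfold consIf
  split_ifs <;> simp

theorem length_rightAlts_le (L : Calculus) (s : HSequent) : (rightAlts L s).length ≤ 2 := by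
  unfold rightAlts
  split <;> simp [consIf] <;> split_ifs <;> simp

theorem length_leftAlts_le (L : Calculus) (s : HSequent) (ψ : Formula) :
    (leftAlts L s ψ).length ≤ 3 := by
  unfold leftAlts
  split
  case h_4 =>
    split
    · exact le_trans length_consIf_le (Nat.succ_le_succ (le_trans length_consIf_le
        (Nat.succ_le_succ (le_trans length_consIf_le (Nat.succ_le_succ (Nat.zero_le _))))))
    · simp
  case h_2 =>
    exact length_consIf_le.trans (Nat.succ_le_succ (length_consIf_le.trans (by simp)))
  case h_5 => simp
  all_goals exact length_consIf_le.trans (by simp)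

theorem length_alts_le (L : Calculus) (T : List Formula) (s : HSequent) :
    (alts L T s).length ≤ 3 * T.length + 2 := by
  have h : (T.flatMap fun ψ => if ψ ∈ s.ctx then leftAlts L s ψ else []).length ≤ 3 * T.length := by
    induction T with
    | nil => simp
    | cons ψ T ih =>
      rw [List.flatMap_cons, List.length_append, List.length_cons]
      have : (if ψ ∈ s.ctx then leftAlts L s ψ else []).length ≤ 3 := by
        split_ifs
        · exact length_leftAlts_le L s ψ
        · simp
      omega
  have h' := length_rightAlts_le L s
  rw [alts, List.length_append]
  omega

end WeakNegation

/-! ### Formulas and sets of formulas as trees -/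

namespace WeakNegation

namespace Data

/-- Natural numbers as trees, in unary. -/
def unary : ℕ → Data
  | 0 => nil
  | n + 1 => cons nil (unary n)

theorem size_unary (n : ℕ) : (unary n).size = 2 * n + 1 := by
  induction n with
  | zero => rfl
  | succ n ih => simp only [unary, size_cons, size_nil, ih]; omega

theorem unary_injective : Function.Injective unary := by
  intro m n h
  have := congrArg size h
  rw [size_unary, size_unary] at this
  omega

/-- Lists as trees. -/
def ofList : List Data → Data
  | [] => nil
  | x :: l => cons x (ofList l)

@[simp] theorem ofList_nil : ofList [] = nil := rfl
@[simp] theorem ofList_cons (x : Data) (l : List Data) : ofList (x :: l) = cons x (ofList l) := rfl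

open Classical in
/-- Propositions as trees. -/
noncomputable def truth (p : Prop) : Data := if p then cons nil nil else nil

@[simp] theorem truth_true : truth True = cons nil nil := by simp [truth]
@[simp] theorem truth_false : truth False = nil := by simp [truth]

theorem size_truth_le (p : Prop) : (truth p).size ≤ 3 := by
  unfold truth; split_ifs <;> simp

/-- If-then-else for trees. -/
def ite (c a b : Data) : Data := if c = nil then b else a

@[simp] theorem ite_cons (c d a b : Data) : ite (cons c d) a b = a := by simp [ite]
@[simp] theorem ite_nil (a b : Data) : ite nil a b = b := by simp [ite]

open Classical in
theorem ite_truth (p : Prop) (a b : Data) : ite (truth p) a b = if p then a else b := by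
  by_cases h : p <;> simp [h]

/-- Equality of trees as a tree. -/
def eq (a b : Data) : Data := bool (decide (a = b))

@[simp] theorem eq_def (a b : Data) : eq a b = truth (a = b) := by
  by_cases h : a = b <;> simp [eq, h]

/-- Conjunction of truth values. -/
def and (a b : Data) : Data := ite a b nil

@[simp] theorem and_truth (p q : Prop) : and (truth p) (truth q) = truth (p ∧ q) := by
  by_cases h : p <;> simp [and, h]

/-- Negation of truth values. -/
def not (a : Data) : Data := ite a nil (cons nil nil)

@[simp] theorem not_truth (p : Prop) : not (truth p) = truth ¬p := by
  by_cases h : p <;> simp [not, h]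

end Data

open Data

theorem foldData_append (f : Data → Data) (e acc : Data) (l l' : List Data) :
    foldData f e acc (ofList (l ++ l')) = foldData f e (foldData f e acc (ofList l)) (ofList l') := by
  induction l generalizing acc with
  | nil => rfl
  | cons x l ih => exact ih _

namespace LinSpace

variable {a b c : Data → Data}

theorem ite (hc : LinSpace c) (ha : LinSpace a) (hb : LinSpace b) :
    LinSpace fun x => Data.ite (c x) (a x) (b x) := ite_nil hc hb ha

theorem and (ha : LinSpace a) (hb : LinSpace b) : LinSpace fun x => Data.and (a x) (b x) :=
  ha.ite hb nil

theorem not (ha : LinSpace a) : LinSpace fun x => Data.not (a x) :=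
  ha.ite nil (const _)

theorem deq (ha : LinSpace a) (hb : LinSpace b) : LinSpace fun x => Data.eq (a x) (b x) :=
  ha.eq hb

end LinSpace

theorem size_ite_le (c a b : Data) : (Data.ite c a b).size ≤ max a.size b.size := by
  unfold Data.ite; split_ifs
  · exact le_max_right _ _
  · exact le_max_left _ _

theorem size_fst_add_size_snd_le (a : Data) : a.fst.size + a.snd.size ≤ a.size + 1 := by
  cases a <;> simp; omega

/-! ### Subsets of a list -/

/-- The step in the search for a list entry `e` with a bit `true`. -/
def memStep (z : Data) : Data :=
  .cons z.snd.fst.fst.snd (.ite (.and (.eq z.snd.snd z.fst) z.snd.fst.fst.fst) (.cons .nil .nil)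
    z.snd.fst.snd)

/-- Membership of `x` in the subset of the list `t` given by the list of truth values `b`. -/
def memData (t b x : Data) : Data := (foldData memStep x (.cons b .nil) t).snd

/-- The step in changing the bits of a list entry `e` to `true`. -/
def insertStep (z : Data) : Data :=
  .cons z.snd.fst.fst.snd (.cons (.ite (.eq z.snd.snd z.fst) (.cons .nil .nil) z.snd.fst.fst.fst)
    z.snd.fst.snd)

/-- The reverse of a list. -/
def reverseData (l : Data) : Data := foldData (fun z => .cons z.snd.snd z.snd.fst) .nil .nil l

/-- Insertion of `x` into the subset of the list `t` given by the list of truth values `b`. -/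
def insertData (t b x : Data) : Data :=
  reverseData (foldData insertStep x (.cons b .nil) t).snd

/-- The empty subset of the list `t`. -/
def emptyData (t : Data) : Data := foldData (fun z => .cons .nil z.snd.fst) .nil .nil t

theorem LinSpace.memStep : LinSpace memStep :=
  .cons id.snd.fst.fst.snd (.ite (.and (.deq id.snd.snd id.fst) id.snd.fst.fst.fst)
    (const _) id.snd.fst.snd)

theorem LinSpace.insertStep : LinSpace insertStep :=
  .cons id.snd.fst.fst.snd (.cons (.ite (.deq id.snd.snd id.fst) (const _) id.snd.fst.fst.fst)
    id.snd.fst.snd)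

namespace LinSpace

variable {t b x : Data → Data}

theorem memData (ht : LinSpace t) (hb : LinSpace b) (hx : LinSpace x) :
    LinSpace fun v => memData (t v) (b v) (x v) := by
  refine (LinSpace.foldData memStep hx (hb.cons nil) ht 4 fun e acc y => ?_).snd
  have h₁ := size_ite_le (.and (.eq y e) acc.fst.fst) (.cons .nil .nil) acc.snd
  have h₂ := size_fst_add_size_snd_le acc
  have h₃ := size_fst_add_size_snd_le acc.fst
  have h₄ := y.size_pos
  have h₅ := acc.fst.fst.size_pos
  have h₆ := acc.snd.size_pos
  simp only [WeakNegation.memStep, snd_cons, fst_cons, size_cons, size_nil] at *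
  omega

theorem reverseData (hx : LinSpace x) : LinSpace fun v => reverseData (x v) := by
  refine LinSpace.foldData (.cons id.snd.snd id.snd.fst) nil nil hx 2 fun e acc y => ?_
  have h₄ := y.size_pos
  simp only [snd_cons, fst_cons, size_cons]
  omega

theorem insertData (ht : LinSpace t) (hb : LinSpace b) (hx : LinSpace x) :
    LinSpace fun v => insertData (t v) (b v) (x v) := by
  refine (LinSpace.foldData insertStep hx (hb.cons nil) ht 8 fun e acc y => ?_).snd.reverseData
  have h₁ := size_ite_le (.eq y e) (.cons .nil .nil) acc.fst.fst
  have h₂ := size_fst_add_size_snd_le acc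
  have h₃ := size_fst_add_size_snd_le acc.fst
  have h₄ := y.size_pos
  have h₅ := acc.fst.fst.size_pos
  have h₆ := acc.snd.size_pos
  simp only [WeakNegation.insertStep, snd_cons, fst_cons, size_cons, size_nil] at *
  omega

theorem emptyData (ht : LinSpace t) : LinSpace fun v => emptyData (t v) := by
  refine LinSpace.foldData (.cons nil id.snd.fst) nil nil ht 2 fun e acc y => ?_
  have h₄ := y.size_pos
  simp only [snd_cons, fst_cons, size_cons, size_nil]
  omega

end LinSpace

theorem reverseData_ofList (l : List Data) : reverseData (ofList l) = ofList l.reverse := by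
  have key : ∀ l acc : List Data, foldData (fun z => .cons z.snd.snd z.snd.fst) .nil (ofList acc)
      (ofList l) = ofList (l.reverse ++ acc) := by
    intro l
    induction l with
    | nil => intro acc; rfl
    | cons x l ih =>
      intro acc
      rw [List.reverse_cons, List.append_assoc]
      exact ih (x :: acc)
  simpa [reverseData] using key l []

/-- The tree for a formula. Variables are renamed by `ν`, and their new indices are written in unary. -/
def Formula.data (ν : ℕ → ℕ) : Formula → Data
  | .var i => .cons Letter.var.data (unary (ν i))
  | .top => .cons Letter.top.data .nil
  | .and α β => .cons Letter.and.data (.cons (α.data ν) (β.data ν))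
  | .or α β => .cons Letter.or.data (.cons (α.data ν) (β.data ν))
  | .imp α β => .cons Letter.imp.data (.cons (α.data ν) (β.data ν))
  | .neg α => .cons Letter.neg.data (α.data ν)

theorem Formula.data_injective {ν : ℕ → ℕ} (hν : Function.Injective ν) :
    Function.Injective (Formula.data ν) := by
  intro φ
  induction φ with
  | var i =>
    intro ψ h
    cases ψ <;> simp only [data, Letter.data, Data.cons.injEq, reduceCtorEq, false_and] at h
    rw [hν (unary_injective h.2)]
  | top =>
    intro ψ h
    cases ψ <;> simp_all [data, Letter.data]
  | neg α ih =>
    intro ψ h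
    cases ψ <;> simp only [data, Letter.data, Data.cons.injEq, reduceCtorEq, false_and, and_false] at h
    rw [ih h.2]
  | and α β ihα ihβ | or α β ihα ihβ | imp α β ihα ihβ =>
    intro ψ h
    cases ψ <;> simp only [data, Letter.data, Data.cons.injEq, reduceCtorEq, false_and, and_false] at h
    rw [ihα h.2.1, ihβ h.2.2]

section Encoding

variable (ν : ℕ → ℕ) (T : List Formula)

/-- The list of the formulas in `T`. -/
def tableData : Data := ofList (T.map (Formula.data ν))

/-- A set of formulas as a list of truth values, one for each entry of `T`. -/
noncomputable def bits (p : Formula → Prop) : Data := ofList (T.map fun ψ => truth (p ψ))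

/-- The tree for a sequent all of whose formulas are in `T`. -/
noncomputable def HSequent.data (s : HSequent) : Data :=
  .cons (bits T (· ∈ s.hist)) (.cons (bits T (· ∈ s.ctx)) (s.goal.data ν))

/-- The tree for a list of sequents. -/
noncomputable def premisesData (ps : List HSequent) : Data := ofList (ps.map (HSequent.data ν T))

/-- The tree for a list of lists of sequents. -/
noncomputable def altsData (l : List (List HSequent)) : Data := ofList (l.map (premisesData ν T))

variable {ν T}

theorem memData_eq (hν : Function.Injective ν) (p : Formula → Prop) {ψ : Formula} (hψ : ψ ∈ T) :
    memData (tableData ν T) (bits T p) (ψ.data ν) = truth (p ψ) := by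
  have key : ∀ (T : List Formula) (q : Prop), (foldData memStep (ψ.data ν)
      (.cons (bits T p) (truth q)) (tableData ν T)).snd = truth (q ∨ (ψ ∈ T ∧ p ψ)) := by
    intro T
    induction T with
    | nil => intro q; simp [tableData, foldData]
    | cons χ T ih =>
      intro q
      refine Eq.trans ?_ ((ih (q ∨ (χ = ψ ∧ p ψ))).trans ?_)
      · simp only [tableData, List.map_cons, ofList_cons, foldData, memStep, bits, snd_cons, fst_cons]
        congr 3
        simp only [eq_def, (Formula.data_injective hν).eq_iff, and_truth]
        by_cases h : χ = ψ ∧ p χ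
        · have h' : χ = ψ ∧ p ψ := ⟨h.1, h.1 ▸ h.2⟩
          simp [h, h']
        · have h' : ¬(χ = ψ ∧ p ψ) := fun h' => h ⟨h'.1, h'.1 ▸ h'.2⟩
          rw [ite_truth, if_neg h]
          simp [h']
      · congr 1
        rw [List.mem_cons, eq_comm (a := ψ)]
        apply propext
        tauto
  have := key T False
  rw [truth_false] at this
  rw [memData, this]
  simp [hψ]

theorem insertData_eq (hν : Function.Injective ν) (p : Formula → Prop) (ψ : Formula) :
    insertData (tableData ν T) (bits T p) (ψ.data ν) = bits T (fun χ => χ = ψ ∨ p χ) := by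
  have key : ∀ (T : List Formula) (acc : List Data), (foldData insertStep (ψ.data ν)
      (.cons (bits T p) (ofList acc)) (tableData ν T)).snd =
        ofList ((T.map fun χ => truth (χ = ψ ∨ p χ)).reverse ++ acc) := by
    intro T
    induction T with
    | nil => intro acc; rfl
    | cons χ T ih =>
      intro acc
      rw [List.map_cons, List.reverse_cons, List.append_assoc]
      refine Eq.trans ?_ (ih (truth (χ = ψ ∨ p χ) :: acc))
      simp only [tableData, List.map_cons, ofList_cons, foldData, insertStep, bits, snd_cons,
        fst_cons]
      congr 4
      simp only [eq_def, (Formula.data_injective hν).eq_iff]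
      by_cases h : χ = ψ <;> simp [h]
  have := key T []
  rw [ofList_nil, List.append_nil] at this
  rw [insertData, this, reverseData_ofList, List.reverse_reverse, bits]

theorem emptyData_eq : emptyData (tableData ν T) = bits T (fun _ => False) := by
  have key : ∀ (T : List Formula) (acc : List Data), foldData (fun z => .cons .nil z.snd.fst) .nil
      (ofList acc) (tableData ν T) = ofList (T.map (fun _ => Data.nil) ++ acc) := by
    intro T
    induction T with
    | nil => intro acc; rfl
    | cons χ T ih =>
      intro acc
      refine (ih (.nil :: acc)).trans ?_
      simp only [List.map_const', List.length_cons, List.replicate_succ', List.append_assoc,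
        List.singleton_append]
  have := key T []
  rw [List.append_nil] at this
  simpa [bits, emptyData] using this

end Encoding

end WeakNegation

/-! ### Computing the rule instances -/

namespace WeakNegation

open Data

/-- `x :: l` if the truth value `c` is true, and `l` otherwise. -/
def consIfData (c x l : Data) : Data := .ite c (.cons x l) l

/-- Whether a formula is a variable, a negation or a disjunction. -/
noncomputable def leftGoalData (g : Data) : Data :=
  .ite (.eq g.fst Letter.var.data) (truth True) (.ite (.eq g.fst Letter.neg.data) (truth True)
    (.eq g.fst Letter.or.data))

/-- Sequents as trees, with given components. -/
def seqData (H G g : Data) : Data := .cons H (.cons G g)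

/-- The tree computation of `negPremise₁`. -/
def negPremise₁Data (t s α β : Data) : Data :=
  .ite (memData t s.snd.fst β) (seqData (insertData t s.fst s.snd.snd) s.snd.fst α)
    (seqData (emptyData t) (insertData t s.snd.fst β) α)

/-- The tree computation of `negPremise₂`. -/
def negPremise₂Data (t s α β : Data) : Data :=
  .ite (memData t s.snd.fst α) (seqData s.fst s.snd.fst β)
    (seqData (emptyData t) (insertData t s.snd.fst α) β)

/-- The tree computation of `leftAlts` for a negation in the context. -/
noncomputable def negAltsData (L : Calculus) (t s α β : Data) : Data :=
  consIfData (.and (truth L.HasN)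
      (.not (.and (memData t s.snd.fst β) (memData t s.fst s.snd.snd))))
    (.cons (negPremise₁Data t s α β) (.cons (negPremise₂Data t s α β) .nil))
  (consIfData (.and (truth L.HasNef) (.not (memData t s.fst s.snd.snd)))
    (.cons (seqData (insertData t s.fst s.snd.snd) s.snd.fst α) .nil)
  (consIfData (.and (truth L.HasCopc)
      (.not (.and (memData t s.snd.fst β) (memData t s.fst s.snd.snd))))
    (.cons (negPremise₁Data t s α β) .nil) .nil))

/-- The tree computation of `leftAlts` for an implication in the context. -/
noncomputable def impAltsData (t s α β : Data) : Data :=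
  consIfData (.and (leftGoalData s.snd.snd) (.and (.not (memData t s.fst s.snd.snd))
      (.not (memData t s.snd.fst β))))
    (.cons (seqData (insertData t s.fst s.snd.snd) s.snd.fst α)
      (.cons (seqData (emptyData t) (insertData t s.snd.fst β) s.snd.snd) .nil)) .nil

/-- The tree computation of `leftAlts` for a conjunction in the context. -/
noncomputable def andAltsData (t s α β : Data) : Data :=
  consIfData (.and (leftGoalData s.snd.snd) (.not (memData t s.snd.fst α)))
    (.cons (seqData (emptyData t) (insertData t s.snd.fst α) s.snd.snd) .nil)
  (consIfData (.and (leftGoalData s.snd.snd) (.not (memData t s.snd.fst β)))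
    (.cons (seqData (emptyData t) (insertData t s.snd.fst β) s.snd.snd) .nil) .nil)

/-- The tree computation of `leftAlts` for a disjunction in the context. -/
noncomputable def orAltsData (t s α β : Data) : Data :=
  consIfData (.and (leftGoalData s.snd.snd) (.and (.not (memData t s.snd.fst α))
      (.not (memData t s.snd.fst β))))
    (.cons (seqData (emptyData t) (insertData t s.snd.fst α) s.snd.snd)
      (.cons (seqData (emptyData t) (insertData t s.snd.fst β) s.snd.snd) .nil)) .nil

/-- The tree computation of `leftAlts`. -/
noncomputable def leftAltsData (L : Calculus) (t s ψ : Data) : Data :=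
  .ite (.eq ψ.fst Letter.imp.data) (impAltsData t s ψ.snd.fst ψ.snd.snd)
  (.ite (.eq ψ.fst Letter.and.data) (andAltsData t s ψ.snd.fst ψ.snd.snd)
  (.ite (.eq ψ.fst Letter.or.data) (orAltsData t s ψ.snd.fst ψ.snd.snd)
  (.ite (.eq ψ.fst Letter.neg.data)
    (.ite (.eq s.snd.snd.fst Letter.neg.data) (negAltsData L t s ψ.snd s.snd.snd.snd) .nil) .nil)))

/-- The tree computation of `rightAlts` for an implication as the goal. -/
def impRightData (t s α β : Data) : Data :=
  consIfData (memData t s.snd.fst α) (.cons (seqData s.fst s.snd.fst β) .nil)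
  (consIfData (.not (memData t s.snd.fst α))
    (.cons (seqData (emptyData t) (insertData t s.snd.fst α) β) .nil) .nil)

/-- The tree computation of `rightAlts`. -/
noncomputable def rightAltsData (L : Calculus) (t s : Data) : Data :=
  .ite (.eq s.snd.snd.fst Letter.var.data)
    (consIfData (memData t s.snd.fst s.snd.snd) .nil .nil)
  (.ite (.eq s.snd.snd.fst Letter.top.data) (.cons .nil .nil)
  (.ite (.eq s.snd.snd.fst Letter.imp.data) (impRightData t s s.snd.snd.snd.fst s.snd.snd.snd.snd)
  (.ite (.eq s.snd.snd.fst Letter.and.data)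
    (.cons (.cons (seqData s.fst s.snd.fst s.snd.snd.snd.fst)
      (.cons (seqData s.fst s.snd.fst s.snd.snd.snd.snd) .nil)) .nil)
  (.ite (.eq s.snd.snd.fst Letter.or.data)
    (.cons (.cons (seqData s.fst s.snd.fst s.snd.snd.snd.fst) .nil)
      (.cons (.cons (seqData s.fst s.snd.fst s.snd.snd.snd.snd) .nil) .nil))
    (consIfData (.and (truth L.HasAn) (.not (memData t s.snd.fst s.snd.snd.snd)))
      (.cons (seqData (emptyData t) (insertData t s.snd.fst s.snd.snd.snd) s.snd.snd) .nil)
      .nil)))))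

namespace LinSpace

variable {t s a b c x l : Data → Data}

theorem consIfData (hc : LinSpace c) (hx : LinSpace x) (hl : LinSpace l) :
    LinSpace fun v => consIfData (c v) (x v) (l v) := hc.ite (hx.cons hl) hl

theorem leftGoalData (hx : LinSpace x) : LinSpace fun v => leftGoalData (x v) :=
  .ite (.deq hx.fst (const _)) (const _) (.ite (.deq hx.fst (const _)) (const _)
    (.deq hx.fst (const _)))

theorem seqData (ha : LinSpace a) (hb : LinSpace b) (hc : LinSpace c) :
    LinSpace fun v => seqData (a v) (b v) (c v) := ha.cons (hb.cons hc)

theorem negPremise₁Data (ht : LinSpace t) (hs : LinSpace s) (ha : LinSpace a) (hb : LinSpace b) :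
    LinSpace fun v => negPremise₁Data (t v) (s v) (a v) (b v) :=
  .ite (ht.memData hs.snd.fst hb) (.seqData (ht.insertData hs.fst hs.snd.snd) hs.snd.fst ha)
    (.seqData ht.emptyData (ht.insertData hs.snd.fst hb) ha)

theorem negPremise₂Data (ht : LinSpace t) (hs : LinSpace s) (ha : LinSpace a) (hb : LinSpace b) :
    LinSpace fun v => negPremise₂Data (t v) (s v) (a v) (b v) :=
  .ite (ht.memData hs.snd.fst ha) (.seqData hs.fst hs.snd.fst hb)
    (.seqData ht.emptyData (ht.insertData hs.snd.fst ha) hb)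

theorem negAltsData (L : Calculus) (ht : LinSpace t) (hs : LinSpace s) (ha : LinSpace a)
    (hb : LinSpace b) : LinSpace fun v => negAltsData L (t v) (s v) (a v) (b v) :=
  .consIfData (.and (const _) (.not (.and (ht.memData hs.snd.fst hb) (ht.memData hs.fst hs.snd.snd))))
    (.cons (.negPremise₁Data ht hs ha hb) (.cons (.negPremise₂Data ht hs ha hb) nil))
  (.consIfData (.and (const _) (.not (ht.memData hs.fst hs.snd.snd)))
    (.cons (.seqData (ht.insertData hs.fst hs.snd.snd) hs.snd.fst ha) nil)
  (.consIfData (.and (const _)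
      (.not (.and (ht.memData hs.snd.fst hb) (ht.memData hs.fst hs.snd.snd))))
    (.cons (.negPremise₁Data ht hs ha hb) nil) nil))

theorem impAltsData (ht : LinSpace t) (hs : LinSpace s) (ha : LinSpace a)
    (hb : LinSpace b) : LinSpace fun v => impAltsData (t v) (s v) (a v) (b v) :=
  .consIfData (.and hs.snd.snd.leftGoalData (.and (.not (ht.memData hs.fst hs.snd.snd))
      (.not (ht.memData hs.snd.fst hb))))
    (.cons (.seqData (ht.insertData hs.fst hs.snd.snd) hs.snd.fst ha)
      (.cons (.seqData ht.emptyData (ht.insertData hs.snd.fst hb) hs.snd.snd) nil)) nil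

theorem andAltsData (ht : LinSpace t) (hs : LinSpace s) (ha : LinSpace a)
    (hb : LinSpace b) : LinSpace fun v => andAltsData (t v) (s v) (a v) (b v) :=
  .consIfData (.and hs.snd.snd.leftGoalData (.not (ht.memData hs.snd.fst ha)))
    (.cons (.seqData ht.emptyData (ht.insertData hs.snd.fst ha) hs.snd.snd) nil)
  (.consIfData (.and hs.snd.snd.leftGoalData (.not (ht.memData hs.snd.fst hb)))
    (.cons (.seqData ht.emptyData (ht.insertData hs.snd.fst hb) hs.snd.snd) nil) nil)

theorem orAltsData (ht : LinSpace t) (hs : LinSpace s) (ha : LinSpace a)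
    (hb : LinSpace b) : LinSpace fun v => orAltsData (t v) (s v) (a v) (b v) :=
  .consIfData (.and hs.snd.snd.leftGoalData (.and (.not (ht.memData hs.snd.fst ha))
      (.not (ht.memData hs.snd.fst hb))))
    (.cons (.seqData ht.emptyData (ht.insertData hs.snd.fst ha) hs.snd.snd)
      (.cons (.seqData ht.emptyData (ht.insertData hs.snd.fst hb) hs.snd.snd) nil)) nil

theorem leftAltsData (L : Calculus) (ht : LinSpace t) (hs : LinSpace s) (hx : LinSpace x) :
    LinSpace fun v => leftAltsData L (t v) (s v) (x v) :=
  .ite (.deq hx.fst (const _)) (.impAltsData ht hs hx.snd.fst hx.snd.snd)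
  (.ite (.deq hx.fst (const _)) (.andAltsData ht hs hx.snd.fst hx.snd.snd)
  (.ite (.deq hx.fst (const _)) (.orAltsData ht hs hx.snd.fst hx.snd.snd)
  (.ite (.deq hx.fst (const _))
    (.ite (.deq hs.snd.snd.fst (const _)) (.negAltsData L ht hs hx.snd hs.snd.snd.snd) nil) nil)))

theorem impRightData (ht : LinSpace t) (hs : LinSpace s) (ha : LinSpace a)
    (hb : LinSpace b) : LinSpace fun v => impRightData (t v) (s v) (a v) (b v) :=
  .consIfData (ht.memData hs.snd.fst ha) (.cons (.seqData hs.fst hs.snd.fst hb) nil)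
  (.consIfData (.not (ht.memData hs.snd.fst ha))
    (.cons (.seqData ht.emptyData (ht.insertData hs.snd.fst ha) hb) nil) nil)

theorem rightAltsData (L : Calculus) (ht : LinSpace t) (hs : LinSpace s) :
    LinSpace fun v => rightAltsData L (t v) (s v) :=
  .ite (.deq hs.snd.snd.fst (const _)) (.consIfData (ht.memData hs.snd.fst hs.snd.snd) nil nil)
  (.ite (.deq hs.snd.snd.fst (const _)) (const _)
  (.ite (.deq hs.snd.snd.fst (const _)) (.impRightData ht hs hs.snd.snd.snd.fst hs.snd.snd.snd.snd)
  (.ite (.deq hs.snd.snd.fst (const _))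
    (.cons (.cons (.seqData hs.fst hs.snd.fst hs.snd.snd.snd.fst)
      (.cons (.seqData hs.fst hs.snd.fst hs.snd.snd.snd.snd) nil)) nil)
  (.ite (.deq hs.snd.snd.fst (const _))
    (.cons (.cons (.seqData hs.fst hs.snd.fst hs.snd.snd.snd.fst) nil)
      (.cons (.cons (.seqData hs.fst hs.snd.fst hs.snd.snd.snd.snd) nil) nil))
    (.consIfData (.and (const _) (.not (ht.memData hs.snd.fst hs.snd.snd.snd)))
      (.cons (.seqData ht.emptyData (ht.insertData hs.snd.fst hs.snd.snd.snd) hs.snd.snd) nil)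
      nil)))))

end LinSpace

section Spec

variable {ν : ℕ → ℕ} {T : List Formula} {L : Calculus} {s : HSequent}

theorem altsData_consIf {c : Prop} {_ : Decidable c} {ps : List HSequent}
    {l : List (List HSequent)} : altsData ν T (consIf c ps l) =
      consIfData (truth c) (premisesData ν T ps) (altsData ν T l) := by
  unfold consIf consIfData
  rw [ite_truth]
  split_ifs <;> rfl

theorem leftGoalData_eq (φ : Formula) : leftGoalData (φ.data ν) = truth φ.IsLeftGoal := by
  cases φ with
  | var i => simp [leftGoalData, Formula.data, Letter.data, Formula.IsLeftGoal.var]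
  | neg α => simp [leftGoalData, Formula.data, Letter.data, Formula.IsLeftGoal.neg]
  | or α β => simp [leftGoalData, Formula.data, Letter.data, Formula.IsLeftGoal.or]
  | top =>
    have : ¬Formula.top.IsLeftGoal := nofun
    simp [leftGoalData, Formula.data, Letter.data, this]
  | and α β =>
    have : ¬(Formula.and α β).IsLeftGoal := nofun
    simp [leftGoalData, Formula.data, Letter.data, this]
  | imp α β =>
    have : ¬(Formula.imp α β).IsLeftGoal := nofun
    simp [leftGoalData, Formula.data, Letter.data, this]

theorem data_hist (s : HSequent) : (s.data ν T).fst = bits T (· ∈ s.hist) := rfl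
theorem data_ctx (s : HSequent) : (s.data ν T).snd.fst = bits T (· ∈ s.ctx) := rfl
theorem data_goal (s : HSequent) : (s.data ν T).snd.snd = s.goal.data ν := rfl

theorem data_mk_hist (hν : Function.Injective ν) (s : HSequent) (α : Formula) :
    HSequent.data ν T ⟨insert s.goal s.hist, s.ctx, α⟩ =
      seqData (insertData (tableData ν T) (bits T (· ∈ s.hist)) (s.goal.data ν))
        (bits T (· ∈ s.ctx)) (α.data ν) := by
  rw [insertData_eq hν]
  simp [HSequent.data, seqData]

theorem data_mk_ctx (hν : Function.Injective ν) (s : HSequent) (α β : Formula) :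
    HSequent.data ν T ⟨∅, α ::ₘ s.ctx, β⟩ =
      seqData (emptyData (tableData ν T))
        (insertData (tableData ν T) (bits T (· ∈ s.ctx)) (α.data ν)) (β.data ν) := by
  rw [insertData_eq hν, emptyData_eq]
  simp [HSequent.data, seqData]

theorem data_mk_goal (s : HSequent) (β : Formula) :
    HSequent.data ν T ⟨s.hist, s.ctx, β⟩ =
      seqData (bits T (· ∈ s.hist)) (bits T (· ∈ s.ctx)) (β.data ν) := rfl

theorem premisesData_nil : premisesData ν T [] = .nil := rfl

theorem premisesData_cons (s : HSequent) (l : List HSequent) :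
    premisesData ν T (s :: l) = .cons (s.data ν T) (premisesData ν T l) := rfl

theorem altsData_nil : altsData ν T [] = .nil := rfl

theorem altsData_cons (ps : List HSequent) (l : List (List HSequent)) :
    altsData ν T (ps :: l) = .cons (premisesData ν T ps) (altsData ν T l) := rfl

theorem negPremise₁Data_eq (hν : Function.Injective ν) (α : Formula) {β : Formula} (hβ : β ∈ T) :
    negPremise₁Data (tableData ν T) (s.data ν T) (α.data ν) (β.data ν) =
      (negPremise₁ s α β).data ν T := by
  rw [negPremise₁Data, negPremise₁, data_hist, data_ctx, data_goal, memData_eq hν _ hβ, ite_truth,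
    ← data_mk_hist hν, ← data_mk_ctx hν]
  split_ifs <;> rfl

theorem negPremise₂Data_eq (hν : Function.Injective ν) {α : Formula} (β : Formula) (hα : α ∈ T) :
    negPremise₂Data (tableData ν T) (s.data ν T) (α.data ν) (β.data ν) =
      (negPremise₂ s α β).data ν T := by
  rw [negPremise₂Data, negPremise₂, data_hist, data_ctx, memData_eq hν _ hα, ite_truth,
    ← data_mk_ctx hν, ← data_mk_goal]
  split_ifs <;> rfl

theorem leftAltsData_eq (hν : Function.Injective ν) (hT : ∀ ψ ∈ T, ∀ χ ∈ ψ.args, χ ∈ T)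
    (hs : s.goal ∈ T) {ψ : Formula} (hψ : ψ ∈ T) :
    leftAltsData L (tableData ν T) (s.data ν T) (ψ.data ν) = altsData ν T (leftAlts L s ψ) := by
  have hT' := hT ψ hψ
  have hg := hT _ hs
  cases ψ with
  | var i => simp [leftAltsData, leftAlts, Formula.data, Letter.data, altsData_nil]
  | top => simp [leftAltsData, leftAlts, Formula.data, Letter.data, altsData_nil]
  | imp α β =>
    have hβ : β ∈ T := hT' _ (by simp [Formula.args])
    simp only [leftAlts, altsData_consIf, premisesData_cons, premisesData_nil, altsData_nil,
      data_mk_hist hν, data_mk_ctx hν]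
    simp [leftAltsData, Formula.data, Letter.data, impAltsData, data_hist, data_ctx, data_goal,
      memData_eq hν _ hβ, memData_eq hν _ hs, leftGoalData_eq]
  | and α β =>
    have hα : α ∈ T := hT' _ (by simp [Formula.args])
    have hβ : β ∈ T := hT' _ (by simp [Formula.args])
    simp only [leftAlts, altsData_consIf, premisesData_cons, premisesData_nil, altsData_nil,
      data_mk_ctx hν]
    simp [leftAltsData, Formula.data, Letter.data, andAltsData, data_ctx, data_goal,
      memData_eq hν _ hα, memData_eq hν _ hβ, leftGoalData_eq]
  | or α β =>
    have hα : α ∈ T := hT' _ (by simp [Formula.args])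
    have hβ : β ∈ T := hT' _ (by simp [Formula.args])
    simp only [leftAlts, altsData_consIf, premisesData_cons, premisesData_nil, altsData_nil,
      data_mk_ctx hν]
    simp [leftAltsData, Formula.data, Letter.data, orAltsData, data_ctx, data_goal,
      memData_eq hν _ hα, memData_eq hν _ hβ, leftGoalData_eq]
  | neg α =>
    have hα : α ∈ T := hT' _ (by simp [Formula.args])
    have e : leftAltsData L (tableData ν T) (s.data ν T) ((Formula.neg α).data ν) =
        .ite (.eq (s.goal.data ν).fst Letter.neg.data)
          (negAltsData L (tableData ν T) (s.data ν T) (α.data ν) (s.goal.data ν).snd) .nil := by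
      simp [leftAltsData, Formula.data, Letter.data, data_goal]
    rw [e]
    cases hgoal : s.goal with
    | neg β =>
      rw [hgoal] at hs hg
      have hβ : β ∈ T := hg _ (by simp [Formula.args])
      have hm : memData (tableData ν T) (s.data ν T).fst (s.data ν T).snd.snd =
          truth (s.goal ∈ s.hist) := memData_eq hν _ (hgoal ▸ hs)
      have hm' : memData (tableData ν T) (s.data ν T).snd.fst (β.data ν) =
          truth (β ∈ s.ctx) := memData_eq hν _ hβ
      simp only [leftAlts, hgoal, altsData_consIf, premisesData_cons, premisesData_nil, altsData_nil]
      rw [← hgoal, data_mk_hist hν]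
      rw [show (s.goal.data ν).fst = Letter.neg.data by rw [hgoal]; rfl,
        show (s.goal.data ν).snd = β.data ν by rw [hgoal]; rfl, eq_def, ite_truth, if_pos rfl,
        negAltsData, hm, hm', negPremise₁Data_eq hν _ hβ, negPremise₂Data_eq hν _ hα]
      simp only [and_truth, not_truth, data_hist, data_ctx, data_goal]
    | _ => simp [leftAlts, hgoal, altsData_nil, Formula.data, Letter.data]

theorem rightAltsData_eq (hν : Function.Injective ν) (hT : ∀ ψ ∈ T, ∀ χ ∈ ψ.args, χ ∈ T)
    (hs : s.goal ∈ T) :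
    rightAltsData L (tableData ν T) (s.data ν T) = altsData ν T (rightAlts L s) := by
  have hg := hT _ hs
  rw [rightAltsData]
  simp only [data_hist, data_ctx, data_goal, memData_eq hν _ hs]
  cases hgoal : s.goal with
  | var i =>
    simp [rightAlts, hgoal, altsData_consIf, premisesData_nil, altsData_nil, Formula.data]
  | top => simp [rightAlts, hgoal, altsData, premisesData, Formula.data, Letter.data]
  | imp α β =>
    rw [hgoal] at hg
    have hα : α ∈ T := hg _ (by simp [Formula.args])
    simp only [rightAlts, hgoal, altsData_consIf, premisesData_cons, premisesData_nil, altsData_nil,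
      data_mk_goal, data_mk_ctx hν]
    simp [Formula.data, Letter.data, impRightData, data_hist, data_ctx, memData_eq hν _ hα]
  | and α β =>
    simp [rightAlts, hgoal, altsData_cons, premisesData_cons, premisesData_nil, altsData_nil,
      data_mk_goal, Formula.data, Letter.data]
  | or α β =>
    simp [rightAlts, hgoal, altsData_cons, premisesData_cons, premisesData_nil, altsData_nil,
      data_mk_goal, Formula.data, Letter.data]
  | neg α =>
    rw [hgoal] at hg
    have hα : α ∈ T := hg _ (by simp [Formula.args])
    simp only [rightAlts, hgoal, altsData_consIf, premisesData_cons, premisesData_nil, altsData_nil,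
      data_mk_ctx hν]
    simp [Formula.data, Letter.data, memData_eq hν _ hα]

end Spec

end WeakNegation

/-! ### Computing a single rule instance -/

namespace WeakNegation

open Data

/-- The step in looking for a list entry. The accumulator consists of the number of entries that are
still to be skipped and of the entry that was found, if any. -/
def pickStep (z : Data) : Data :=
  .ite z.snd.fst.snd z.snd.fst (.ite z.snd.fst.fst (.cons z.snd.fst.fst.snd .nil)
    (.cons .nil (.cons .nil z.snd.snd)))

/-- The step in looking for a rule instance: pass through the instances with principal formula `y`,
provided that `y` is in the context. -/
noncomputable def altStep (L : Calculus) (z : Data) : Data :=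
  .ite (memData z.fst.fst z.fst.snd.snd.fst z.snd.snd)
    (foldData pickStep .nil z.snd.fst (leftAltsData L z.fst.fst z.fst.snd z.snd.snd)) z.snd.fst

/-- The premises of the rule instance with number `j` and conclusion `s`, marked by a leading `nil`, or
`nil` if there are fewer instances. -/
noncomputable def altData (L : Calculus) (t s j : Data) : Data :=
  (foldData (altStep L) (.cons t s)
    (foldData pickStep .nil (.cons j .nil) (rightAltsData L t s)) t).snd

theorem size_pickStep_le (e acc y : Data) :
    (pickStep (.cons e (.cons acc y))).size ≤ max acc.size (y.size + 4) := by
  have h₁ := size_ite_le acc.snd acc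
    (.ite acc.fst (.cons acc.fst.snd .nil) (.cons .nil (.cons .nil y)))
  have h₂ := size_ite_le acc.fst (.cons acc.fst.snd .nil) (.cons .nil (.cons .nil y))
  have h₄ := size_fst_add_size_snd_le acc.fst
  have h₅ := y.size_pos
  have h₆ := acc.snd.size_pos
  have h₇ := acc.fst.fst.size_pos
  cases acc <;> simp only [pickStep, snd_cons, fst_cons, size_cons, size_nil, fst_nil, snd_nil] at * <;>
    omega

theorem size_foldData_pickStep_le (e acc l : Data) :
    (foldData pickStep e acc l).size ≤ max acc.size (l.size + 4) := by
  induction l generalizing acc with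
  | nil => exact le_max_left _ _
  | cons y l _ ih =>
    have h₁ := ih (pickStep (.cons e (.cons acc y)))
    have h₂ := size_pickStep_le e acc y
    simp only [foldData, size_cons] at *
    omega

namespace LinSpace

variable {t s j a l : Data → Data}

theorem pickStep : LinSpace pickStep :=
  .ite id.snd.fst.snd id.snd.fst (.ite id.snd.fst.fst (.cons id.snd.fst.fst.snd nil)
    (.cons nil (.cons nil id.snd.snd)))

theorem pick (ha : LinSpace a) (hl : LinSpace l) :
    LinSpace fun v => WeakNegation.foldData WeakNegation.pickStep .nil (a v) (l v) := by
  refine LinSpace.foldData pickStep nil ha hl 5 fun e acc y => ?_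
  have h₁ := size_pickStep_le e acc y
  have h₂ := y.size_pos
  omega

theorem altStep (L : Calculus) : LinSpace (altStep L) :=
  .ite (id.fst.fst.memData id.fst.snd.snd.fst id.snd.snd)
    (.pick id.snd.fst (.leftAltsData L id.fst.fst id.fst.snd id.snd.snd)) id.snd.fst

theorem altData (L : Calculus) (ht : LinSpace t) (hs : LinSpace s) (hj : LinSpace j) :
    LinSpace fun v => altData L (t v) (s v) (j v) := by
  obtain ⟨_, k, hk⟩ := leftAltsData L (t := fun z => z.fst.fst) (s := fun z => z.fst.snd)
    (x := fun z => z.snd) id.fst.fst id.fst.snd id.snd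
  refine (LinSpace.foldData (altStep L) (ht.cons hs)
    (.pick (hj.cons nil) (.rightAltsData L ht hs)) ht (k + k + 4) fun e acc y => ?_).snd
  have h₁ := (hk (.cons e y)).1
  have h₂ := size_ite_le (WeakNegation.memData e.fst e.snd.snd.fst y)
    (WeakNegation.foldData WeakNegation.pickStep .nil acc
      (WeakNegation.leftAltsData L e.fst e.snd y)) acc
  have h₃ := size_foldData_pickStep_le .nil acc (WeakNegation.leftAltsData L e.fst e.snd y)
  have h₄ := y.size_pos
  have h₅ := e.size_pos
  have h₆ := Nat.mul_le_mul_left k h₄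
  simp only [WeakNegation.altStep, snd_cons, fst_cons, size_cons, mul_add, add_mul, mul_one] at *
  omega

end LinSpace

theorem foldData_pickStep_of_ne {acc : Data} (h : acc.snd ≠ .nil) (l : List Data) :
    foldData pickStep .nil acc (ofList l) = acc := by
  induction l with
  | nil => rfl
  | cons y l ih =>
    refine Eq.trans ?_ ih
    simp only [ofList_cons, foldData]
    congr 1
    simp [pickStep, Data.ite, h]

theorem foldData_pickStep (j : ℕ) (l : List Data) :
    (foldData pickStep .nil (.cons (unary j) .nil) (ofList l)).snd =
      match l[j]? with
      | none => .nil
      | some a => .cons .nil a := by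
  induction l generalizing j with
  | nil => rfl
  | cons y l ih =>
    cases j with
    | zero => exact congrArg snd (foldData_pickStep_of_ne (by simp [pickStep, unary]) l)
    | succ j => exact ih j

section Spec

variable {ν : ℕ → ℕ} {T : List Formula} {L : Calculus} {s : HSequent}

theorem altData_eq (hν : Function.Injective ν) (hT : ∀ ψ ∈ T, ∀ χ ∈ ψ.args, χ ∈ T)
    (hs : s.goal ∈ T) (j : ℕ) :
    altData L (tableData ν T) (s.data ν T) (unary j) =
      match (alts L T s)[j]? with
      | none => .nil
      | some ps => .cons .nil (premisesData ν T ps) := by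
  have key : ∀ (U : List Formula), (∀ ψ ∈ U, ψ ∈ T) → ∀ (acc : Data),
      foldData (altStep L) (.cons (tableData ν T) (s.data ν T)) acc (tableData ν U) =
        foldData pickStep .nil acc (altsData ν T
          (U.flatMap fun ψ => if ψ ∈ s.ctx then leftAlts L s ψ else [])) := by
    intro U
    induction U with
    | nil => intro _ acc; rfl
    | cons ψ U ih =>
      intro hU acc
      have hψ := hU ψ (by simp)
      rw [altsData, List.flatMap_cons, List.map_append, foldData_append]
      refine Eq.trans ?_ (ih (fun χ hχ => hU χ (by simp [hχ])) _)
      change foldData (altStep L) _ _ (tableData ν U) = _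
      congr 1
      change Data.ite (memData (tableData ν T) (s.data ν T).snd.fst (ψ.data ν))
        (foldData pickStep .nil acc (leftAltsData L (tableData ν T) (s.data ν T) (ψ.data ν))) acc = _
      rw [data_ctx, memData_eq hν _ hψ, ite_truth, leftAltsData_eq hν hT hs hψ]
      split_ifs <;> rfl
  rw [altData, rightAltsData_eq hν hT hs, key T (fun _ h => h), altsData, altsData,
    ← foldData_append, ← List.map_append, foldData_pickStep, List.getElem?_map, alts]
  cases (rightAlts L s ++ T.flatMap fun ψ => if ψ ∈ s.ctx then leftAlts L s ψ else [])[j]? <;> rfl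

end Spec

/-! ### Depth-first search -/

/-- The list `l` without its first `k` entries, where `k ≤ 2` is in unary; rule instances have at most
two premises. -/
def dropData (l k : Data) : Data :=
  .ite k (.ite k.snd l.snd.snd l.snd) l

/-- The transition function of the depth-first search. A state consists of the list of all
subformulas, the list of the calls under way, and either a call `(s, j, k)` or a result. The call
`(s, j, k)` stands for looking for a derivation of `s` that ends with the rule instance number `j`,
of which the first `k` premises have been found to be derivable, or with a later instance. A result,
marked by `nil`, is passed to the last call under way. -/
noncomputable def searchStep (L : Calculus) (z : Data) : Data :=
  let T := z.fst
  let stack := z.snd.fst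
  let call := z.snd.snd
  let s := call.fst
  let j := call.snd.fst
  let k := call.snd.snd
  let f := stack.fst
  let ps := altData L T s j
  let rest := dropData ps.snd k
  .ite s
    (.ite ps
      (.ite rest
        (.cons T (.cons (.cons call stack) (.cons rest.fst (.cons .nil .nil))))
        (.cons T (.cons stack (.cons .nil (.cons .nil .nil)))))
      (.cons T (.cons stack (.cons .nil .nil))))
    (.cons T (.cons stack.snd
      (.ite call.snd (.cons f.fst (.cons f.snd.fst (.cons .nil f.snd.snd)))
        (.cons f.fst (.cons (.cons .nil f.snd.fst) .nil)))))

/-- The search goes on unless the state is a result and no calls are under way. -/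
def searchTest (z : Data) : Data :=
  .ite z.snd.snd.fst (.cons .nil .nil) z.snd.fst

theorem LinSpace.searchTest : LinSpace searchTest :=
  .ite id.snd.snd.fst (const _) id.snd.fst

theorem LinSpace.dropData {l k : Data → Data} (hl : LinSpace l) (hk : LinSpace k) :
    LinSpace fun v => dropData (l v) (k v) :=
  .ite hk (.ite hk.snd hl.snd.snd hl.snd) hl

theorem LinSpace.searchStep (L : Calculus) : LinSpace (searchStep L) := by
  have hT : LinSpace fun z => z.fst := id.fst
  have hstack : LinSpace fun z => z.snd.fst := id.snd.fst
  have hcall : LinSpace fun z => z.snd.snd := id.snd.snd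
  have hps := altData L hT hcall.fst hcall.snd.fst
  have hrest := hps.snd.dropData hcall.snd.snd
  exact .ite hcall.fst
    (.ite hps
      (.ite hrest
        (hT.cons (.cons (hcall.cons hstack) (hrest.fst.cons (const _))))
        (hT.cons (hstack.cons (const _))))
      (hT.cons (hstack.cons (const _))))
    (hT.cons (hstack.snd.cons
      (.ite hcall.snd (hstack.fst.fst.cons (hstack.fst.snd.fst.cons (nil.cons hstack.fst.snd.snd)))
        (hstack.fst.fst.cons (.cons (nil.cons hstack.fst.snd.fst) nil)))))

end WeakNegation

/-! ### Correctness and space of the search -/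

namespace WeakNegation

open Data

section Correctness

variable {ν : ℕ → ℕ} {T : List Formula} {L : Calculus}

/-- The call `(s, j, k)` of the depth-first search. -/
noncomputable def callData (ν : ℕ → ℕ) (T : List Formula) (s : HSequent) (j k : ℕ) : Data :=
  .cons (s.data ν T) (.cons (unary j) (unary k))

/-- The result `p` of a call of the depth-first search. -/
noncomputable def resultData (p : Prop) : Data := .cons .nil (truth p)

/-- A state of the depth-first search. -/
def stateData (ν : ℕ → ℕ) (T : List Formula) (stack call : Data) : Data :=
  .cons (tableData ν T) (.cons stack call)

theorem Rule.length_le {s : HSequent} {ps : List HSequent} (h : Rule L s ps) : ps.length ≤ 2 := by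
  cases h <;> simp

theorem dropData_eq (ps : List HSequent) {k : ℕ} (hk : k ≤ 2) :
    dropData (premisesData ν T ps) (unary k) = premisesData ν T (ps.drop k) := by
  have h : ∀ ps, (premisesData ν T ps).snd = premisesData ν T (ps.drop 1) := by
    intro ps; cases ps <;> rfl
  rcases k with _ | _ | _ | k
  · rfl
  · simp [dropData, unary, h]
  · simp [dropData, unary, h]
  · omega

theorem searchTest_call (stack : Data) (s : HSequent) (j k : ℕ) :
    searchTest (stateData ν T stack (callData ν T s j k)) ≠ .nil := by
  simp [searchTest, stateData, callData, HSequent.data]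

theorem searchTest_result (stack : Data) (p : Prop) :
    searchTest (stateData ν T stack (resultData p)) = stack := by
  simp [searchTest, stateData, resultData]

theorem searchStep_result_true {s : HSequent} {j k : ℕ} (stack : Data) {p : Prop} (hp : p) :
    searchStep L (stateData ν T (.cons (callData ν T s j k) stack) (resultData p)) =
      stateData ν T stack (callData ν T s j (k + 1)) := by
  simp [searchStep, stateData, resultData, callData, hp, unary]

theorem searchStep_result_false {s : HSequent} {j k : ℕ} (stack : Data) {p : Prop} (hp : ¬p) :
    searchStep L (stateData ν T (.cons (callData ν T s j k) stack) (resultData p)) =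
      stateData ν T stack (callData ν T s (j + 1) 0) := by
  simp [searchStep, stateData, resultData, callData, hp, unary]

variable (hν : Function.Injective ν) (hT : ∀ ψ ∈ T, ∀ χ ∈ ψ.args, χ ∈ T)
include hν hT

theorem searchStep_call_none {s : HSequent} (hs : s.goal ∈ T) {j : ℕ} (k : ℕ)
    (h : (alts L T s)[j]? = none) (stack : Data) :
    searchStep L (stateData ν T stack (callData ν T s j k)) =
      stateData ν T stack (resultData False) := by
  have e := altData_eq (L := L) hν hT hs j
  rw [h] at e
  simp only [searchStep, stateData, callData, fst_cons, snd_cons]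
  rw [e]
  simp [HSequent.data, resultData]

theorem searchStep_call_nil {s : HSequent} (hs : s.goal ∈ T) {j k : ℕ} (hk : k ≤ 2)
    {ps : List HSequent} (h : (alts L T s)[j]? = some ps) (hps : ps.drop k = []) (stack : Data) :
    searchStep L (stateData ν T stack (callData ν T s j k)) =
      stateData ν T stack (resultData True) := by
  have e := altData_eq (L := L) hν hT hs j
  rw [h] at e
  simp only [searchStep, stateData, callData, fst_cons, snd_cons]
  rw [e, snd_cons, dropData_eq _ hk, hps]
  simp [HSequent.data, resultData, premisesData]

theorem searchStep_call_cons {s t : HSequent} (hs : s.goal ∈ T) {j k : ℕ} (hk : k ≤ 2)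
    {ps qs : List HSequent} (h : (alts L T s)[j]? = some ps) (hps : ps.drop k = t :: qs)
    (stack : Data) :
    searchStep L (stateData ν T stack (callData ν T s j k)) =
      stateData ν T (.cons (callData ν T s j k) stack) (callData ν T t 0 0) := by
  have e := altData_eq (L := L) hν hT hs j
  rw [h] at e
  simp only [searchStep, stateData, callData, fst_cons, snd_cons]
  rw [e, snd_cons, dropData_eq _ hk, hps]
  simp [HSequent.data, premisesData, unary]

end Correctness

/-- The call of the search for a sequent `s` of the proof-search tree for `φ` leads to the result
whether `s` is derivable. The stack of calls never grows by more than `rank φ s` calls. -/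
theorem iterates_call {ν : ℕ → ℕ} (hν : Function.Injective ν) (L : Calculus) (φ : Formula) {F B : ℕ}
    (hF : ∀ s, Subformulas φ s → ∀ j k, j ≤ 3 * φ.weight + 2 → k ≤ 2 →
      (callData ν φ.subs s j k).size ≤ F)
    (hF' : 5 ≤ F) {s : HSequent} (hs : Subformulas φ s) {stack y : Data}
    (hB : (tableData ν φ.subs).size + stack.size + rank φ s * (F + 1) + 2 ≤ B)
    (hy : Iterates searchTest (searchStep L) B
      (stateData ν φ.subs stack (resultData (Derivable L s))) y) :
    Iterates searchTest (searchStep L) B (stateData ν φ.subs stack (callData ν φ.subs s 0 0)) y := by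
  induction hn : rank φ s using Nat.strong_induction_on generalizing s stack with
  | _ n ih =>
    subst hn
    have hT : ∀ ψ ∈ φ.subs, ∀ χ ∈ ψ.args, χ ∈ φ.subs :=
      fun ψ hψ χ hχ => Formula.mem_subs_of_mem_args hψ hχ
    have hrank : F + 1 ≤ rank φ s * (F + 1) := Nat.le_mul_of_pos_left _ (rank_pos φ s)
    have hlen := length_alts_le L φ.subs s
    rw [φ.length_subs] at hlen
    have hrule : ∀ ps, ps ∈ alts L φ.subs s ↔ Rule L s ps := fun ps =>
      mem_alts_iff fun ψ hψ => (hs.ctx ψ hψ).1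
    have hsize : ∀ j k, j ≤ 3 * φ.weight + 2 → k ≤ 2 →
        (stateData ν φ.subs stack (callData ν φ.subs s j k)).size ≤ B := by
      intro j k hj hk
      have := hF s hs j k hj hk
      simp only [stateData, size_cons]
      omega
    -- The premises of rule instance number `j` are examined one after the other.
    have premises : ∀ (j : ℕ) (ps : List HSequent), (alts L φ.subs s)[j]? = some ps →
        ∀ (qs : List HSequent) (k : ℕ), k ≤ ps.length → ps.drop k = qs →
        ((∀ t ∈ qs, Derivable L t) → Iterates searchTest (searchStep L) B
          (stateData ν φ.subs stack (resultData True)) y) →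
        ((¬∀ t ∈ qs, Derivable L t) → Iterates searchTest (searchStep L) B
          (stateData ν φ.subs stack (callData ν φ.subs s (j + 1) 0)) y) →
        Iterates searchTest (searchStep L) B (stateData ν φ.subs stack (callData ν φ.subs s j k)) y := by
      intro j ps hj qs
      have hps : Rule L s ps := (hrule ps).1 (List.mem_of_getElem? hj)
      have hj' : j < (alts L φ.subs s).length := (List.getElem?_eq_some_iff.1 hj).1
      have hps' := hps.length_le
      induction qs with
      | nil =>
        intro k hk hd h₁ _
        refine .next (searchTest_call _ _ _ _) (hsize j k (by omega) (by omega)) ?_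
        rw [searchStep_call_nil hν hT hs.goal (by omega) hj hd]
        exact h₁ (by simp)
      | cons t qs ihq =>
        intro k hk hd h₁ h₂
        have hk' : k < ps.length := by
          by_contra hk'
          rw [List.drop_eq_nil_of_le (by omega)] at hd
          simp at hd
        have ht : t ∈ ps := List.mem_of_mem_drop (hd ▸ List.mem_cons_self)
        have hchild : Child L s t := ⟨ps, hps, ht⟩
        have hlt := rank_lt_of_child hs hchild
        have hmul : (rank φ t + 1) * (F + 1) ≤ rank φ s * (F + 1) := Nat.mul_le_mul_right _ hlt
        rw [add_mul, one_mul] at hmul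
        have hcall := hF s hs j k (by omega) (by omega)
        have hposs := rank_pos φ t
        have hrank' : F + 1 ≤ rank φ t * (F + 1) := Nat.le_mul_of_pos_left _ hposs
        refine .next (searchTest_call _ _ _ _) (hsize j k (by omega) (by omega)) ?_
        rw [searchStep_call_cons hν hT hs.goal (by omega) hj hd]
        refine ih _ hlt (hs.child hchild) ?_ ?_ rfl
        · simp only [size_cons]; omega
        · refine .next (by rw [searchTest_result]; simp) ?_ ?_
          · have := size_truth_le (Derivable L t)
            simp only [stateData, resultData, size_cons, size_nil]
            omega
          · by_cases hd' : Derivable L t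
            · rw [searchStep_result_true _ hd']
              refine ihq (k + 1) hk' (by rw [← List.drop_drop, hd]; rfl) (fun h => h₁ ?_)
                (fun h => h₂ fun h' => h fun t' ht' => h' t' (List.mem_cons_of_mem _ ht'))
              intro t' ht'
              rcases List.mem_cons.1 ht' with rfl | ht'
              · exact hd'
              · exact h t' ht'
            · rw [searchStep_result_false _ hd']
              exact h₂ fun h => hd' (h t List.mem_cons_self)
    -- The rule instances are examined one after the other.
    have instances : ∀ (d j : ℕ), j + d = (alts L φ.subs s).length →
        (∀ i ps, i < j → (alts L φ.subs s)[i]? = some ps → ¬∀ t ∈ ps, Derivable L t) →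
        Iterates searchTest (searchStep L) B (stateData ν φ.subs stack (callData ν φ.subs s j 0)) y := by
      intro d
      induction d with
      | zero =>
        intro j hj hfail
        refine .next (searchTest_call _ _ _ _) (hsize j 0 (by omega) (by omega)) ?_
        rw [searchStep_call_none hν hT hs.goal 0 (List.getElem?_eq_none (by omega))]
        have : ¬Derivable L s := by
          rw [derivable_iff]
          rintro ⟨ps, hps, h⟩
          obtain ⟨i, hi, hi'⟩ := List.mem_iff_getElem.1 ((hrule ps).2 hps)
          exact hfail i ps (by omega) (List.getElem?_eq_some_iff.2 ⟨hi, hi'⟩) h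
        simpa [this] using hy
      | succ d ihd =>
        intro j hj hfail
        have hj' : j < (alts L φ.subs s).length := by omega
        refine premises j _ (List.getElem?_eq_getElem hj') _ 0 (Nat.zero_le _) rfl ?_ ?_
        · intro h
          have : Derivable L s :=
            derivable_iff.2 ⟨_, (hrule _).1 (List.getElem_mem hj'), by simpa using h⟩
          simpa [this] using hy
        · intro h
          refine ihd (j + 1) (by omega) fun i ps hi hps => ?_
          rcases Nat.lt_succ_iff_lt_or_eq.1 hi with hi | rfl
          · exact hfail i ps hi hps
          · rw [List.getElem?_eq_getElem hj', Option.some.injEq] at hps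
            subst hps
            simpa using h
    exact instances _ 0 (Nat.zero_add _) (fun i ps hi => absurd hi (Nat.not_lt_zero i))

end WeakNegation

namespace WeakNegation

open Data

/-! ### Parsing -/

/-- `Folds f e B acc l acc'`: folding `f` over the list `l`, starting from `acc`, leads to `acc'`,
and all values of the accumulator have at most size `B`. -/
def Folds (f : Data → Data) (e : Data) (B : ℕ) (acc : Data) (l : List Data) (acc' : Data) : Prop :=
  FoldLe f e B acc (ofList l) ∧ foldData f e acc (ofList l) = acc'

namespace Folds

variable {f : Data → Data} {e acc acc' acc'' : Data} {B : ℕ} {l l' : List Data}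

theorem nil (h : acc.size ≤ B) : Folds f e B acc [] acc := ⟨h, rfl⟩

theorem cons {y : Data} (h : acc.size ≤ B) (hl : Folds f e B (f (.cons e (.cons acc y))) l acc') :
    Folds f e B acc (y :: l) acc' := ⟨⟨h, hl.1⟩, hl.2⟩

theorem append (h : Folds f e B acc l acc') (h' : Folds f e B acc' l' acc'') :
    Folds f e B acc (l ++ l') acc'' := by
  induction l generalizing acc with
  | nil => obtain ⟨_, rfl⟩ := h; exact h'
  | cons y l ih => exact cons h.1.1 (ih ⟨h.1.2, h.2⟩)

end Folds

/-- The step in the search for the name `e` in a list of names: the truth value whether it has been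
found is followed by the number of the names after its first occurrence. -/
def lookupStep (z : Data) : Data :=
  .cons (.ite z.snd.fst.fst (.cons .nil .nil) (.eq z.snd.snd z.fst))
    (.ite z.snd.fst.fst (.cons .nil z.snd.fst.snd) z.snd.fst.snd)

/-- The search for the name `x` in the list `l`. -/
def lookupData (l x : Data) : Data := foldData lookupStep x (.cons .nil .nil) l

theorem LinSpace.lookupData {l x : Data → Data} (hl : LinSpace l) (hx : LinSpace x) :
    LinSpace fun v => lookupData (l v) (x v) := by
  refine LinSpace.foldData (f := lookupStep) (.cons (.ite id.snd.fst.fst (const _)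
    (.deq id.snd.snd id.fst)) (.ite id.snd.fst.fst (.cons nil id.snd.fst.snd) id.snd.fst.snd))
    hx (const _) hl 8 fun e acc y => ?_
  have h₁ := size_ite_le acc.fst (.cons .nil .nil) (.eq y e)
  have h₂ := size_ite_le acc.fst (.cons .nil acc.snd) acc.snd
  have h₃ := size_fst_add_size_snd_le acc
  have h₄ := y.size_pos
  have h₅ := acc.fst.size_pos
  have h₆ : (Data.eq y e).size ≤ 3 := by rw [Data.eq_def]; exact size_truth_le _
  simp only [lookupStep, snd_cons, fst_cons, size_cons, size_nil] at *
  omega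

/-- The name of a variable: its index in binary. -/
def nameData (i : ℕ) : Data := ofList (i.bits.map Data.bool)

theorem nameData_injective : Function.Injective nameData := by
  have key : Function.Injective ofList := by
    intro l
    induction l with
    | nil => intro l' h; cases l' <;> simp_all
    | cons x l ih =>
      intro l' h
      cases l' with
      | nil => simp at h
      | cons x' l' =>
        simp only [ofList_cons, Data.cons.injEq] at h
        rw [h.1, ih h.2]
  have hb : Function.Injective Data.bool := by decide
  intro i j h
  have := List.map_injective_iff.2 hb (key h)
  exact Nat.eq_of_testBit_eq fun k => by rw [Nat.testBit_eq_inth, Nat.testBit_eq_inth, this]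

/-- The position of `i` in the list `l`, counted from the end. -/
def position (i : ℕ) : List ℕ → ℕ
  | [] => 0
  | x :: l => if x = i then l.length else position i l

theorem position_lt {i : ℕ} {l : List ℕ} (h : i ∈ l) : position i l < l.length := by
  induction l with
  | nil => simp at h
  | cons x l ih =>
    rw [position, List.length_cons]
    split_ifs with hx
    · omega
    · have := ih (by simpa [Ne.symm hx] using h)
      omega

theorem position_injOn {i j : ℕ} {l : List ℕ} (hi : i ∈ l) (hj : j ∈ l)
    (h : position i l = position j l) : i = j := by
  induction l with
  | nil => simp at hi
  | cons x l ih =>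
    rw [position, position] at h
    rw [List.mem_cons] at hi hj
    split_ifs at h with h₁ h₂ h₂
    · rw [← h₁, ← h₂]
    · have := position_lt (hj.resolve_left (Ne.symm h₂)); omega
    · have := position_lt (hi.resolve_left (Ne.symm h₁)); omega
    · exact ih (hi.resolve_left (Ne.symm h₁)) (hj.resolve_left (Ne.symm h₂)) h

theorem position_insert {i : ℕ} {l : List ℕ} (h : i ∈ l) (x : ℕ) :
    position i (l.insert x) = position i l := by
  by_cases hx : x ∈ l
  · rw [List.insert_of_mem hx]
  · rw [List.insert_of_not_mem hx, position, if_neg]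
    rintro rfl
    exact hx h

theorem lookupData_eq (l : List ℕ) (i : ℕ) :
    lookupData (ofList (l.map nameData)) (nameData i) =
      .cons (truth (i ∈ l)) (unary (position i l)) := by
  have found : ∀ (l : List ℕ) (n : ℕ), foldData lookupStep (nameData i)
      (.cons (.cons .nil .nil) (unary n)) (ofList (l.map nameData)) =
        .cons (.cons .nil .nil) (unary (l.length + n)) := by
    intro l
    induction l with
    | nil => intro n; simp [foldData]
    | cons x l ih =>
      intro n
      refine Eq.trans ?_ ((ih (n + 1)).trans ?_)
      · simp [foldData, lookupStep, unary]
      · rw [List.length_cons, Nat.add_right_comm, Nat.add_assoc]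
  induction l with
  | nil => simp [lookupData, foldData, position, unary]
  | cons x l ih =>
    rw [lookupData, List.map_cons, ofList_cons, foldData, lookupStep]
    simp only [fst_cons, snd_cons, ite_nil, eq_def, nameData_injective.eq_iff, position]
    by_cases h : x = i
    · subst h
      simpa [unary] using found l 0
    · simpa [h, Ne.symm h, lookupData] using ih

/-- The variables of a formula are added to the front of the list `l`, from right to left. -/
def Formula.names : Formula → List ℕ → List ℕ
  | .var i, l => l.insert i
  | .top, l => l
  | .neg α, l => α.names l
  | .and α β, l => α.names (β.names l)
  | .or α β, l => α.names (β.names l)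
  | .imp α β, l => α.names (β.names l)

theorem Formula.length_names_le (φ : Formula) (l : List ℕ) :
    (φ.names l).length ≤ φ.weight + l.length := by
  induction φ generalizing l with
  | var i =>
    simp only [names, weight, List.length_insert]
    split_ifs <;> omega
  | top => simp [names, weight]
  | neg α ih => have := ih l; simp only [names, weight]; omega
  | and α β ihα ihβ | or α β ihα ihβ | imp α β ihα ihβ =>
    have h₁ := ihα (β.names l)
    have h₂ := ihβ l
    simp only [names, weight]; omega

/-- Names are added at the front, and positions are counted from the end. So a variable keeps its number
once it has been read. -/
theorem Formula.names_stable (φ : Formula) {l : List ℕ} {i : ℕ} (h : i ∈ l) :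
    i ∈ φ.names l ∧ position i (φ.names l) = position i l := by
  induction φ generalizing l with
  | var j => exact ⟨List.mem_insert_of_mem h, position_insert h j⟩
  | top => exact ⟨h, rfl⟩
  | neg α ih => exact ih h
  | and α β ihα ihβ | or α β ihα ihβ | imp α β ihα ihβ =>
    have h₁ := ihβ h
    have h₂ := ihα h₁.1
    exact ⟨h₂.1, h₂.2.trans h₁.2⟩

/-- The renaming of variables given by a list `l` of variables: those in `l` are numbered from the
end of the list, and the others get larger numbers. -/
def newIndex (l : List ℕ) (i : ℕ) : ℕ := if i ∈ l then position i l else l.length + i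

theorem newIndex_injective (l : List ℕ) : Function.Injective (newIndex l) := by
  intro i j h
  unfold newIndex at h
  split_ifs at h with hi hj hj
  · exact position_injOn hi hj h
  · have := position_lt hi; omega
  · have := position_lt hj; omega
  · omega

/-- A state of the parser: the stack of the formulas read, the list of all their subformulas, the
list of the names of variables, and the bits of the name that is being read. -/
def parseState (stack table names word : Data) : Data :=
  .cons stack (.cons table (.cons names word))

/-- The formula with main symbol `y` and its arguments on top of the stack `s`, followed by the rest
of the stack. -/
def nodeData (y s : Data) : Data :=
  .ite (.eq y Letter.top.data) (.cons (.cons y .nil) s)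
    (.ite (.eq y Letter.neg.data) (.cons (.cons y s.fst) s.snd)
      (.cons (.cons y (.cons s.fst s.snd.fst)) s.snd.snd))

/-- Put the formula on top of `s` into the table, where `s` is the new stack. -/
def finishData (s table names : Data) : Data :=
  parseState s (.cons s.fst table) names .nil

/-- The list of names `l` with the name `x` added, if it is new. -/
def addName (l x : Data) : Data := .ite (lookupData l x).fst l (.cons x l)

/-- Reading the letter `y` in the state `x`. The code of a formula is read from right to left. -/
def readLetter (x y : Data) : Data :=
  .ite y.fst (parseState x.fst x.snd.fst x.snd.snd.fst (.cons y.snd x.snd.snd.snd))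
    (.ite y (finishData (nodeData y x.fst) x.snd.fst x.snd.snd.fst)
      (finishData (.cons (.cons .nil
          (lookupData (addName x.snd.snd.fst x.snd.snd.snd) x.snd.snd.snd).snd) x.fst)
        x.snd.fst (addName x.snd.snd.fst x.snd.snd.snd)))

/-- The step of the parser, as a function to be folded over the letters; the parameter is not used. -/
def parseStep (z : Data) : Data := readLetter z.snd.fst z.snd.snd

namespace LinSpace

variable {s t l x y : Data → Data}

theorem addName (hl : LinSpace l) (hx : LinSpace x) : LinSpace fun v => addName (l v) (x v) :=
  .ite (lookupData hl hx).fst hl (.cons hx hl)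

theorem nodeData (hy : LinSpace y) (hs : LinSpace s) : LinSpace fun v => nodeData (y v) (s v) :=
  .ite (.deq hy (const _)) (.cons (.cons hy nil) hs)
    (.ite (.deq hy (const _)) (.cons (.cons hy hs.fst) hs.snd)
      (.cons (.cons hy (.cons hs.fst hs.snd.fst)) hs.snd.snd))

theorem finishData (hs : LinSpace s) (ht : LinSpace t) (hl : LinSpace l) :
    LinSpace fun v => finishData (s v) (t v) (l v) :=
  .cons hs (.cons (.cons hs.fst ht) (.cons hl nil))

theorem readLetter (hx : LinSpace x) (hy : LinSpace y) :
    LinSpace fun v => readLetter (x v) (y v) :=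
  .ite hy.fst (.cons hx.fst (.cons hx.snd.fst (.cons hx.snd.snd.fst (.cons hy.snd hx.snd.snd.snd))))
    (.ite hy (finishData (nodeData hy hx.fst) hx.snd.fst hx.snd.snd.fst)
      (finishData (.cons (.cons nil
          (lookupData (addName hx.snd.snd.fst hx.snd.snd.snd) hx.snd.snd.snd).snd) hx.fst)
        hx.snd.fst (addName hx.snd.snd.fst hx.snd.snd.snd)))

theorem parseStep : LinSpace parseStep := readLetter id.snd.fst id.snd.snd

end LinSpace

theorem addName_eq (l : List ℕ) (i : ℕ) :
    addName (ofList (l.map nameData)) (nameData i) = ofList ((l.insert i).map nameData) := by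
  classical
  rw [addName, lookupData_eq, fst_cons, ite_truth]
  by_cases h : i ∈ l
  · rw [if_pos h, List.insert_of_mem h]
  · rw [if_neg h, List.insert_of_not_mem h]; rfl

theorem readLetter_bit (b : Bool) (s t l w : Data) :
    readLetter (parseState s t l w) (Letter.bit b).data =
      parseState s t l (.cons (.bool b) w) := by
  cases b <;> rfl

theorem readLetter_var (l : List ℕ) (i : ℕ) (s t : Data) :
    readLetter (parseState s t (ofList (l.map nameData)) (nameData i)) Letter.var.data =
      parseState (.cons (.cons .nil (unary (position i (l.insert i)))) s)
        (.cons (.cons .nil (unary (position i (l.insert i)))) t)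
        (ofList ((l.insert i).map nameData)) .nil := by
  simp only [readLetter, parseState, Letter.data, finishData, snd_cons, fst, ite_nil,
    addName_eq, lookupData_eq]

theorem readLetter_node (f y s s' l : Data) (T : List Data) (hy : y.fst = .nil) (hy' : y ≠ .nil)
    (h : nodeData y s = .cons f s') :
    readLetter (parseState s (ofList T) l .nil) y =
      parseState (.cons f s') (ofList (f :: T)) l .nil := by
  rw [readLetter, hy, ite_nil, Data.ite, if_neg hy']
  simp only [parseState, finishData, fst_cons, snd_cons, h, ofList_cons]

theorem Folds.size_le {f : Data → Data} {e acc acc' : Data} {B : ℕ} {l : List Data}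
    (h : Folds f e B acc l acc') : acc'.size ≤ B := h.2 ▸ h.1.foldData_le

theorem size_parseState (s t l w : Data) :
    (parseState s t l w).size = s.size + t.size + l.size + w.size + 3 := by
  simp only [parseState, size_cons]; omega

theorem Folds.node {B : ℕ} {acc f y s s' l : Data} {T : List Data} {u : List Data}
    (hy : y.fst = .nil) (hy' : y ≠ .nil) (h : nodeData y s = .cons f s')
    (hu : Folds parseStep .nil B acc u (parseState s (ofList T) l .nil))
    (hB : (parseState (.cons f s') (ofList (f :: T)) l .nil).size ≤ B) :
    Folds parseStep .nil B acc (u ++ [y]) (parseState (.cons f s') (ofList (f :: T)) l .nil) := by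
  refine hu.append (.cons hu.size_le ?_)
  rw [parseStep, snd_cons, fst_cons, snd_cons, readLetter_node f y s s' l T hy hy' h]
  exact .nil hB

theorem folds_bits (b : List Bool) {B : ℕ} (s t l : Data)
    (hB : (parseState s t l .nil).size + 4 * b.length ≤ B) :
    Folds parseStep .nil B (parseState s t l .nil)
      ((b.map Letter.bit).reverse.map Letter.data) (parseState s t l (ofList (b.map Data.bool))) := by
  induction b generalizing B with
  | nil => exact .nil (by simpa using hB)
  | cons x b ih =>
    rw [List.length_cons] at hB
    have h := ih (B := B) (by omega)
    have h' := (ih le_rfl).size_le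
    have hx : (Data.bool x).size ≤ 3 := by cases x <;> simp
    rw [List.map_cons, List.reverse_cons, List.map_append]
    refine h.append (.cons h.size_le ?_)
    rw [parseStep, snd_cons, fst_cons, snd_cons, readLetter_bit]
    refine .nil ?_
    simp only [size_parseState, size_cons] at *
    omega

/-- The parser puts `φ` onto its stack, its subformulas into the table and its variables into the list
of names. Each bit read enlarges the state by at most 4, and each node by at most the size of a
subformula on the stack, that of its copy in the table, and a constant. -/
theorem folds_parseStep (φ : Formula) {ν : ℕ → ℕ} {M B : ℕ} {l : List ℕ} {s : Data}
    {T : List Data} (hν : ∀ i ∈ φ.names l, ν i = position i (φ.names l))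
    (hM : ∀ ψ ∈ φ.subs, (ψ.data ν).size ≤ M)
    (hB : (parseState s (ofList T) (ofList (l.map nameData)) .nil).size +
      (4 * φ.code.length + (2 * M + 8) * φ.weight) ≤ B) :
    Folds parseStep .nil B (parseState s (ofList T) (ofList (l.map nameData)) .nil)
      (φ.code.reverse.map Letter.data)
      (parseState (.cons (φ.data ν) s) (ofList (φ.subs.map (Formula.data ν) ++ T))
        (ofList ((φ.names l).map nameData)) .nil) := by
  induction φ generalizing l s T B with
  | var i =>
    have hi := hν i (by simp [Formula.names])
    have hs := hM _ (Formula.self_mem_subs _)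
    simp only [Formula.names, Formula.code, Formula.weight, List.length_cons, List.length_map,
      List.reverse_cons, List.map_append] at *
    have h := folds_bits (B := B) i.bits s (ofList T) (ofList (l.map nameData)) (by omega)
    have h' := (folds_bits i.bits s (ofList T) (ofList (l.map nameData)) le_rfl).size_le
    refine h.append (.cons h.size_le ?_)
    rw [parseStep, snd_cons, fst_cons, snd_cons]
    have := readLetter_var l i s (ofList T)
    rw [nameData, ← hi] at this
    rw [this]
    refine .nil ?_
    have hl : (ofList ((l.insert i).map nameData)).size ≤
        (ofList (l.map nameData)).size + (ofList (i.bits.map Data.bool)).size + 1 := by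
      by_cases hil : i ∈ l
      · rw [List.insert_of_mem hil]; omega
      · rw [List.insert_of_not_mem hil, List.map_cons, ofList_cons, size_cons, nameData]; omega
    simp only [size_parseState, size_cons, size_nil, Formula.data, Letter.data] at *
    omega
  | top =>
    have hs := hM _ (Formula.self_mem_subs _)
    have h₀ : Folds parseStep .nil B (parseState s (ofList T) (ofList (l.map nameData)) .nil) []
      (parseState s (ofList T) (ofList (l.map nameData)) .nil) := .nil (by omega)
    refine h₀.node rfl (by simp [Letter.data]) ?_ ?_
    · simp [nodeData, Formula.data]
    · simp only [size_parseState, size_cons, ofList_cons, Formula.weight] at *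
      omega
  | neg α ih =>
    have hs := hM _ (Formula.self_mem_subs _)
    simp only [Formula.subs, List.mem_cons, forall_eq_or_imp] at hM
    simp only [Formula.code, Formula.weight, List.length_cons, mul_add, mul_one] at hB
    have h := ih (B := B) (s := s) (T := T) hν hM.2 (by omega)
    have h' := (ih (s := s) (T := T) hν hM.2 le_rfl).size_le
    have e : α.neg.subs.map (Formula.data ν) ++ T =
        α.neg.data ν :: (α.subs.map (Formula.data ν) ++ T) := rfl
    rw [Formula.code, List.reverse_cons, List.map_append, e]
    refine h.node rfl (by simp [Letter.data]) ?_ ?_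
    · simp [nodeData, Formula.data, Letter.data]
    · simp only [size_parseState, size_cons, ofList_cons, Formula.names] at *
      omega
  | and α β ihα ihβ | or α β ihα ihβ | imp α β ihα ihβ =>
    have hs := hM _ (Formula.self_mem_subs _)
    simp only [Formula.subs, List.mem_cons, List.mem_append, or_imp,
      forall_and] at hM
    simp only [Formula.code, Formula.weight, List.length_cons, List.length_append, mul_add,
      mul_one] at hB
    have hνβ : ∀ i ∈ β.names l, ν i = position i (β.names l) := fun i hi => by
      have := α.names_stable hi
      rw [← this.2]; exact hν i this.1
    have h₁ := ihβ (B := B) (s := s) (T := T) hνβ hM.2.2 (by omega)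
    have h₁' := (ihβ (s := s) (T := T) hνβ hM.2.2 le_rfl).size_le
    have h₂ := ihα (B := B) (s := .cons (β.data ν) s) (T := β.subs.map (Formula.data ν) ++ T) hν
      hM.2.1 (by omega)
    have h₂' := (ihα (s := .cons (β.data ν) s) (T := β.subs.map (Formula.data ν) ++ T) hν
      hM.2.1 le_rfl).size_le
    rw [Formula.code, List.reverse_cons, List.reverse_append, List.map_append, List.map_append,
      Formula.subs, List.map_cons (l := α.subs ++ β.subs), List.map_append (l₁ := α.subs),
      List.cons_append, List.append_assoc (as := List.map (Formula.data ν) α.subs)]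
    refine (h₁.append h₂).node rfl (by simp [Letter.data]) ?_ ?_
    · simp [nodeData, Formula.data, Letter.data]
    · simp only [size_parseState, size_cons, ofList_cons, Formula.names] at *
      omega

end WeakNegation

namespace WeakNegation

open Data

/-! ### The space needed -/

/-- If the new indices of variables are at most `K`, then each node of a formula needs at most
`2 * K + 16` cells. -/
theorem Formula.size_data_le (φ : Formula) {ν : ℕ → ℕ} {K : ℕ} {l : List ℕ}
    (hν : ∀ i ∈ φ.names l, ν i ≤ K) :
    ∀ ψ ∈ φ.subs, (ψ.data ν).size ≤ (2 * K + 16) * φ.weight := by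
  induction φ generalizing l with
  | var i =>
    have := hν i (by simp [names])
    simp [subs, data, weight, Letter.data, size_unary]
    omega
  | top => simp [subs, data, weight, Letter.data]
  | neg α ih =>
    have h := ih hν
    have h₀ := h α α.self_mem_subs
    simp only [subs, List.forall_mem_cons, weight, mul_add, mul_one]
    refine ⟨?_, fun ψ hψ => (h ψ hψ).trans (by omega)⟩
    have := Letter.size_data_le .neg
    simp only [data, size_cons]
    omega
  | and α β ihα ihβ | or α β ihα ihβ | imp α β ihα ihβ =>
    have h₁ := ihα hν
    have h₂ := ihβ (l := l) fun i hi => hν i (α.names_stable hi).1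
    have h₁' := h₁ α α.self_mem_subs
    have h₂' := h₂ β β.self_mem_subs
    simp only [subs, List.forall_mem_cons, List.forall_mem_append, weight, mul_add, mul_one]
    refine ⟨?_, fun ψ hψ => (h₁ ψ hψ).trans (by omega), fun ψ hψ => (h₂ ψ hψ).trans (by omega)⟩
    have h₃ := Letter.size_data_le .and
    have h₄ := Letter.size_data_le .or
    have h₅ := Letter.size_data_le .imp
    simp only [data, size_cons]
    omega

theorem size_ofList_le {l : List Data} {M : ℕ} (h : ∀ x ∈ l, x.size ≤ M) :
    (ofList l).size ≤ l.length * (M + 1) + 1 := by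
  induction l with
  | nil => simp
  | cons x l ih =>
    rw [List.forall_mem_cons] at h
    have := ih h.2
    simp only [ofList_cons, size_cons, List.length_cons, add_mul, one_mul]
    omega

theorem size_bits_le (T : List Formula) (p : Formula → Prop) :
    (bits T p).size ≤ 4 * T.length + 1 := by
  have := size_ofList_le (l := T.map fun ψ => truth (p ψ)) (M := 3) (by
    simp only [List.mem_map]; rintro _ ⟨ψ, _, rfl⟩; exact size_truth_le _)
  rw [List.length_map] at this
  rw [bits]; omega

theorem size_callData_le {ν : ℕ → ℕ} {φ : Formula} {M : ℕ}
    (hM : ∀ ψ ∈ φ.subs, (ψ.data ν).size ≤ M) {s : HSequent} (hs : Subformulas φ s) {j k : ℕ}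
    (hj : j ≤ 3 * φ.weight + 2) (hk : k ≤ 2) :
    (callData ν φ.subs s j k).size ≤ M + 14 * φ.weight + 16 := by
  have h₁ := size_bits_le φ.subs (· ∈ s.hist)
  have h₂ := size_bits_le φ.subs (· ∈ s.ctx)
  have h₃ := hM _ hs.goal
  rw [φ.length_subs] at h₁ h₂
  simp only [callData, HSequent.data, size_cons, size_unary]
  omega

/-- The first state of the search, in terms of the last state of the parser. -/
def initialState (x : Data) : Data :=
  .cons x.snd.fst (.cons .nil (.cons (seqData (emptyData x.snd.fst) (emptyData x.snd.fst) x.fst.fst)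
    (.cons .nil .nil)))

theorem LinSpace.initialState : LinSpace initialState :=
  .cons id.snd.fst (.cons nil (.cons (.cons (.emptyData id.snd.fst) (.cons (.emptyData id.snd.fst)
    id.fst.fst)) (.cons nil nil)))

theorem initialState_parseState (ν : ℕ → ℕ) (φ : Formula) (s l w : Data) :
    initialState (parseState (.cons (φ.data ν) s) (tableData ν φ.subs) l w) =
      stateData ν φ.subs .nil (callData ν φ.subs (root φ) 0 0) := by
  simp only [initialState, parseState, fst_cons, snd_cons, emptyData_eq, seqData, stateData,
    callData, HSequent.data, root, Finset.notMem_empty, Multiset.notMem_zero, unary]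

/-- Derivability of `∅ | ∅ ⇒ φ` is decided in the space needed for storing `w ^ 3` calls of size
`O(w ^ 2)` and the code of `φ`. -/
theorem exists_decidableInSpace (L : Calculus) :
    ∃ C : ℕ, DecidableInSpace Formula.code (fun φ => Derivable L (root φ))
      (fun φ => C * (φ.weight ^ 5 + φ.code.length)) := by
  obtain ⟨P₀, k₀, h₀⟩ : LinSpace fun x => .cons .nil (.cons (parseState .nil .nil .nil .nil) x) :=
    .cons .nil (.cons (.const _) .id)
  obtain ⟨P₁, k₁, h₁⟩ := exists_replaces_foldData LinSpace.parseStep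
  obtain ⟨P₂, k₂, h₂⟩ := LinSpace.initialState
  obtain ⟨P₃, k₃, h₃⟩ := exists_replaces_of_iterates LinSpace.searchTest (LinSpace.searchStep L)
  obtain ⟨P₄, k₄, h₄⟩ := LinSpace.id.snd.snd.snd
  refine ⟨5 * ((k₀ + k₁ + k₂ + k₃ + k₄ + 1) * 100), ?_⟩
  have := decidableInSpace_of_run (code := Formula.code) (p := fun φ => Derivable L (root φ))
    (P := .seq readInput (.seq (.seq P₀ (.seq P₁ (.seq P₂ (.seq P₃ P₄)))) writeOutput))
    (fun φ => (k₀ + k₁ + k₂ + k₃ + k₄ + 1) * (100 * (φ.weight ^ 5 + φ.code.length))) ?_ ?_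
  · simpa only [mul_assoc] using this
  · intro φ
    exact le_trans (by omega) (Nat.le_mul_of_pos_left _ (Nat.succ_pos _))
  intro φ
  set w := φ.weight with hw
  set n := φ.code.length with hn
  set B := 100 * (w ^ 5 + n) with hB
  have w₁ : 1 ≤ w := φ.weight_pos
  have w₂ : w ≤ w ^ 2 := Nat.le_self_pow (by norm_num) w
  have w₃ : w ≤ w ^ 3 := Nat.le_self_pow (by norm_num) w
  have w₅ : w ^ 3 ≤ w ^ 5 := Nat.pow_le_pow_right w₁ (by norm_num)
  have w₅' : 1 ≤ w ^ 5 := Nat.one_le_pow _ _ w₁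
  -- The renaming `ν` of the variables that the parser carries out.
  set l := φ.names [] with hl
  set ν := newIndex l with hνl
  have hν : Function.Injective ν := newIndex_injective l
  have hpos : ∀ i ∈ l, ν i = position i l := fun i hi => if_pos hi
  have hM : ∀ ψ ∈ φ.subs, (ψ.data ν).size ≤ 18 * w ^ 2 := by
    intro ψ hψ
    refine (φ.size_data_le (K := w) (l := []) (fun i hi => ?_) ψ hψ).trans ?_
    · have h₁ : position i l < l.length := position_lt hi
      have h₂ : l.length ≤ w + ([] : List ℕ).length := φ.length_names_le []
      rw [hpos i hi]
      simp only [List.length_nil] at h₂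
      omega
    · rw [← hw]; nlinarith
  -- The sizes of the list of subformulas and of a call, and the bound for the parser and the search.
  have htable : (tableData ν φ.subs).size ≤ 19 * w ^ 3 + 1 := by
    have := size_ofList_le (l := φ.subs.map (Formula.data ν)) (M := 18 * w ^ 2) (by
      simp only [List.mem_map]; rintro _ ⟨ψ, hψ, rfl⟩; exact hM ψ hψ)
    rw [List.length_map, φ.length_subs, ← hw] at this
    have e : w * (18 * w ^ 2 + 1) = 18 * w ^ 3 + w := by ring
    rw [e] at this
    rw [tableData]
    omega
  have hcall : ∀ s, Subformulas φ s → ∀ j k, j ≤ 3 * w + 2 → k ≤ 2 →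
      (callData ν φ.subs s j k).size ≤ 48 * w ^ 2 := by
    intro s hs j k hj hk
    have := size_callData_le hM hs hj hk
    omega
  set z := parseState (.cons (φ.data ν) .nil) (tableData ν φ.subs) (ofList (l.map nameData)) .nil
    with hz
  have hparse : Folds parseStep .nil B (parseState .nil .nil .nil .nil)
      (φ.code.reverse.map Letter.data) z := by
    have := folds_parseStep φ (l := []) (s := .nil) (T := []) (B := B) hpos hM (by
      have e : (2 * (18 * w ^ 2) + 8) * w = 36 * w ^ 3 + 8 * w := by ring
      simp only [size_parseState, List.map_nil, ofList_nil, size_nil]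
      rw [← hw, ← hn, e]
      omega)
    rw [List.append_nil] at this
    exact this
  have hletters : ∀ u : List Letter, lettersData u = ofList (u.map Letter.data) := by
    intro u
    induction u with
    | nil => rfl
    | cons x u ih => rw [lettersData, ih]; rfl
  have hsize : (lettersData φ.code.reverse).size ≤ 12 * n + 1 := by
    simpa using size_lettersData_le φ.code.reverse
  set y := stateData ν φ.subs .nil (resultData (Derivable L (root φ))) with hy
  have hroot := rank_root_le φ
  have hrank : rank φ (root φ) * (48 * w ^ 2 + 1) ≤ 49 * w ^ 5 := by
    refine (Nat.mul_le_mul_right _ hroot).trans ?_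
    have e : w ^ 3 * (48 * w ^ 2 + 1) = 48 * w ^ 5 + w ^ 3 := by ring
    rw [← hw, e]
    omega
  have hysize : y.size ≤ B := by
    have := size_truth_le (Derivable L (root φ))
    simp only [hy, stateData, resultData, size_cons, size_nil]
    omega
  have hsearch : Iterates searchTest (searchStep L) B
      (stateData ν φ.subs .nil (callData ν φ.subs (root φ) 0 0)) y := by
    refine iterates_call hν L φ hcall (by omega) (.root φ) ?_ (.done (searchTest_result _ _) hysize)
    simp only [size_nil]
    omega
  set K := k₀ + k₁ + k₂ + k₃ + k₄ + 1 with hK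
  have hmain : Replaces (.seq P₀ (.seq P₁ (.seq P₂ (.seq P₃ P₄)))) (lettersData φ.code.reverse)
      (truth (Derivable L (root φ))) (K * B) := by
    refine .seq ((h₀ _).2.mono (Nat.mul_le_mul (by omega) (by omega))) (.seq (y := z) ?_ (.seq
      ((h₂ z).2.mono (Nat.mul_le_mul (by omega) hparse.size_le)) (.seq (y := y) ?_ ?_)))
    · rw [hletters, ← hparse.2]
      refine (h₁ _ _ _ B ?_ ?_ hparse.1).mono (Nat.mul_le_mul_right _ (by omega))
      · rw [size_nil]; omega
      · rw [← hletters]; omega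
    · rw [hz, initialState_parseState]
      exact (h₃ B _ _ hsearch).mono (Nat.mul_le_mul_right _ (by omega))
    · simpa [hy, stateData, resultData] using
        (h₄ y).2.mono (Nat.mul_le_mul (by omega : k₄ ≤ K) hysize)
  classical
  have hKB : B ≤ K * B := Nat.le_mul_of_pos_left _ (Nat.succ_pos _)
  refine ⟨decide (Derivable L (root φ)), by simp, .seq (run_readInput _ ?_) (.seq ?_
    (run_writeOutput _ ?_))⟩
  · rw [← hn]; omega
  · have := hmain (K * B) [] (by simp)
    rw [List.append_nil, List.append_nil] at this
    convert this using 3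
    by_cases h : Derivable L (root φ) <;> simp [h]
  · omega

end WeakNegation

theorem theorem5p6 (L : WeakNegation.Calculus) :
    -- every branch of a search tree has length at most `w ^ 3`
    (∀ (φ : WeakNegation.Formula) (b : List WeakNegation.HSequent),
      WeakNegation.IsBranch L φ b → b.length ≤ φ.weight ^ 3) ∧
    -- every node of a search tree has at most `2 * w` children
    (∀ (φ : WeakNegation.Formula) (s : WeakNegation.HSequent), WeakNegation.Occurs L φ s →
      {t | WeakNegation.Child L s t}.encard ≤ ((2 * φ.weight : ℕ) : ℕ∞)) ∧
    -- the sequents in a search tree have size `O(w ^ 2)`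
    (∃ C : ℕ, ∀ (φ : WeakNegation.Formula) (s : WeakNegation.HSequent),
      WeakNegation.Occurs L φ s → s.size ≤ C * φ.weight ^ 2) ∧
    -- backwards search terminates, with the right verdict, and stores `O(w ^ 5)` at a time
    (∃ C : ℕ, ∀ φ : WeakNegation.Formula, ∃ (v : Bool) (m : ℕ),
      WeakNegation.Search L (WeakNegation.root φ) v m ∧
      (v = true ↔ WeakNegation.Derivable L (WeakNegation.root φ)) ∧
      m ≤ C * φ.weight ^ 5) ∧
    -- on a Turing machine, `O(w ^ 5)` cells suffice besides those for the input
    (∃ C : ℕ, WeakNegation.DecidableInSpace WeakNegation.Formula.code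
      (fun φ => WeakNegation.Derivable L (WeakNegation.root φ))
      (fun φ => C * (φ.weight ^ 5 + φ.code.length))) := by
  classical
  refine ⟨fun φ b h => WeakNegation.length_branch_le h,
    fun φ s h => WeakNegation.encard_children_le (.of_occurs h),
    ⟨3, fun φ s h => (WeakNegation.Subformulas.of_occurs h).size_le⟩,
    ⟨3, fun φ => ?_⟩, WeakNegation.exists_decidableInSpace L⟩
  obtain ⟨m, hm, hle⟩ := WeakNegation.exists_search (L := L) (.root φ)
  refine ⟨_, m, hm, by simp, hle.trans ?_⟩
  calc _ ≤ 3 * φ.weight ^ 2 * φ.weight ^ 3 :=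
        Nat.mul_le_mul_left _ (WeakNegation.rank_root_le φ)
    _ = 3 * φ.weight ^ 5 := by ring
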